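/- **Theorem 1.1.** Let $V,f\in\mathcal S(\mathbb R)$ be real-valued, with $f$ even and $\|f\|_{L^2(\mathbb R)}=1$, and let $a>0$, $P>0$. For $\varepsilon>0$ consider, in $\mathcal K=L^2(\mathbb R)\otimes L^2(\mathbb R)\otimes\mathbb C^2\cong L^2(\mathbb R^2;\mathbb C^2)$ (first component: spin up, second component: spin down), the self-adjoint operators with domain $H^2(\mathbb R^2;\mathbb C^2)$ $$\mathcal H_0=-\tfrac{\varepsilon^4}{2}(\Delta_1+\Delta_2)\,\mathbb I+\tfrac{\varepsilon}{2}\sigma_3,\qquad \mathcal H=\mathcal H_0+\varepsilon^2\,V\!\left(\tfrac{x_1-a}{\varepsilon}\right)\sigma_2,\qquad \sigma_2=\begin{pmatrix}0&-i\\ i&0\end{pmatrix},\quad \sigma_3=\begin{pmatrix}1&0\\0&-1\end{pmatrix},$$ that is, the two-particle and spin Hamiltonians with unit masses in the scaling $\hbar=\varepsilon^2$, $\omega=\varepsilon^{-1}$, $\gamma=\varepsilon^2$, $\delta=\sigma=\varepsilon$. They generate the strongly continuous unitary groups $\mathcal U_0(t)=e^{-i\frac{t}{\varepsilon^2}\mathcal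 H_0}$ and $\mathcal U(t)=e^{-i\frac{t}{\varepsilon^2}\mathcal H}$. Put $$\phi_{\pm P}(x)=\frac1{\sqrt\varepsilon}f\!\left(\frac x\varepsilon\right)e^{\pm i\frac{P}{\varepsilon^2}x},\qquad \Psi_0=\begin{pmatrix}0\\ N\,(\phi_P\otimes\phi_{-P}+\phi_{-P}\otimes\phi_P)\end{pmatrix},$$ where, with $s_\varepsilon=\int_{\mathbb R}f(y)^2\cos\!\big(\tfrac{2P}{\varepsilon}y\big)\,dy$, $N=(2+2s_\varepsilon^2)^{-1/2}$ is the constant for which $\|\Psi_0\|_{\mathcal K}=1$. Let $$\Psi^{(I)}(x_1,x_2)=N\begin{pmatrix}A(x_1)\,\phi_{-P}(x_2)\\0\end{pmatrix},$$ $$A(x)=-\frac{\sqrt{2\pi}}{P}\,e^{i\frac{a}{\varepsilon P}\left(1+\frac{\varepsilon}{2P^2}\right)}\,\overline{\hat V(P^{-1})}\,\frac1{\sqrt\varepsilon}\,f\!\left(\frac{x-aP^{-2}\varepsilon}{\varepsilon}\right)e^{\frac{i}{\varepsilon^2}(P-\varepsilon P^{-1})x},\qquad \hat V(\xi)=\frac1{\sqrt{2\pi}}\int_{\mathbb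 R}V(x)e^{-i\xi x}\,dx .$$ Fix $t>T_{\rm coll}:=a/P$. Then there are constants $C>0$ and $\varepsilon_0>0$, independent of $\varepsilon$ (they may depend on $t,a,P,f,V$), such that for all $0<\varepsilon<\varepsilon_0$ $$\mathcal U(t)\Psi_0=\mathcal U_0(t)\Psi_0+\varepsilon\,\mathcal U_0(t)\Psi^{(I)}+\mathcal R(t),\qquad \|\mathcal R(t)\|_{\mathcal K}<C\,\varepsilon^2 .$$ The same holds if $N$ is replaced, in both $\Psi_0$ and $\Psi^{(I)}$, by $(2+2s_\varepsilon)^{-1/2}$. -/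

import Mathlib

open MeasureTheory Complex
open scoped SchwartzMap Laplacian ComplexConjugate

noncomputable section

namespace EPR

/-- Configuration space of the two particles; `x 0` and `x 1` are the positions of
particle 1 and of particle 2. -/
abbrev Config := EuclideanSpace ℝ (Fin 2)

/-- `L²(ℝ) ⊗ L²(ℝ) = L²(ℝ²)`. -/
abbrev L2 := Lp ℂ 2 (volume : Measure Config)

/-- `𝒦 = L²(ℝ) ⊗ L²(ℝ) ⊗ ℂ²`, as the Hilbert sum of two copies of `L²(ℝ²)`: the first component
is the spin-up one, the second component is the spin-down one. -/
abbrev StateSpace := WithLp 2 (L2 × L2)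

/-! ### The Hamiltonian -/

/-- The embedding of `L²(ℝ²)` in the tempered distributions. -/
def toDistr : L2 →ₗ[ℂ] 𝓢'(Config, ℂ) :=
  (Lp.toTemperedDistributionCLM ℂ (volume : Measure Config) 2).toLinearMap

theorem toDistr_injective : Function.Injective toDistr :=
  LinearMap.ker_eq_bot.1 (Lp.ker_toTemperedDistributionCLM_eq_bot (F := ℂ) (p := 2))

/-- The Laplacian of tempered distributions on `ℝ²`. -/
def distrLaplacian : 𝓢'(Config, ℂ) →ₗ[ℂ] 𝓢'(Config, ℂ) :=
  (LineDeriv.laplacianCLM ℂ Config 𝓢'(Config, ℂ)).toLinearMap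

/-- The Laplacian `Δ₁ + Δ₂` as an unbounded operator in `L²(ℝ²)`: its domain is the set of the
`u ∈ L²(ℝ²)` whose distributional Laplacian belongs to `L²(ℝ²)`, that is `H²(ℝ²)`. -/
def laplacianOp : L2 →ₗ.[ℂ] L2 where
  domain := (LinearMap.range toDistr).comap (distrLaplacian ∘ₗ toDistr)
  toFun := (LinearEquiv.ofInjective toDistr toDistr_injective).symm.toLinearMap ∘ₗ
    (distrLaplacian ∘ₗ toDistr).restrict (fun _ hu => hu)

theorem mem_laplacianOp_domain (u : L2) :
    u ∈ laplacianOp.domain ↔ ∃ w : L2, (w : 𝓢'(Config, ℂ)) = Δ (u : 𝓢'(Config, ℂ)) := by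
  simp only [laplacianOp, Submodule.mem_comap, LinearMap.mem_range]
  rw [← TemperedDistribution.laplacianCLM_apply]
  rfl

theorem laplacianOp_spec (u : laplacianOp.domain) :
    (laplacianOp u : 𝓢'(Config, ℂ)) = Δ ((u : L2) : 𝓢'(Config, ℂ)) := by
  rw [← TemperedDistribution.laplacianCLM_apply]
  have h := LinearEquiv.apply_symm_apply (LinearEquiv.ofInjective toDistr toDistr_injective)
    ((distrLaplacian ∘ₗ toDistr).restrict (fun _ hu => hu) u)
  exact congrArg Subtype.val h

/-- The scalar operator `-(ħ²/2) (Δ₁ + Δ₂) + μ` on the domain of the Laplacian. -/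
def scalarHamiltonian (ħ μ : ℝ) : laplacianOp.domain →ₗ[ℂ] L2 :=
  (-((ħ : ℂ) ^ 2 / 2)) • laplacianOp.toFun + (μ : ℂ) • laplacianOp.domain.subtype

/-- The free Hamiltonian `ℋ₀ = -(ħ²/2) (Δ₁ + Δ₂) 𝕀 + (ħ ω / 2) σ₃` (unit masses): it acts as
`-(ħ²/2) (Δ₁ + Δ₂) + ħ ω / 2` on the spin-up component and as `-(ħ²/2) (Δ₁ + Δ₂) - ħ ω / 2` on the
spin-down component. -/
def freeHamiltonian (ħ ω : ℝ) : StateSpace →ₗ.[ℂ] StateSpace where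
  domain := laplacianOp.domain.comap (WithLp.fstₗ 2 ℂ L2 L2) ⊓
    laplacianOp.domain.comap (WithLp.sndₗ 2 ℂ L2 L2)
  toFun := (WithLp.linearEquiv 2 ℂ (L2 × L2)).symm.toLinearMap ∘ₗ
    LinearMap.prod
      (scalarHamiltonian ħ (ħ * ω / 2) ∘ₗ (WithLp.fstₗ 2 ℂ L2 L2).restrict (fun _ h => h.1))
      (scalarHamiltonian ħ (-(ħ * ω / 2)) ∘ₗ (WithLp.sndₗ 2 ℂ L2 L2).restrict (fun _ h => h.2))

theorem freeHamiltonian_apply (ħ ω : ℝ) (Ψ : (freeHamiltonian ħ ω).domain) :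
    freeHamiltonian ħ ω Ψ = WithLp.toLp 2
      ((-((ħ : ℂ) ^ 2 / 2)) • laplacianOp ⟨(Ψ : StateSpace).fst, Ψ.2.1⟩
          + ((ħ * ω / 2 : ℝ) : ℂ) • (Ψ : StateSpace).fst,
       (-((ħ : ℂ) ^ 2 / 2)) • laplacianOp ⟨(Ψ : StateSpace).snd, Ψ.2.2⟩
          + ((-(ħ * ω / 2) : ℝ) : ℂ) • (Ψ : StateSpace).snd) :=
  rfl

/-- The function `x ↦ V ((x₁ - a) / δ)` on the configuration space. -/
def potential (V : 𝓢(ℝ, ℝ)) (a δ : ℝ) (x : Config) : ℂ := V ((x 0 - a) / δ)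

theorem potential_mul_memLp (V : 𝓢(ℝ, ℝ)) (a δ : ℝ) (u : L2) :
    MemLp (fun x => potential V a δ x * u x) 2 (volume : Measure Config) := by
  have hc : Continuous (potential V a δ) := by
    unfold potential
    have h0 : Continuous fun x : Config => (x 0 - a) / δ := by fun_prop
    exact continuous_ofReal.comp (V.continuous.comp h0)
  have hV : MemLp (potential V a δ) ⊤ (volume : Measure Config) :=
    memLp_top_of_bound hc.aestronglyMeasurable (SchwartzMap.seminorm ℝ 0 0 V)
      (Filter.Eventually.of_forall fun x => by
        simpa [potential] using SchwartzMap.norm_le_seminorm ℝ V ((x 0 - a) / δ))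
  exact (Lp.memLp u).mul hV

/-- Multiplication by `V ((x₁ - a) / δ)` in `L²(ℝ²)`. -/
def potentialOp (V : 𝓢(ℝ, ℝ)) (a δ : ℝ) : L2 →ₗ[ℂ] L2 where
  toFun u := (potential_mul_memLp V a δ u).toLp
  map_add' u v := by
    rw [← MemLp.toLp_add]
    refine MemLp.toLp_congr _ _ ?_
    filter_upwards [Lp.coeFn_add u v] with x hx
    rw [hx, Pi.add_apply, Pi.add_apply, mul_add]
  map_smul' c u := by
    rw [RingHom.id_apply, ← MemLp.toLp_const_smul]
    refine MemLp.toLp_congr _ _ ?_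
    filter_upwards [Lp.coeFn_smul c u] with x hx
    rw [hx, Pi.smul_apply, Pi.smul_apply, smul_eq_mul, smul_eq_mul, mul_left_comm]

/-- The interaction `γ V ((x₁ - a) / δ) σ₂`, with `σ₂ (u, d) = (-i d, i u)`. -/
def interaction (V : 𝓢(ℝ, ℝ)) (a γ δ : ℝ) : StateSpace →ₗ[ℂ] StateSpace :=
  (γ : ℂ) • ((WithLp.linearEquiv 2 ℂ (L2 × L2)).symm.toLinearMap ∘ₗ
    LinearMap.prod
      ((-I) • (potentialOp V a δ ∘ₗ WithLp.sndₗ 2 ℂ L2 L2))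
      (I • (potentialOp V a δ ∘ₗ WithLp.fstₗ 2 ℂ L2 L2)))

theorem interaction_apply (V : 𝓢(ℝ, ℝ)) (a γ δ : ℝ) (Ψ : StateSpace) :
    interaction V a γ δ Ψ = (γ : ℂ) • WithLp.toLp 2
      ((-I) • potentialOp V a δ Ψ.snd, I • potentialOp V a δ Ψ.fst) :=
  rfl

/-- The Hamiltonian `ℋ = ℋ₀ + γ V ((x₁ - a) / δ) σ₂`, with the same domain as `ℋ₀`. -/
def hamiltonian (V : 𝓢(ℝ, ℝ)) (a ħ ω γ δ : ℝ) : StateSpace →ₗ.[ℂ] StateSpace :=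
  interaction V a γ δ +ᵥ freeHamiltonian ħ ω

/-- `ℋ₀` in the scaling `ħ = ε²`, `ω = ε⁻¹`. -/
def scaledFreeHamiltonian (ε : ℝ) : StateSpace →ₗ.[ℂ] StateSpace :=
  freeHamiltonian (ε ^ 2) ε⁻¹

/-- `ℋ` in the scaling `ħ = ε²`, `ω = ε⁻¹`, `γ = ε²`, `δ = ε`. -/
def scaledHamiltonian (V : 𝓢(ℝ, ℝ)) (a ε : ℝ) : StateSpace →ₗ.[ℂ] StateSpace :=
  hamiltonian V a (ε ^ 2) ε⁻¹ (ε ^ 2) ε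

/-! ### Unitary propagators -/

/-- `U` is the strongly continuous one-parameter unitary group `t ↦ exp (-i t H / ħ)`: its
infinitesimal generator (on its full domain) is `-(i / ħ) H`. -/
structure IsPropagator (ħ : ℝ) (H : StateSpace →ₗ.[ℂ] StateSpace)
    (U : ℝ → StateSpace ≃ₗᵢ[ℂ] StateSpace) : Prop where
  zero : ∀ Ψ, U 0 Ψ = Ψ
  add : ∀ s t Ψ, U (s + t) Ψ = U s (U t Ψ)
  continuous : ∀ Ψ, Continuous fun t => U t Ψ
  generator : ∀ Ψ Φ, HasDerivAt (fun t => U t Ψ) Φ 0 ↔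
    ∃ h : Ψ ∈ H.domain, Φ = (-(I / (ħ : ℂ))) • H ⟨Ψ, h⟩

/-- The propagator `exp (-i t H / ħ)`: the unitary group generated by `H` (a unitary group is
determined by its generator). -/
def propagator (ħ : ℝ) (H : StateSpace →ₗ.[ℂ] StateSpace) : ℝ → StateSpace ≃ₗᵢ[ℂ] StateSpace :=
  Classical.epsilon (IsPropagator ħ H)

/-! ### Wave packets -/

/-- The wave packet `σ^{-1/2} f ((x - q) / σ) exp (i k x)`. -/
def wavePacket (f : 𝓢(ℝ, ℝ)) (σ q k : ℝ) (x : ℝ) : ℂ :=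
  ((1 / √σ : ℝ) : ℂ) * (f ((x - q) / σ) : ℂ) * exp (I * (k : ℂ) * (x : ℂ))

theorem wavePacket_memLp (f : 𝓢(ℝ, ℝ)) (σ q k : ℝ) : MemLp (wavePacket f σ q k) 2 := by
  rcases le_or_gt σ 0 with hσ | hσ
  · have : wavePacket f σ q k = fun _ => 0 := by
      funext x
      simp [wavePacket, Real.sqrt_eq_zero_of_nonpos hσ]
    rw [this]
    exact MemLp.zero
  have hf : MemLp (fun x => f ((x - q) / σ)) 2 := by
    have h0 : Continuous fun x : ℝ => f ((x - q) / σ) := f.continuous.comp (by fun_prop)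
    rw [memLp_two_iff_integrable_sq h0.aestronglyMeasurable]
    have h1 : Integrable (fun x => f x ^ 2) :=
      (memLp_two_iff_integrable_sq f.continuous.aestronglyMeasurable).1 (f.memLp 2)
    exact (h1.comp_div hσ.ne').comp_sub_right q
  have hm : Continuous (wavePacket f σ q k) := by
    have h0 : Continuous fun x : ℝ => f ((x - q) / σ) := f.continuous.comp (by fun_prop)
    unfold wavePacket
    fun_prop
  refine (hf.const_mul (1 / √σ)).congr_norm hm.aestronglyMeasurable
    (Filter.Eventually.of_forall fun x => ?_)
  have he : ‖exp (I * (k : ℂ) * (x : ℂ))‖ = 1 := by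
    rw [mul_assoc, mul_comm, ← ofReal_mul]
    exact norm_exp_ofReal_mul_I _
  rw [wavePacket, norm_mul, norm_mul, he, mul_one, norm_mul, norm_real, norm_real]

theorem tensor_memLp {g h : ℝ → ℂ} (hg : MemLp g 2) (hh : MemLp h 2) :
    MemLp (fun x : Config => g (x 0) * h (x 1)) 2 (volume : Measure Config) := by
  have hm : MeasurePreserving (fun x : Config => (x 0, x 1)) :=
    (volume_preserving_finTwoArrow ℝ).comp (PiLp.volume_preserving_ofLp (Fin 2))
  have hg1 := hg.1.comp_fst (ν := (volume : Measure ℝ))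
  have hh1 := hh.1.comp_snd (μ := (volume : Measure ℝ))
  have hgh : MemLp (fun z : ℝ × ℝ => g z.1 * h z.2) 2 (volume : Measure (ℝ × ℝ)) := by
    refine (memLp_two_iff_integrable_sq_norm (hg1.mul hh1)).2 ?_
    have := ((memLp_two_iff_integrable_sq_norm hg.1).1 hg).mul_prod
      ((memLp_two_iff_integrable_sq_norm hh.1).1 hh)
    simpa only [Pi.mul_apply, norm_mul, mul_pow] using this
  exact hgh.comp_measurePreserving hm

/-- `g ⊗ h`, that is `(x₁, x₂) ↦ g (x₁) h (x₂)`, as an element of `L²(ℝ²)`. -/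
def tensor {g h : ℝ → ℂ} (hg : MemLp g 2) (hh : MemLp h 2) : L2 := (tensor_memLp hg hh).toLp

/-- `φ_P (x) = σ^{-1/2} f (x / σ) exp (i P x / ħ)`. -/
def phi (f : 𝓢(ℝ, ℝ)) (ħ σ P : ℝ) : ℝ → ℂ := wavePacket f σ 0 (P / ħ)

theorem phi_memLp (f : 𝓢(ℝ, ℝ)) (ħ σ P : ℝ) : MemLp (phi f ħ σ P) 2 := wavePacket_memLp f _ _ _

/-- The initial state: spin down, and the two particles in the state
`N (φ_P ⊗ φ_{-P} + φ_{-P} ⊗ φ_P)`. -/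
def initialState (f : 𝓢(ℝ, ℝ)) (ħ σ P N : ℝ) : StateSpace :=
  WithLp.toLp 2 (0, (N : ℂ) •
    (tensor (phi_memLp f ħ σ P) (phi_memLp f ħ σ (-P))
      + tensor (phi_memLp f ħ σ (-P)) (phi_memLp f ħ σ P)))

/-- The overlap `∫ f(y)² cos (2 σ P y / ħ) dy`, equal to `⟨φ_P, φ_{-P}⟩` for even `f`. -/
def overlap (f : 𝓢(ℝ, ℝ)) (ħ σ P : ℝ) : ℝ := ∫ y, f y ^ 2 * Real.cos (2 * σ * P / ħ * y)

/-- The constant that makes the initial state a unit vector. -/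
def normFactor (f : 𝓢(ℝ, ℝ)) (ħ σ P : ℝ) : ℝ := (2 + 2 * overlap f ħ σ P ^ 2) ^ (-(1 / 2) : ℝ)

/-- The variant of the normalization constant in which the overlap is not squared. -/
def normFactor' (f : 𝓢(ℝ, ℝ)) (ħ σ P : ℝ) : ℝ := (2 + 2 * overlap f ħ σ P) ^ (-(1 / 2) : ℝ)

/-- The unitary Fourier transform `(2 π)^{-1/2} ∫ V(x) exp (-i ξ x) dx`. -/
def fourierHat (V : 𝓢(ℝ, ℝ)) (ξ : ℝ) : ℂ :=
  ((1 / √(2 * Real.pi) : ℝ) : ℂ) * ∫ x : ℝ, (V x : ℂ) * exp (-(I * (ξ : ℂ) * (x : ℂ)))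

/-- The outgoing wave packet `A` of particle 1. -/
def outgoing (V f : 𝓢(ℝ, ℝ)) (a P ε : ℝ) (x : ℝ) : ℂ :=
  -((√(2 * Real.pi) / P : ℝ) : ℂ)
    * exp (I * ((a / (ε * P) * (1 + ε / (2 * P ^ 2)) : ℝ) : ℂ))
    * conj (fourierHat V P⁻¹)
    * wavePacket f ε (a / P ^ 2 * ε) ((P - ε * P⁻¹) / ε ^ 2) x

theorem outgoing_memLp (V f : 𝓢(ℝ, ℝ)) (a P ε : ℝ) : MemLp (outgoing V f a P ε) 2 :=
  (wavePacket_memLp f ε (a / P ^ 2 * ε) ((P - ε * P⁻¹) / ε ^ 2)).const_mul _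

/-- The first-order state `Ψ^{(I)}`: spin up, and the two particles in the product state
`N A ⊗ φ_{-P}`. -/
def firstOrderState (V f : 𝓢(ℝ, ℝ)) (a P N ε : ℝ) : StateSpace :=
  WithLp.toLp 2 ((N : ℂ) •
    tensor (outgoing_memLp V f a P ε) (phi_memLp f (ε ^ 2) ε (-P)), 0)

end EPR

end

/-! Both propagators are identified first. In Fourier variables the free one multiplies by
unimodular phases, and its generator is computed with its exact domain (`isPropagator_stateGroup`).
The interaction, divided by `iħ`, is bounded and skew-adjoint, so a Dyson series in the interaction
picture gives the full group, with the same domain (`exists_unitaryGroup_perturbation`). A unitary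
group is determined by its generator, so these are the groups selected by `propagator`.

The expansion rests on one explicit approximate solution `y` of the interaction-picture equation: if
its residual is at most `b'`, the exact evolution of `y 0` and the free evolution of `y T` differ by
at most `b T - b 0` (`norm_evolution_sub_le`). The spin-down part of `y` stays at its initial value;
the spin-up part, `correction`, integrates a simplified forcing.

By Galilean covariance (`freeSchwartz_packet`), a packet of momentum `±P` travels at speed `P` while
its rescaled profile evolves by a group independent of `ε`. In the profile variable the `+P` packet
sees the potential `V(x + ρ)` with `ρ = (s P - a) / ε`; the `-P` packet stays at rescaled distance
at least `a / ε` and contributes `O(ε²)`. Since the `+P` packet interacts only while `|s - a / P|`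
is of order `ε`, its profile evolution may be frozen at the collision time `a / P`, with error `O(ε
/ (1 + ρ²))` (`exists_nrm_interaction_picture_sub_le`). After freezing, the spin phase `exp (i s /
ε)` makes the forcing an exact `ρ`-derivative of a primitive of `exp (i z / P) V(z) / P`, times `exp
(-i x / P)`, the momentum lost by the particle (`modul_shiftMul_transition`). The change of
variables `ds = (ε / P) dρ` gives the prefactor `ε`. The back-reaction on the spin-down part is also
`O(ε / (1 + ρ²))`, and the time integral of `ε / (1 + ρ²)` is at most `π ε² / P`.

The primitive tends to `0` at `-∞` and to the full integral at `+∞`, with error `O(1 / |ρ|)`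
(`exists_nrm_primMul_le`). At times `0` and `t` this is `O(ε)`, hence `O(ε²)` with the prefactor.
The full integral is the Fourier amplitude in `A`, and conjugating `exp (-i x / P)` by the free
evolution up to `a / P` yields the displacement and phase of `A` (`outgoing_eq`). -/

noncomputable section

namespace EPR

open Filter Topology
open scoped BoundedContinuousFunction FourierTransform LineDeriv

/-! ### One-parameter unitary groups -/

section UnitaryGroup

variable {H : Type*} [NormedAddCommGroup H] [InnerProductSpace ℂ H] [NormedSpace ℝ H]
  [IsScalarTower ℝ ℂ H]

/-- Strongly continuous one-parameter unitary groups. -/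
structure IsUnitaryGroup (U : ℝ → H ≃ₗᵢ[ℂ] H) : Prop where
  zero : ∀ x, U 0 x = x
  add : ∀ s t x, U (s + t) x = U s (U t x)
  continuous : ∀ x, Continuous fun t => U t x

theorem isometry_real_smul (e : H ≃ₗᵢ[ℂ] H) (r : ℝ) (x : H) : e (r • x) = r • e x :=
  e.toContinuousLinearEquiv.toContinuousLinearMap.map_smul_of_tower r x

/-- Product rule for a strongly continuous family of isometries applied to a curve. -/
theorem hasDerivAt_isometry_apply {Z : ℝ → H ≃ₗᵢ[ℂ] H} {g : ℝ → H} {g' Φ : H} {t : ℝ}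
    (hZ : ContinuousAt (fun h => Z h g') t) (hg : HasDerivAt g g' t)
    (hΦ : HasDerivAt (fun h => Z h (g t)) Φ t) :
    HasDerivAt (fun h => Z h (g h)) (Φ + Z t g') t := by
  -- The scalar factor vanishes at `t`, so continuity of `Z h g'` replaces its differentiability.
  have h1 : HasDerivAt (fun h => (h - t) • Z h g') (Z t g') t := by
    rw [hasDerivAt_iff_tendsto_slope]
    have : Tendsto (fun h => Z h g') (𝓝[≠] t) (𝓝 (Z t g')) := hZ.tendsto.mono_left nhdsWithin_le_nhds
    refine this.congr' ?_
    filter_upwards [self_mem_nhdsWithin] with h hh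
    have : h - t ≠ 0 := sub_ne_zero.2 hh
    rw [slope_def_module, sub_self, zero_smul, sub_zero, smul_smul, inv_mul_cancel₀ this, one_smul]
  -- Isometries preserve the norm of the Taylor remainder, so no uniform control of `Z` is required.
  have h2 : HasDerivAt (fun h => Z h (g h - g t - (h - t) • g')) 0 t := by
    rw [hasDerivAt_iff_isLittleO] at hg ⊢
    refine (Asymptotics.isLittleO_norm_left.1 ?_)
    refine (Asymptotics.isLittleO_norm_left.2 hg).congr (fun h => ?_) (fun h => rfl)
    simp only [sub_self, zero_smul, sub_zero, map_zero, smul_zero, LinearIsometryEquiv.norm_map]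
  convert (hΦ.add h1).add h2 using 1
  · funext h
    simp only [Pi.add_apply, map_sub, isometry_real_smul]
    abel
  · abel

omit [NormedSpace ℝ H] [IsScalarTower ℝ ℂ H] in
/-- A strongly continuous family of isometries applied to a continuous curve. -/
theorem continuous_isometry_apply {Z : ℝ → H ≃ₗᵢ[ℂ] H} {g : ℝ → H}
    (hZ : ∀ x, Continuous fun t => Z t x) (hg : Continuous g) :
    Continuous fun t => Z t (g t) := by
  rw [continuous_iff_continuousAt]
  intro t
  have h1 : Tendsto (fun s => Z s (g s - g t)) (𝓝 t) (𝓝 0) := by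
    rw [tendsto_zero_iff_norm_tendsto_zero]
    simp only [LinearIsometryEquiv.norm_map]
    rw [← tendsto_zero_iff_norm_tendsto_zero]
    have := (hg.tendsto t).sub_const (g t)
    rwa [sub_self] at this
  have h2 := ((hZ (g t)).tendsto t).add h1
  rw [add_zero] at h2
  refine h2.congr fun s => ?_
  simp

omit [InnerProductSpace ℂ H] [IsScalarTower ℝ ℂ H] in
theorem hasDerivAt_of_shift {f : ℝ → H} {f' : H} {t : ℝ}
    (h : HasDerivAt (fun s => f (t + s)) f' 0) : HasDerivAt f f' t := by
  have h1 : HasDerivAt (fun s => f (t + s)) f' (t - t) := by rwa [sub_self]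
  have := h1.comp_sub_const t t
  simpa using this

theorem hasDerivAt_isometry {g : ℝ → H} {g' : H} {t : ℝ} (e : H ≃ₗᵢ[ℂ] H)
    (h : HasDerivAt g g' t) : HasDerivAt (fun s => e (g s)) (e g') t :=
  (e.toContinuousLinearEquiv.toContinuousLinearMap.restrictScalars ℝ).hasFDerivAt.comp_hasDerivAt
    t h

namespace IsUnitaryGroup

variable {U U' : ℝ → H ≃ₗᵢ[ℂ] H}

omit [NormedSpace ℝ H] [IsScalarTower ℝ ℂ H] in
theorem neg_apply (hU : IsUnitaryGroup U) (t : ℝ) (x : H) : U (-t) (U t x) = x := by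
  rw [← hU.add, neg_add_cancel, hU.zero]

omit [NormedSpace ℝ H] [IsScalarTower ℝ ℂ H] in
theorem apply_neg (hU : IsUnitaryGroup U) (t : ℝ) (x : H) : U t (U (-t) x) = x := by
  rw [← hU.add, add_neg_cancel, hU.zero]

omit [NormedSpace ℝ H] [IsScalarTower ℝ ℂ H] in
theorem continuous_neg (hU : IsUnitaryGroup U) (x : H) : Continuous fun t => U (-t) x :=
  (hU.continuous x).comp (_root_.ContinuousNeg.continuous_neg)

theorem hasDerivAt_apply (hU : IsUnitaryGroup U) {x Φ : H}
    (h : HasDerivAt (fun t => U t x) Φ 0) (t : ℝ) : HasDerivAt (fun t => U t x) (U t Φ) t := by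
  refine hasDerivAt_of_shift ?_
  simp only [hU.add]
  exact hasDerivAt_isometry (U t) h

omit [IsScalarTower ℝ ℂ H] in
theorem hasDerivAt_neg (_hU : IsUnitaryGroup U) {x Φ : H}
    (h : HasDerivAt (fun t => U t x) Φ 0) : HasDerivAt (fun t => U (-t) x) (-Φ) 0 := by
  have h' : HasDerivAt (fun t => U t x) Φ (-0) := by rwa [neg_zero]
  have := h'.scomp (0 : ℝ) (_root_.hasDerivAt_neg (0 : ℝ))
  rwa [neg_one_smul] at this

omit [NormedSpace ℝ H] [IsScalarTower ℝ ℂ H] in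
theorem apply_comm (hU : IsUnitaryGroup U) (s t : ℝ) (x : H) : U s (U t x) = U t (U s x) := by
  rw [← hU.add, ← hU.add, add_comm]

/-- The domain of the generator is dense. -/
theorem dense_domain [CompleteSpace H] (hU : IsUnitaryGroup U) :
    Dense {x : H | ∃ Φ, HasDerivAt (fun t => U t x) Φ 0} := by
  intro x
  have hi : ∀ a b, IntervalIntegrable (fun s => U s x) volume a b :=
    fun a b => (hU.continuous x).intervalIntegrable a b
  have hd : ∀ b, HasDerivAt (fun t => ∫ s in (0 : ℝ)..t, U s x) (U b x) b := fun b =>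
    intervalIntegral.integral_hasDerivAt_right (hi _ _)
      (hU.continuous x).aestronglyMeasurable.stronglyMeasurableAtFilter (hU.continuous x).continuousAt
  -- Time averages of an orbit lie in the domain and converge to its starting point.
  have hlim : Tendsto (fun h : ℝ => h⁻¹ • ∫ s in (0 : ℝ)..h, U s x) (𝓝[≠] 0) (𝓝 x) := by
    have := (hasDerivAt_iff_tendsto_slope.1 (hd 0))
    rw [hU.zero] at this
    refine this.congr fun h => ?_
    simp [slope_def_module]
  refine mem_closure_of_tendsto hlim (Eventually.of_forall fun h => ?_)
  -- The case `h = 0` is harmless: with `0⁻¹ = 0` the average and its derivative are both zero.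
  refine ⟨h⁻¹ • (U h x - x), ?_⟩
  have key : ∀ t, U t (∫ s in (0 : ℝ)..h, U s x) =
      (∫ s in (0 : ℝ)..(t + h), U s x) - ∫ s in (0 : ℝ)..t, U s x := by
    intro t
    rw [intervalIntegral.integral_interval_sub_left (hi _ _) (hi _ _)]
    have := ((U t).toContinuousLinearEquiv.toContinuousLinearMap).intervalIntegral_comp_comm
      (hi 0 h)
    have h2 : U t (∫ s in (0 : ℝ)..h, U s x) = ∫ s in (0 : ℝ)..h, U t (U s x) := this.symm
    rw [h2]
    simp only [← hU.add]
    rw [intervalIntegral.integral_comp_add_left (fun s => U s x) t, add_zero]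
  have h3 : HasDerivAt (fun t => (∫ s in (0 : ℝ)..(t + h), U s x) - ∫ s in (0 : ℝ)..t, U s x)
      (U h x - x) 0 := by
    have h4 := (hd (0 + h)).comp_add_const 0 h
    have h5 := h4.sub (hd 0)
    rw [zero_add, hU.zero] at h5
    exact h5
  have h6 := h3.const_smul h⁻¹
  convert h6 using 1
  funext t
  rw [isometry_real_smul, key]
  rfl

omit [NormedSpace ℝ H] [IsScalarTower ℝ ℂ H] in
theorem trans_continuous (hU : IsUnitaryGroup U) (hU' : IsUnitaryGroup U') (x : H) :
    Continuous fun t => U (-t) (U' t x) :=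
  continuous_isometry_apply (Z := fun t => U (-t)) hU.continuous_neg (hU'.continuous x)

/-- A unitary group is determined by its generator. -/
theorem eq_of_generator [CompleteSpace H] (hU : IsUnitaryGroup U) (hU' : IsUnitaryGroup U')
    (h : ∀ x Φ, HasDerivAt (fun t => U t x) Φ 0 → HasDerivAt (fun t => U' t x) Φ 0) : U = U' := by
  have key : ∀ x, (∃ Φ, HasDerivAt (fun t => U t x) Φ 0) → ∀ t, U t x = U' t x := by
    rintro x ⟨Φ, hΦ⟩ t
    -- Forward by `U`, back by `U'`: the common generator makes this curve constant.
    have hd : ∀ s, HasDerivAt (fun s => U' (-s) (U s x)) 0 s := by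
      intro s
      refine hasDerivAt_of_shift ?_
      have h1 : HasDerivAt (fun r => U r (U s x)) (U s Φ) 0 := by
        simp only [fun r => hU.apply_comm r s x]
        exact hasDerivAt_isometry (U s) hΦ
      have h2 := hU'.hasDerivAt_neg (h _ _ h1)
      have h3 := hasDerivAt_isometry_apply (Z := fun r => U' (-r)) (g := fun r => U r (U s x))
        (hU'.continuous_neg _).continuousAt h1 (by simpa only [hU.zero] using h2)
      simp only [neg_zero, hU'.zero, neg_add_cancel] at h3
      have h4 := hasDerivAt_isometry (U' (-s)) h3
      rw [map_zero] at h4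
      convert h4 using 1
      funext r
      rw [neg_add, hU'.add, add_comm s r, hU.add]
    have := is_const_of_deriv_eq_zero (fun s => (hd s).differentiableAt) (fun s => (hd s).deriv) t 0
    simp only [neg_zero, hU.zero, hU'.zero] at this
    rw [← hU'.apply_neg t (U t x), this]
  funext t
  ext x
  have hc := Continuous.ext_on hU.dense_domain (U t).continuous (U' t).continuous
    (fun x hx => key x hx t)
  exact congrFun hc x

end IsUnitaryGroup

/-- Comparison of an approximate solution in the interaction picture with the exact evolution. -/
theorem norm_evolution_sub_le {U U₀ : ℝ → H ≃ₗᵢ[ℂ] H} (hU : IsUnitaryGroup U)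
    (hU₀ : IsUnitaryGroup U₀) {B : H → H}
    (hB : ∀ x, HasDerivAt (fun t => U (-t) (U₀ t x)) (B x) 0)
    {y y' : ℝ → H} (hy : ∀ s, HasDerivAt y (y' s) s) {b b' : ℝ → ℝ}
    (hb : ∀ s, HasDerivAt b (b' s) s) {T : ℝ} (hT : 0 ≤ T)
    (hbound : ∀ s, 0 ≤ s → s ≤ T → ‖y' s + U₀ (-s) (B (U₀ s (y s)))‖ ≤ b' s) :
    ‖U T (y 0) - U₀ T (y T)‖ ≤ b T - b 0 := by
  -- Undoing the exact evolution turns the residual of `y` into a derivative, up to isometries that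
  -- do not change its norm.
  have hd : ∀ s, HasDerivAt (fun s => U (-s) (U₀ s (y s)))
      (U (-s) (B (U₀ s (y s)) + U₀ s (y' s))) s := by
    intro s
    refine hasDerivAt_of_shift ?_
    have h1 : HasDerivAt (fun r => U₀ s (y (s + r))) (U₀ s (y' s)) 0 := by
      have : HasDerivAt y (y' s) (s + 0) := by simpa using hy s
      exact hasDerivAt_isometry (U₀ s) (this.comp_const_add s 0)
    have h2 := hasDerivAt_isometry_apply (Z := fun r => (U₀ r).trans (U (-r)))
      (hU.trans_continuous hU₀ _).continuousAt h1
      (by simpa only [add_zero, LinearIsometryEquiv.trans_apply] using hB (U₀ s (y s)))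
    simp only [LinearIsometryEquiv.trans_apply, neg_zero, hU.zero, hU₀.zero] at h2
    have h3 := hasDerivAt_isometry (U (-s)) h2
    convert h3 using 1
    funext r
    rw [neg_add, hU.add, add_comm s r, hU₀.add]
  have key := image_norm_le_of_norm_deriv_right_le_deriv_boundary
    (f := fun s => U (-s) (U₀ s (y s)) - y 0) (a := 0) (b := T) (B := fun s => b s - b 0) (B' := b')
    (f' := fun s => U (-s) (B (U₀ s (y s)) + U₀ s (y' s)))
    (fun s _ => ((hd s).continuousAt.continuousWithinAt).sub continuousWithinAt_const)
    (fun s _ => ((hd s).sub_const _).hasDerivWithinAt)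
    (by simp [hU.zero, hU₀.zero]) (fun s => (hb s).sub_const _)
    (fun s hs => by
      rw [LinearIsometryEquiv.norm_map, ← (U₀ (-s)).norm_map, map_add, hU₀.neg_apply, add_comm]
      exact hbound s hs.1 hs.2.le) (Set.right_mem_Icc.2 hT)
  rw [norm_sub_rev, ← (U (-T)).norm_map, map_sub, hU.neg_apply]
  exact key

omit [IsScalarTower ℝ ℂ H] in
/-- Convergence of the interaction picture of a bounded skew perturbation: the initial value
problem `w' = Z(t)⁻¹ B Z(t) w`. -/
theorem exists_interaction_solution [CompleteSpace H] {U₀ : ℝ → H ≃ₗᵢ[ℂ] H}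
    (hU₀ : IsUnitaryGroup U₀) (B : H →L[ℂ] H) (x : H) :
    ∃ w : ℝ → H, w 0 = x ∧ ∀ t, HasDerivAt w (U₀ (-t) (B (U₀ t (w t)))) t := by
  set G : ℝ → H → H := fun t v => U₀ (-t) (B (U₀ t v)) with hG
  have hGc : ∀ g : ℝ → H, Continuous g → Continuous fun t => G t (g t) := fun g hg =>
    continuous_isometry_apply (Z := fun t => U₀ (-t)) hU₀.continuous_neg
      (B.continuous.comp (continuous_isometry_apply hU₀.continuous hg))
  have hGn : ∀ t v, ‖G t v‖ ≤ ‖B‖ * ‖v‖ := fun t v => by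
    simpa [hG] using B.le_opNorm (U₀ t v)
  -- The terms of the Dyson series: each is the time integral of `G` applied to the previous one.
  let w : ℕ → ℝ → H := fun n => Nat.rec (fun _ => x) (fun _ v t => ∫ s in (0 : ℝ)..t, G s (v s)) n
  have w0 : w 0 = fun _ => x := rfl
  have wsucc : ∀ n, w (n + 1) = fun t => ∫ s in (0 : ℝ)..t, G s (w n s) := fun n => rfl
  have hder : ∀ n, Continuous (w n) → ∀ t, HasDerivAt (w (n + 1)) (G t (w n t)) t := by
    intro n hn t
    rw [wsucc]
    exact intervalIntegral.integral_hasDerivAt_right ((hGc _ hn).intervalIntegrable _ _)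
      (hGc _ hn).aestronglyMeasurable.stronglyMeasurableAtFilter (hGc _ hn).continuousAt
  have hcont : ∀ n, Continuous (w n) := by
    intro n
    induction n with
    | zero => rw [w0]; exact continuous_const
    | succ n ih => exact continuous_iff_continuousAt.2 fun t => (hder n ih t).continuousAt
  have hbd : ∀ n t, ‖w n t‖ ≤ ‖x‖ * ((‖B‖ * |t|) ^ n / n.factorial) := by
    intro n
    induction n with
    | zero => intro t; simp [w0]
    | succ n ih =>
      intro t
      rw [wsucc]
      have h1 : ‖∫ s in (0 : ℝ)..t, G s (w n s)‖ ≤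
          ∫ s in Set.uIoc 0 t, ‖B‖ * (‖x‖ * ((‖B‖ * |s - 0|) ^ n / n.factorial)) := by
        refine (intervalIntegral.norm_integral_le_integral_norm_uIoc).trans ?_
        refine setIntegral_mono_on ?_ ?_ measurableSet_uIoc fun s _ => ?_
        · exact ((hGc _ (hcont n)).norm).integrableOn_uIoc
        · refine Continuous.integrableOn_uIoc ?_
          fun_prop
        · refine (hGn s _).trans ?_
          rw [sub_zero]
          exact mul_le_mul_of_nonneg_left (ih s) (norm_nonneg B)
      refine h1.trans (le_of_eq ?_)
      have h2 : (fun s : ℝ => ‖B‖ * (‖x‖ * ((‖B‖ * |s - 0|) ^ n / n.factorial))) =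
          fun s : ℝ => (‖B‖ * ‖x‖ * ‖B‖ ^ n / n.factorial) * |s - 0| ^ n := by
        funext s
        rw [mul_pow]
        ring
      rw [h2, integral_const_mul, integral_pow_abs_sub_uIoc, sub_zero, Nat.factorial_succ]
      push_cast
      field_simp
      ring
  have hsum : ∀ t, Summable fun n => w n t := fun t =>
    Summable.of_norm_bounded ((Real.summable_pow_div_factorial (‖B‖ * |t|)).mul_left ‖x‖)
      (fun n => hbd n t)
  refine ⟨fun t => ∑' n, w n t, ?_, fun t => ?_⟩
  · change ∑' n, w n 0 = x
    rw [tsum_eq_single 0]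
    · rw [w0]
    · intro n hn
      obtain ⟨m, rfl⟩ := Nat.exists_eq_succ_of_ne_zero hn
      rw [Nat.succ_eq_add_one, wsucc]
      simp
  · have hshift : (fun t => ∑' n, w n t) = fun t => x + ∑' n, w (n + 1) t := by
      funext t
      rw [(hsum t).tsum_eq_zero_add, w0]
    have hGt : G t (∑' n, w n t) = ∑' n, G t (w n t) :=
      (((U₀ (-t)).toContinuousLinearEquiv.toContinuousLinearMap ∘L B ∘L
        (U₀ t).toContinuousLinearEquiv.toContinuousLinearMap).map_tsum (hsum t))
    change HasDerivAt _ (G t (∑' n, w n t)) t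
    rw [hGt, hshift]
    clear hshift hGt
    refine HasDerivAt.const_add x ?_
    -- The series of derivatives is dominated only on bounded time intervals; any radius exceeding
    -- `|t|` would serve.
    set R : ℝ := |t| + 1
    clear_value w G
    refine hasDerivAt_tsum_of_isPreconnected (t := Metric.ball (0 : ℝ) R) (y₀ := t)
      (u := fun n => ‖B‖ * (‖x‖ * ((‖B‖ * R) ^ n / n.factorial)))
      (((Real.summable_pow_div_factorial (‖B‖ * R)).mul_left _).mul_left _) Metric.isOpen_ball
      (convex_ball _ _).isPreconnected (g := fun n => w (n + 1)) (g' := fun n s => G s (w n s))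
      (fun n s _ => hder n (hcont n) s) (fun n s hs => ?_) ?_
      ((summable_nat_add_iff 1).2 (hsum t)) ?_
    · refine (hGn s _).trans (mul_le_mul_of_nonneg_left ((hbd n s).trans ?_) (norm_nonneg B))
      have : |s| ≤ R := by
        rw [mem_ball_zero_iff, Real.norm_eq_abs] at hs
        exact hs.le
      gcongr
    · simp [R]
    · simp [R]

/-- A bounded skew-adjoint perturbation of the generator of a unitary group generates a unitary
group. -/
theorem exists_unitaryGroup_perturbation [CompleteSpace H] {U₀ : ℝ → H ≃ₗᵢ[ℂ] H}
    (hU₀ : IsUnitaryGroup U₀) (B : H →L[ℂ] H)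
    (hskew : ∀ x, (inner ℂ x (B x) : ℂ) + inner ℂ (B x) x = 0) :
    ∃ U : ℝ → H ≃ₗᵢ[ℂ] H, IsUnitaryGroup U ∧
      ∀ x, HasDerivAt (fun t => U₀ (-t) (U t x)) (B x) 0 := by
  choose w hw0 hw using exists_interaction_solution hU₀ B
  -- Skewness kills the derivative of `‖v‖²`. By linearity this conservation law also gives
  -- uniqueness.
  have hnorm : ∀ (v : ℝ → H), (∀ t, HasDerivAt v (U₀ (-t) (B (U₀ t (v t)))) t) →
      ∀ t, ‖v t‖ = ‖v 0‖ := by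
    intro v hv t
    have hd : ∀ s, HasDerivAt (fun s => (inner ℂ (v s) (v s) : ℂ)) 0 s := by
      intro s
      have := (hv s).inner ℂ (hv s)
      have h0 : (inner ℂ (v s) (U₀ (-s) (B (U₀ s (v s)))) : ℂ) +
          inner ℂ (U₀ (-s) (B (U₀ s (v s)))) (v s) = 0 := ?_
      · rwa [h0] at this
      rw [← hskew (U₀ s (v s))]
      congr 1
      · rw [← (U₀ s).inner_map_map (v s), hU₀.apply_neg]
      · rw [← (U₀ s).inner_map_map _ (v s), hU₀.apply_neg]
    have h1 := is_const_of_deriv_eq_zero (fun s => (hd s).differentiableAt)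
      (fun s => (hd s).deriv) t 0
    simp only [inner_self_eq_norm_sq_to_K] at h1
    have h2 : ‖v t‖ ^ 2 = ‖v 0‖ ^ 2 := by exact_mod_cast h1
    exact (sq_eq_sq₀ (norm_nonneg _) (norm_nonneg _)).1 h2
  have huniq : ∀ (v v' : ℝ → H), (∀ t, HasDerivAt v (U₀ (-t) (B (U₀ t (v t)))) t) →
      (∀ t, HasDerivAt v' (U₀ (-t) (B (U₀ t (v' t)))) t) → v 0 = v' 0 → ∀ t, v t = v' t := by
    intro v v' hv hv' h0 t
    have := hnorm (fun t => v t - v' t)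
      (fun t => by simpa only [map_sub] using (hv t).fun_sub (hv' t)) t
    rw [h0, sub_self, norm_zero, norm_eq_zero, sub_eq_zero] at this
    exact this
  -- The group law follows from uniqueness: restarting the solution at time `t` gives the same
  -- initial value problem in `s`.
  have hadd : ∀ s t x, U₀ (s + t) (w x (s + t)) = U₀ s (w (U₀ t (w x t)) s) := by
    intro s t x
    have h1 := huniq (fun r => U₀ t (w x (r + t))) (w (U₀ t (w x t))) (fun r => ?_) (hw _)
      (by simp [hw0]) s
    · rw [hU₀.add, ← h1]
    · have h2 := hasDerivAt_isometry (U₀ t) ((hw x (r + t)).comp_add_const r t)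
      convert h2 using 1
      rw [← hU₀.add t, hU₀.add r t]
      congr 2
      ring
  let e : ℝ → H ≃ₗᵢ[ℂ] H := fun t =>
    { toFun := fun x => U₀ t (w x t)
      invFun := fun x => U₀ (-t) (w x (-t))
      map_add' := fun x y => by
        rw [← map_add, huniq (w (x + y)) (fun t => w x t + w y t) (hw _)
          (fun t => by simpa only [map_add] using (hw x t).fun_add (hw y t)) (by simp [hw0]) t]
      map_smul' := fun c x => by
        rw [RingHom.id_apply, ← map_smul, huniq (w (c • x)) (fun t => c • w x t) (hw _)
          (fun t => by simpa only [map_smul] using (hw x t).fun_const_smul c) (by simp [hw0]) t]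
      left_inv := fun x => by
        change U₀ (-t) (w (U₀ t (w x t)) (-t)) = x
        rw [← hadd, neg_add_cancel, hU₀.zero, hw0]
      right_inv := fun x => by
        change U₀ t (w (U₀ (-t) (w x (-t))) t) = x
        rw [← hadd, add_neg_cancel, hU₀.zero, hw0]
      norm_map' := fun x => by
        change ‖U₀ t (w x t)‖ = ‖x‖
        rw [LinearIsometryEquiv.norm_map, hnorm _ (hw x) t, hw0] }
  have he : ∀ t x, e t x = U₀ t (w x t) := fun t x => rfl
  refine ⟨e, ⟨fun x => ?_, fun s t x => ?_, fun x => ?_⟩, fun x => ?_⟩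
  · rw [he, hU₀.zero, hw0]
  · rw [he, he, he, hadd]
  · exact continuous_isometry_apply (g := w x) hU₀.continuous
      (continuous_iff_continuousAt.2 fun t => (hw x t).continuousAt)
  · simp only [he, hU₀.neg_apply]
    have := hw x 0
    simpa only [neg_zero, hU₀.zero, hw0] using this

/-- Two unitary groups that differ by a bounded perturbation of the generator. -/
theorem hasDerivAt_iff_of_perturbation {U U₀ : ℝ → H ≃ₗᵢ[ℂ] H} (hU : IsUnitaryGroup U)
    (hU₀ : IsUnitaryGroup U₀) {B : H → H}
    (hB : ∀ x, HasDerivAt (fun t => U₀ (-t) (U t x)) (B x) 0) (x Φ : H) :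
    HasDerivAt (fun t => U t x) Φ 0 ↔ HasDerivAt (fun t => U₀ t x) (Φ - B x) 0 := by
  have h0 : HasDerivAt (fun t => U₀ (-t) (U t x) - x) (B x) 0 := (hB x).sub_const x
  have h1 := hasDerivAt_isometry_apply (Z := U₀) (hU₀.continuous _).continuousAt h0
    (Φ := 0) (by simpa [hU.zero, hU₀.zero] using hasDerivAt_const (0 : ℝ) (0 : H))
  simp only [map_sub, hU₀.apply_neg, hU₀.zero, zero_add] at h1
  constructor
  · intro h
    convert h.sub h1 using 1
    funext t
    simp
  · intro h
    convert h.add h1 using 1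
    · funext t
      simp
    · abel

/-- The product rule is applied to `U(-t) U₀(t)` acting on `U₀(-t) U(t) x - x`, which equals `x -
U(-t) U₀(t) x`. As the inner curve vanishes at `0`, differentiability of the outer family at a fixed
vector is not presupposed. -/
theorem hasDerivAt_perturbation_symm {U U₀ : ℝ → H ≃ₗᵢ[ℂ] H} (hU : IsUnitaryGroup U)
    (hU₀ : IsUnitaryGroup U₀) {B : H → H}
    (hB : ∀ x, HasDerivAt (fun t => U₀ (-t) (U t x)) (B x) 0) (x : H) :
    HasDerivAt (fun t => U (-t) (U₀ t x)) (-B x) 0 := by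
  have h0 : HasDerivAt (fun t => U₀ (-t) (U t x) - x) (B x) 0 := (hB x).sub_const x
  have h1 := hasDerivAt_isometry_apply (Z := fun t => (U₀ t).trans (U (-t)))
    (hU.trans_continuous hU₀ _).continuousAt h0
    (Φ := 0) (by simpa [hU.zero, hU₀.zero] using hasDerivAt_const (0 : ℝ) (0 : H))
  simp only [LinearIsometryEquiv.trans_apply, map_sub, hU₀.apply_neg, hU.neg_apply, neg_zero,
    hU₀.zero, hU.zero, zero_add] at h1
  convert (h1.neg).add_const x using 1
  funext t
  simp

end UnitaryGroup

/-! ### Multiplication by bounded continuous functions -/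

section Multiplication

variable {α : Type*} [TopologicalSpace α] [MeasurableSpace α] [BorelSpace α] {μ : Measure α}

/-- Multiplication by a bounded continuous function in `L²`. -/
def bmul (W : α →ᵇ ℂ) : Lp ℂ 2 μ →L[ℂ] Lp ℂ 2 μ :=
  LinearMap.mkContinuous
    { toFun := fun u => ((W.memLp_top (μ := μ)).toLp W • u : Lp ℂ 2 μ)
      map_add' := fun u v => Lp.add_smul _ u v
      map_smul' := fun c u => by
        rw [RingHom.id_apply]
        ext1
        filter_upwards [Lp.coeFn_lpSMul (r := 2) ((W.memLp_top (μ := μ)).toLp W) (c • u),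
          Lp.coeFn_lpSMul (r := 2) ((W.memLp_top (μ := μ)).toLp W) u, Lp.coeFn_smul c u,
          Lp.coeFn_smul c ((W.memLp_top (μ := μ)).toLp W • u : Lp ℂ 2 μ)] with x h1 h2 h3 h4
        rw [h1, h4, Pi.smul_apply', Pi.smul_apply, h2, Pi.smul_apply', h3, Pi.smul_apply]
        simp only [smul_eq_mul]
        ring } ‖W‖ fun u => by
      refine (Lp.norm_smul_le _ u).trans (mul_le_mul_of_nonneg_right ?_ (norm_nonneg u))
      rw [Lp.norm_toLp]
      refine ENNReal.toReal_le_of_le_ofReal (norm_nonneg _) ?_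
      rw [eLpNorm_exponent_top]
      exact eLpNormEssSup_le_of_ae_bound (Eventually.of_forall W.norm_coe_le_norm)

theorem coeFn_bmul (W : α →ᵇ ℂ) (u : Lp ℂ 2 μ) : bmul W u =ᵐ[μ] fun x => W x * u x := by
  have h : bmul W u = ((W.memLp_top (μ := μ)).toLp W • u : Lp ℂ 2 μ) := rfl
  rw [h]
  filter_upwards [Lp.coeFn_lpSMul (r := 2) ((W.memLp_top (μ := μ)).toLp W) u,
    (W.memLp_top (μ := μ)).coeFn_toLp] with x h1 h2
  rw [h1, Pi.smul_apply', h2, smul_eq_mul]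

theorem bmul_bmul (W W' : α →ᵇ ℂ) (u : Lp ℂ 2 μ) : bmul W (bmul W' u) = bmul (W * W') u := by
  ext1
  filter_upwards [coeFn_bmul W (bmul W' u), coeFn_bmul W' u, coeFn_bmul (W * W') u] with x h1 h2 h3
  rw [h1, h2, h3, BoundedContinuousFunction.mul_apply, mul_assoc]

theorem bmul_one (u : Lp ℂ 2 μ) : bmul (1 : α →ᵇ ℂ) u = u := by
  ext1
  filter_upwards [coeFn_bmul (1 : α →ᵇ ℂ) u] with x h1
  rw [h1, BoundedContinuousFunction.coe_one, Pi.one_apply, one_mul]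

theorem norm_bmul_of_unimodular (W : α →ᵇ ℂ) (hW : ∀ x, ‖W x‖ = 1) (u : Lp ℂ 2 μ) :
    ‖bmul W u‖ = ‖u‖ := by
  refine le_antisymm (Lp.norm_le_norm_of_ae_le ?_) (Lp.norm_le_norm_of_ae_le ?_) <;>
  · filter_upwards [coeFn_bmul W u] with x hx
    rw [hx, norm_mul, hW, one_mul]

omit [TopologicalSpace α] [BorelSpace α] in
theorem norm_sq_Lp_two (u : Lp ℂ 2 μ) : ‖u‖ ^ 2 = ∫ x, ‖u x‖ ^ 2 ∂μ := by
  have h : (inner ℂ u u : ℂ) = ∫ x, inner ℂ (u x) (u x) ∂μ := L2.inner_def u u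
  simp only [inner_self_eq_norm_sq_to_K, coe_algebraMap] at h
  have h2 : (∫ x, ((‖u x‖ : ℂ)) ^ 2 ∂μ) = ((∫ x, ‖u x‖ ^ 2 ∂μ : ℝ) : ℂ) := by
    rw [← integral_complex_ofReal]
    push_cast
    rfl
  rw [h2] at h
  exact_mod_cast h

omit [TopologicalSpace α] [BorelSpace α] in
/-- Dominated convergence in `L²`. -/
theorem tendsto_Lp_two_zero {ι : Type*} {l : Filter ι} [l.IsCountablyGenerated]
    {F : ι → Lp ℂ 2 μ} {f : ι → α → ℂ} (hF : ∀ i, F i =ᵐ[μ] f i) (g : Lp ℂ 2 μ) (C : ℝ)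
    (hle : ∀ᶠ i in l, ∀ᵐ x ∂μ, ‖f i x‖ ≤ C * ‖g x‖)
    (hlim : ∀ᵐ x ∂μ, Tendsto (fun i => f i x) l (𝓝 0)) : Tendsto F l (𝓝 0) := by
  have h1 : Tendsto (fun i => ∫ x, ‖f i x‖ ^ 2 ∂μ) l (𝓝 (∫ _, (0 : ℝ) ∂μ)) := by
    refine tendsto_integral_filter_of_dominated_convergence (fun x => C ^ 2 * ‖g x‖ ^ 2)
      (Eventually.of_forall fun i =>
        (((Lp.aestronglyMeasurable (F i)).congr (hF i)).norm.pow 2)) ?_ ?_ ?_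
    · filter_upwards [hle] with i hi
      filter_upwards [hi] with x hx
      rw [Real.norm_of_nonneg (by positivity), ← mul_pow]
      exact pow_le_pow_left₀ (norm_nonneg _) hx 2
    · exact ((memLp_two_iff_integrable_sq_norm (Lp.aestronglyMeasurable g)).1
        (Lp.memLp g)).const_mul _
    · filter_upwards [hlim] with x hx
      simpa using hx.norm.pow 2
  have h3 : ∀ i, ∫ x, ‖f i x‖ ^ 2 ∂μ = ‖F i‖ ^ 2 := fun i => by
    rw [norm_sq_Lp_two]
    refine integral_congr_ae ?_
    filter_upwards [hF i] with x hx
    rw [hx]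
  simp only [h3, integral_zero] at h1
  rw [tendsto_zero_iff_norm_tendsto_zero]
  have h2 := h1.sqrt
  simpa using h2

/-! ### Phase groups -/

/-- The function `exp (-i t θ)`. -/
def phase (θ : α → ℝ) (hθ : Continuous θ) (t : ℝ) : α →ᵇ ℂ :=
  BoundedContinuousFunction.ofNormedAddCommGroup (fun x => exp (((-(t * θ x) : ℝ) : ℂ) * I))
    (by fun_prop) 1 fun x => (norm_exp_ofReal_mul_I _).le

omit [MeasurableSpace α] [BorelSpace α] in
theorem phase_apply (θ : α → ℝ) (hθ : Continuous θ) (t : ℝ) (x : α) :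
    phase θ hθ t x = exp (((-(t * θ x) : ℝ) : ℂ) * I) := rfl

omit [MeasurableSpace α] [BorelSpace α] in
theorem norm_phase (θ : α → ℝ) (hθ : Continuous θ) (t : ℝ) (x : α) : ‖phase θ hθ t x‖ = 1 :=
  norm_exp_ofReal_mul_I _

omit [MeasurableSpace α] [BorelSpace α] in
theorem phase_mul (θ : α → ℝ) (hθ : Continuous θ) (s t : ℝ) :
    phase θ hθ s * phase θ hθ t = phase θ hθ (s + t) := by
  ext x
  rw [BoundedContinuousFunction.mul_apply, phase_apply, phase_apply, phase_apply, ← Complex.exp_add]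
  congr 1
  push_cast
  ring

omit [MeasurableSpace α] [BorelSpace α] in
theorem phase_zero (θ : α → ℝ) (hθ : Continuous θ) : phase θ hθ 0 = 1 := by
  ext x
  simp [phase_apply]

/-- Multiplication by `exp (-i t θ)` as a unitary operator. -/
def phaseGroup (θ : α → ℝ) (hθ : Continuous θ) (t : ℝ) : Lp ℂ 2 μ ≃ₗᵢ[ℂ] Lp ℂ 2 μ where
  toFun := bmul (phase θ hθ t)
  invFun := bmul (phase θ hθ (-t))
  map_add' := map_add _
  map_smul' := map_smul _
  left_inv u := by rw [bmul_bmul, phase_mul, neg_add_cancel, phase_zero, bmul_one]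
  right_inv u := by rw [bmul_bmul, phase_mul, add_neg_cancel, phase_zero, bmul_one]
  norm_map' u := norm_bmul_of_unimodular _ (norm_phase θ hθ t) u

theorem phaseGroup_apply (θ : α → ℝ) (hθ : Continuous θ) (t : ℝ) (u : Lp ℂ 2 μ) :
    phaseGroup θ hθ t u = bmul (phase θ hθ t) u := rfl

theorem isUnitaryGroup_of_continuousAt_zero {H : Type*} [NormedAddCommGroup H]
    [InnerProductSpace ℂ H] {U : ℝ → H ≃ₗᵢ[ℂ] H} (h0 : ∀ x, U 0 x = x)
    (hadd : ∀ s t x, U (s + t) x = U s (U t x))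
    (hc : ∀ x, Tendsto (fun t => U t x - x) (𝓝 0) (𝓝 0)) : IsUnitaryGroup U where
  zero := h0
  add := hadd
  continuous x := by
    rw [continuous_iff_continuousAt]
    intro t
    have h1 : Tendsto (fun s => U (s - t) x - x) (𝓝 t) (𝓝 0) := by
      have : Tendsto (fun s => s - t) (𝓝 t) (𝓝 0) := by
        have h : Continuous fun s : ℝ => s - t := by fun_prop
        simpa using h.tendsto t
      exact (hc x).comp this
    have h2 : Tendsto (fun s => U t (U (s - t) x - x)) (𝓝 t) (𝓝 (U t 0)) :=
      ((U t).continuous.tendsto 0).comp h1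
    rw [map_zero] at h2
    have h3 := h2.add_const (U t x)
    rw [zero_add] at h3
    refine h3.congr fun s => ?_
    rw [map_sub, sub_add_cancel, ← hadd, add_sub_cancel]

theorem coeFn_phaseGroup_sub (θ : α → ℝ) (hθ : Continuous θ) (u : Lp ℂ 2 μ) (t : ℝ) :
    phaseGroup θ hθ t u - u =ᵐ[μ] fun x => phase θ hθ t x * u x - u x := by
  filter_upwards [Lp.coeFn_sub (phaseGroup θ hθ t u) u, coeFn_bmul (phase θ hθ t) u] with x h1 h2
  rw [h1, Pi.sub_apply, phaseGroup_apply, h2]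

theorem isUnitaryGroup_phaseGroup (θ : α → ℝ) (hθ : Continuous θ) :
    IsUnitaryGroup (phaseGroup (μ := μ) θ hθ) := by
  refine isUnitaryGroup_of_continuousAt_zero (fun u => ?_) (fun s t u => ?_) (fun u => ?_)
  · rw [phaseGroup_apply, phase_zero, bmul_one]
  · rw [phaseGroup_apply, phaseGroup_apply, phaseGroup_apply, bmul_bmul, phase_mul]
  · refine tendsto_Lp_two_zero (coeFn_phaseGroup_sub θ hθ u) u 2
      (Eventually.of_forall fun t => Eventually.of_forall fun x => ?_)
      (Eventually.of_forall fun x => ?_)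
    · refine (norm_sub_le _ _).trans (le_of_eq ?_)
      rw [norm_mul, norm_phase]
      ring
    · have h : Continuous fun t => phase θ hθ t x * u x - u x := by
        simp only [phase_apply]
        fun_prop
      have h2 := h.tendsto 0
      simpa [phase_zero] using h2

/-- The generator of a phase group. -/
theorem hasDerivAt_phaseGroup_iff (θ : α → ℝ) (hθ : Continuous θ) (u v : Lp ℂ 2 μ) :
    HasDerivAt (fun t => phaseGroup θ hθ t u) v 0 ↔ v =ᵐ[μ] fun x => -(I * θ x) * u x := by
  have hslope : ∀ x, Tendsto (fun t : ℝ => (t : ℂ)⁻¹ * (phase θ hθ t x * u x - u x)) (𝓝[≠] 0)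
      (𝓝 (-(I * θ x) * u x)) := by
    intro x
    have h1 : HasDerivAt (fun t : ℝ => exp (((-(t * θ x) : ℝ) : ℂ) * I) * u x)
        (exp (((-(0 * θ x) : ℝ) : ℂ) * I) * (((-(1 * θ x) : ℝ) : ℂ) * I) * u x) 0 :=
      ((((((hasDerivAt_id (0 : ℝ)).mul_const (θ x)).neg).ofReal_comp).mul_const I).cexp).mul_const _
    rw [hasDerivAt_iff_tendsto_slope_zero] at h1
    have hv : exp (((-(0 * θ x) : ℝ) : ℂ) * I) * (((-(1 * θ x) : ℝ) : ℂ) * I) * u x =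
        -(I * θ x) * u x := by
      simp [mul_comm]
    rw [hv] at h1
    refine h1.congr fun t => ?_
    simp [phase_apply]
  have hae : ∀ t : ℝ, t⁻¹ • (phaseGroup θ hθ (0 + t) u - phaseGroup θ hθ 0 u) =ᵐ[μ]
      fun x => (t : ℂ)⁻¹ * (phase θ hθ t x * u x - u x) := by
    intro t
    have h0 : phaseGroup θ hθ 0 u = u := by rw [phaseGroup_apply, phase_zero, bmul_one]
    rw [zero_add, h0]
    filter_upwards [coeFn_phaseGroup_sub θ hθ u t,
      Lp.coeFn_smul t⁻¹ (phaseGroup θ hθ t u - u)] with x h1 h2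
    rw [h2, Pi.smul_apply, h1, ← Complex.coe_smul, smul_eq_mul, ofReal_inv]
  rw [hasDerivAt_iff_tendsto_slope_zero]
  constructor
  · intro h
    have hseq : Tendsto (fun n : ℕ => ((n : ℝ) + 1)⁻¹) atTop (𝓝[≠] 0) := by
      refine tendsto_nhdsWithin_iff.2 ⟨?_, Eventually.of_forall fun n => ?_⟩
      · simpa using tendsto_one_div_add_atTop_nhds_zero_nat (𝕜 := ℝ)
      · have : ((n : ℝ) + 1) ≠ 0 := by positivity
        simpa using this
    -- Convergence in `L²` gives almost everywhere convergence along a subsequence, enough to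
    -- identify the limit with the pointwise derivative.
    obtain ⟨ns, hns, hlim⟩ :=
      (tendstoInMeasure_of_tendsto_Lp (h.comp hseq)).exists_seq_tendsto_ae
    filter_upwards [hlim, ae_all_iff.2 fun n : ℕ => hae ((n : ℝ) + 1)⁻¹] with x h1 h2
    refine tendsto_nhds_unique h1 ?_
    refine ((hslope x).comp (hseq.comp hns.tendsto_atTop)).congr fun i => ?_
    simp only [Function.comp_apply]
    rw [h2]
  · intro h
    rw [← tendsto_sub_nhds_zero_iff]
    -- Since `|exp (-i t θ) - 1| ≤ |t θ|`, the difference quotient is at most `|θ u| = |v|`;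
    -- subtracting the limit costs a second `|v|`, hence the constant `2`.
    refine tendsto_Lp_two_zero
      (f := fun t x => (t : ℂ)⁻¹ * (phase θ hθ t x * u x - u x) - -(I * θ x) * u x)
      (fun t => ?_) v 2
      (Eventually.of_forall fun t => ?_) (Eventually.of_forall fun x => ?_)
    · filter_upwards [hae t, h, Lp.coeFn_sub
        (t⁻¹ • (phaseGroup θ hθ (0 + t) u - phaseGroup θ hθ 0 u)) v] with x h1 h2 h3
      rw [h3, Pi.sub_apply, h1, h2]
    · filter_upwards [h] with x hx
      rw [← hx]
      refine (norm_sub_le _ _).trans ?_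
      rw [two_mul]
      refine add_le_add_left ?_ _
      rw [hx, ← sub_one_mul, ← mul_assoc, norm_mul, norm_mul (-(I * (θ x : ℂ)))]
      refine mul_le_mul_of_nonneg_right ?_ (norm_nonneg _)
      rw [norm_mul, norm_inv, norm_neg, norm_mul, norm_I, one_mul, norm_real, norm_real]
      rcases eq_or_ne t 0 with rfl | ht
      · simp
      · rw [inv_mul_le_iff₀ (norm_pos_iff.2 ht), phase_apply, mul_comm _ I]
        refine Real.norm_exp_I_mul_ofReal_sub_one_le.trans (le_of_eq ?_)
        rw [norm_neg, norm_mul]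
    · have := (hslope x).sub_const (-(I * θ x) * u x)
      rwa [sub_self] at this

end Multiplication

/-! ### The free Schrödinger group -/

section FreeGroup

theorem IsUnitaryGroup.conj {H H' : Type*} [NormedAddCommGroup H] [InnerProductSpace ℂ H]
    [NormedAddCommGroup H'] [InnerProductSpace ℂ H'] {U : ℝ → H ≃ₗᵢ[ℂ] H} (hU : IsUnitaryGroup U)
    (e : H' ≃ₗᵢ[ℂ] H) : IsUnitaryGroup fun t => (e.trans (U t)).trans e.symm where
  zero x := by simp [hU.zero]
  add s t x := by simp [hU.add]
  continuous x := e.symm.continuous.comp (hU.continuous (e x))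

theorem hasDerivAt_conj_iff {H H' : Type*} [NormedAddCommGroup H] [InnerProductSpace ℂ H]
    [NormedSpace ℝ H] [IsScalarTower ℝ ℂ H] [NormedAddCommGroup H'] [InnerProductSpace ℂ H']
    [NormedSpace ℝ H'] [IsScalarTower ℝ ℂ H'] {g : ℝ → H'} {v : H'} {t : ℝ}
    (e : H' ≃ₗᵢ[ℂ] H) : HasDerivAt (fun t => e (g t)) (e v) t ↔ HasDerivAt g v t := by
  refine ⟨fun h => ?_, fun h => ?_⟩
  · have := (e.symm.toContinuousLinearEquiv.toContinuousLinearMap.restrictScalars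
      ℝ).hasFDerivAt.comp_hasDerivAt t h
    convert this using 1
    · funext s
      exact (e.symm_apply_apply _).symm
    · exact (e.symm_apply_apply _).symm
  · exact (e.toContinuousLinearEquiv.toContinuousLinearMap.restrictScalars
      ℝ).hasFDerivAt.comp_hasDerivAt t h

variable (E : Type*) [NormedAddCommGroup E] [InnerProductSpace ℝ E] [FiniteDimensional ℝ E]
  [MeasurableSpace E] [BorelSpace E]

/-- The symbol `(c / 2) (2 π |ξ|)²` of `-(c / 2) Δ`. -/
def kinetic (c : ℝ) (ξ : E) : ℝ := c / 2 * (2 * Real.pi) ^ 2 * ‖ξ‖ ^ 2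

omit [InnerProductSpace ℝ E] [FiniteDimensional ℝ E] [MeasurableSpace E] [BorelSpace E] in
theorem continuous_kinetic (c : ℝ) : Continuous (kinetic E c) := by
  unfold kinetic
  fun_prop

/-- The free Schrödinger group `exp (i t (c / 2) Δ)` in `L²`. -/
def freeGroup (c t : ℝ) : Lp ℂ 2 (volume : Measure E) ≃ₗᵢ[ℂ] Lp ℂ 2 (volume : Measure E) :=
  ((Lp.fourierTransformₗᵢ E ℂ).trans (phaseGroup (kinetic E c) (continuous_kinetic E c) t)).trans
    (Lp.fourierTransformₗᵢ E ℂ).symm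

theorem isUnitaryGroup_freeGroup (c : ℝ) : IsUnitaryGroup (freeGroup E c) :=
  (isUnitaryGroup_phaseGroup _ _).conj _

variable {E}

theorem fourier_freeGroup (c t : ℝ) (u : Lp ℂ 2 (volume : Measure E)) :
    Lp.fourierTransformₗᵢ E ℂ (freeGroup E c t u) =
      bmul (phase (kinetic E c) (continuous_kinetic E c) t) (Lp.fourierTransformₗᵢ E ℂ u) := by
  simp [freeGroup, phaseGroup_apply]

/-- Testing against smooth compactly supported functions recovers locally integrable functions
almost everywhere. With the Fourier transform, this connects the pointwise generator of the phase
group to the distributional Laplacian. -/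
theorem toTemperedDistribution_eq_smulLeftCLM_iff {g : E → ℂ} (hg : g.HasTemperateGrowth)
    (u v : Lp ℂ 2 (volume : Measure E)) :
    (v : 𝓢'(E, ℂ)) = TemperedDistribution.smulLeftCLM ℂ g (u : 𝓢'(E, ℂ)) ↔
      v =ᵐ[volume] fun x => g x * u x := by
  constructor
  · intro h
    refine ae_eq_of_integral_contDiff_smul_eq ((Lp.memLp v).locallyIntegrable (by norm_num)) ?_ ?_
    · have h1 : LocallyIntegrable u (volume : Measure E) :=
        (Lp.memLp u).locallyIntegrable (by norm_num)
      rw [← locallyIntegrableOn_univ] at h1 ⊢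
      exact h1.continuousOn_mul hg.1.continuous.continuousOn isOpen_univ.isLocallyClosed
    · intro φ φ_smooth φ_cpt
      have hg₁ : HasCompactSupport (Complex.ofRealCLM ∘ φ) := φ_cpt.comp_left rfl
      have hg₂ : ContDiff ℝ (⊤ : ℕ∞) (Complex.ofRealCLM ∘ φ) := by fun_prop
      have h1 := congrArg (fun T : 𝓢'(E, ℂ) => T (hg₁.toSchwartzMap hg₂)) h
      simp only [Lp.toTemperedDistribution_apply,
        TemperedDistribution.smulLeftCLM_apply_apply] at h1
      have h2 : ∀ x, (SchwartzMap.smulLeftCLM ℂ g (hg₁.toSchwartzMap hg₂)) x • u x =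
          φ x • (g x * u x) := fun x => by
        rw [SchwartzMap.smulLeftCLM_apply_apply hg]
        simp
        ring
      simp only [h2] at h1
      simpa using h1
  · intro h
    ext φ
    simp only [Lp.toTemperedDistribution_apply, TemperedDistribution.smulLeftCLM_apply_apply]
    refine integral_congr_ae ?_
    filter_upwards [h] with x hx
    rw [hx, SchwartzMap.smulLeftCLM_apply_apply hg]
    simp only [smul_eq_mul]
    ring

/-- The generator of the free Schrödinger group. -/
theorem hasDerivAt_freeGroup_iff (c : ℝ) (u v : Lp ℂ 2 (volume : Measure E)) :
    HasDerivAt (fun t => freeGroup E c t u) v 0 ↔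
      (v : 𝓢'(E, ℂ)) = (I * (c / 2)) • Δ (u : 𝓢'(E, ℂ)) := by
  have hg1 : (fun x : E => ((‖x‖ ^ 2 : ℝ) : ℂ)).HasTemperateGrowth := by fun_prop
  have hgeq : (fun x : E => -(I * (kinetic E c x : ℂ))) =
      (-(I * (c / 2 * (2 * Real.pi) ^ 2)) : ℂ) • fun x : E => ((‖x‖ ^ 2 : ℝ) : ℂ) := by
    funext x
    simp only [kinetic, Pi.smul_apply, smul_eq_mul]
    push_cast
    ring
  have hg : (fun x : E => -(I * (kinetic E c x : ℂ))).HasTemperateGrowth := by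
    rw [hgeq]
    exact (Function.HasTemperateGrowth.const _).mul hg1
  rw [← hasDerivAt_conj_iff (Lp.fourierTransformₗᵢ E ℂ)]
  simp only [fourier_freeGroup]
  refine (hasDerivAt_phaseGroup_iff (kinetic E c) (continuous_kinetic E c)
    (Lp.fourierTransformₗᵢ E ℂ u) (Lp.fourierTransformₗᵢ E ℂ v)).trans ?_
  rw [← toTemperedDistribution_eq_smulLeftCLM_iff hg]
  have hu : ((Lp.fourierTransformₗᵢ E ℂ u : Lp ℂ 2 (volume : Measure E)) : 𝓢'(E, ℂ)) =
    FourierTransform.fourier (u : 𝓢'(E, ℂ)) := (Lp.fourier_toTemperedDistribution_eq u).symm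
  have hv : ((Lp.fourierTransformₗᵢ E ℂ v : Lp ℂ 2 (volume : Measure E)) : 𝓢'(E, ℂ)) =
    FourierTransform.fourier (v : 𝓢'(E, ℂ)) := (Lp.fourier_toTemperedDistribution_eq v).symm
  rw [hu, hv, hgeq, TemperedDistribution.smulLeftCLM_smul hg1,
    TemperedDistribution.laplacian_eq_fourierMultiplierCLM,
    TemperedDistribution.fourierMultiplierCLM_apply]
  have hsm : (I * (c / 2) : ℂ) • (-(2 * Real.pi) ^ 2 : ℝ) • FourierTransformInv.fourierInv
      (TemperedDistribution.smulLeftCLM ℂ (fun x : E => ((‖x‖ ^ 2 : ℝ) : ℂ))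
        (FourierTransform.fourier (u : 𝓢'(E, ℂ)))) =
      FourierTransformInv.fourierInv ((-(I * (c / 2 * (2 * Real.pi) ^ 2)) : ℂ) •
      (TemperedDistribution.smulLeftCLM ℂ (fun x : E => ((‖x‖ ^ 2 : ℝ) : ℂ))
        (FourierTransform.fourier (u : 𝓢'(E, ℂ))))) := by
    rw [FourierTransform.fourierInv_smul]
    ext φ
    simp
    ring
  rw [hsm]
  constructor
  · intro h
    have := congrArg FourierTransformInv.fourierInv h
    rw [FourierTransform.fourierInv_fourier_eq] at this
    exact this
  · intro h
    rw [h]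
    exact FourierTransform.fourier_fourierInv_eq _

end FreeGroup

/-! ### The propagators -/

section Twist

variable {H : Type*} [NormedAddCommGroup H] [InnerProductSpace ℂ H]

theorem norm_exp_neg_mul_I (m t : ℝ) : ‖exp (-(I * (m * t : ℝ)))‖ = 1 := by
  have : -(I * ((m * t : ℝ) : ℂ)) = ((-(m * t) : ℝ) : ℂ) * I := by
    push_cast
    ring
  rw [this, norm_exp_ofReal_mul_I]

/-- The unitary group `exp (-i m t) U(t)`. -/
def twist (m : ℝ) (U : ℝ → H ≃ₗᵢ[ℂ] H) (t : ℝ) : H ≃ₗᵢ[ℂ] H where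
  toFun x := exp (-(I * (m * t : ℝ))) • U t x
  invFun x := (U t).symm (exp (I * (m * t : ℝ)) • x)
  map_add' x y := by rw [map_add, smul_add]
  map_smul' c x := by rw [map_smul, smul_comm, RingHom.id_apply]
  left_inv x := by
    change (U t).symm (exp (I * (m * t : ℝ)) • exp (-(I * (m * t : ℝ))) • U t x) = x
    rw [smul_smul, ← Complex.exp_add, add_neg_cancel, Complex.exp_zero, one_smul]
    exact (U t).symm_apply_apply x
  right_inv x := by
    change exp (-(I * (m * t : ℝ))) • U t ((U t).symm (exp (I * (m * t : ℝ)) • x)) = x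
    rw [LinearIsometryEquiv.apply_symm_apply, smul_smul, ← Complex.exp_add, neg_add_cancel,
      Complex.exp_zero, one_smul]
  norm_map' x := by
    change ‖exp (-(I * (m * t : ℝ))) • U t x‖ = ‖x‖
    rw [norm_smul, norm_exp_neg_mul_I, one_mul, LinearIsometryEquiv.norm_map]

theorem twist_apply (m : ℝ) (U : ℝ → H ≃ₗᵢ[ℂ] H) (t : ℝ) (x : H) :
    twist m U t x = exp (-(I * (m * t : ℝ))) • U t x := rfl

theorem IsUnitaryGroup.twist {U : ℝ → H ≃ₗᵢ[ℂ] H} (hU : IsUnitaryGroup U) (m : ℝ) :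
    IsUnitaryGroup (twist m U) where
  zero x := by simp [twist_apply, hU.zero]
  add s t x := by
    rw [twist_apply, twist_apply, twist_apply, map_smul, smul_smul, ← Complex.exp_add, hU.add]
    congr 2
    push_cast
    ring
  continuous x := by
    simp only [twist_apply]
    have := hU.continuous x
    fun_prop

theorem twist_neg_twist (m : ℝ) (U : ℝ → H ≃ₗᵢ[ℂ] H) : twist (-m) (twist m U) = U := by
  funext t
  ext x
  rw [twist_apply, twist_apply, smul_smul, ← Complex.exp_add]
  have : -(I * ((-m * t : ℝ) : ℂ)) + -(I * ((m * t : ℝ) : ℂ)) = 0 := by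
    push_cast
    ring
  rw [this, Complex.exp_zero, one_smul]

variable [NormedSpace ℝ H] [IsScalarTower ℝ ℂ H]

theorem hasDerivAt_twist {U : ℝ → H ≃ₗᵢ[ℂ] H} (hU : IsUnitaryGroup U) (m : ℝ) {x Φ : H}
    (h : HasDerivAt (fun t => U t x) Φ 0) :
    HasDerivAt (fun t => twist m U t x) (Φ - (I * m) • x) 0 := by
  have h1 : HasDerivAt (fun t : ℝ => exp (-(I * (m * t : ℝ)))) (-(I * m)) 0 := by
    have h2 : HasDerivAt (fun t : ℝ => -(I * ((m * t : ℝ) : ℂ))) (-(I * ((m * 1 : ℝ) : ℂ))) 0 :=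
      ((((hasDerivAt_id (0 : ℝ)).const_mul m).ofReal_comp).const_mul I).fun_neg
    have h3 := h2.cexp
    simpa using h3
  have h4 := h1.smul h
  simp only [hU.zero] at h4
  have h5 : cexp (-(I * ((m * 0 : ℝ) : ℂ))) • Φ + -(I * (m : ℂ)) • x = Φ - (I * m) • x := by
    simp [sub_eq_add_neg]
  rw [h5] at h4
  exact h4

theorem hasDerivAt_twist_iff {U : ℝ → H ≃ₗᵢ[ℂ] H} (hU : IsUnitaryGroup U) (m : ℝ) {x Φ : H} :
    HasDerivAt (fun t => twist m U t x) Φ 0 ↔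
      HasDerivAt (fun t => U t x) (Φ + (I * m) • x) 0 := by
  constructor
  · intro h
    have := hasDerivAt_twist (hU.twist m) (-m) h
    rw [twist_neg_twist] at this
    convert this using 1
    simp
  · intro h
    have := hasDerivAt_twist hU m h
    rwa [add_sub_cancel_right] at this

end Twist

section Prod

variable {H : Type*} [NormedAddCommGroup H] [InnerProductSpace ℂ H]

/-- The direct sum of two unitary groups. -/
def prodGroup (U V : ℝ → H ≃ₗᵢ[ℂ] H) (t : ℝ) : WithLp 2 (H × H) ≃ₗᵢ[ℂ] WithLp 2 (H × H) where
  toFun x := WithLp.toLp 2 (U t x.fst, V t x.snd)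
  invFun x := WithLp.toLp 2 ((U t).symm x.fst, (V t).symm x.snd)
  map_add' x y := by
    rw [WithLp.add_fst, WithLp.add_snd, map_add, map_add]
    rfl
  map_smul' c x := by
    rw [WithLp.smul_fst, WithLp.smul_snd, map_smul, map_smul]
    rfl
  left_inv x := by
    change WithLp.toLp 2 ((U t).symm (U t x.fst), (V t).symm (V t x.snd)) = x
    rw [LinearIsometryEquiv.symm_apply_apply, LinearIsometryEquiv.symm_apply_apply]
    rfl
  right_inv x := by
    change WithLp.toLp 2 (U t ((U t).symm x.fst), V t ((V t).symm x.snd)) = x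
    rw [LinearIsometryEquiv.apply_symm_apply, LinearIsometryEquiv.apply_symm_apply]
    rfl
  norm_map' x := by
    change ‖WithLp.toLp 2 (U t x.fst, V t x.snd)‖ = ‖x‖
    rw [WithLp.prod_norm_eq_of_L2, WithLp.prod_norm_eq_of_L2]
    simp only [WithLp.toLp_fst, WithLp.toLp_snd, LinearIsometryEquiv.norm_map]

theorem prodGroup_apply (U V : ℝ → H ≃ₗᵢ[ℂ] H) (t : ℝ) (x : WithLp 2 (H × H)) :
    prodGroup U V t x = WithLp.toLp 2 (U t x.fst, V t x.snd) := rfl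

theorem IsUnitaryGroup.prod {U V : ℝ → H ≃ₗᵢ[ℂ] H} (hU : IsUnitaryGroup U)
    (hV : IsUnitaryGroup V) : IsUnitaryGroup (prodGroup U V) where
  zero x := by
    rw [prodGroup_apply, hU.zero, hV.zero]
    rfl
  add s t x := by
    rw [prodGroup_apply, hU.add, hV.add]
    rfl
  continuous x := (WithLp.prod_continuous_toLp 2 H H).comp
    ((hU.continuous x.fst).prodMk (hV.continuous x.snd))

omit [InnerProductSpace ℂ H] in
theorem hasDerivAt_withLp_iff [NormedSpace ℝ H] {g : ℝ → WithLp 2 (H × H)}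
    {v : WithLp 2 (H × H)} {t : ℝ} : HasDerivAt g v t ↔
      HasDerivAt (fun s => (g s).fst) v.fst t ∧ HasDerivAt (fun s => (g s).snd) v.snd t := by
  constructor
  · intro h
    exact ⟨(WithLp.fstL 2 ℝ H H).hasFDerivAt.comp_hasDerivAt t h,
      (WithLp.sndL 2 ℝ H H).hasFDerivAt.comp_hasDerivAt t h⟩
  · intro h
    exact (WithLp.prodContinuousLinearEquiv 2 ℝ H
      H).symm.toContinuousLinearMap.hasFDerivAt.comp_hasDerivAt t (h.1.prodMk h.2)

end Prod

/-- The free evolution of the two particles and the spin. -/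
def stateGroup (ħ ω : ℝ) : ℝ → StateSpace ≃ₗᵢ[ℂ] StateSpace :=
  prodGroup (twist (ω / 2) (freeGroup Config ħ)) (twist (-(ω / 2)) (freeGroup Config ħ))

theorem isUnitaryGroup_stateGroup (ħ ω : ℝ) : IsUnitaryGroup (stateGroup ħ ω) :=
  ((isUnitaryGroup_freeGroup Config ħ).twist _).prod ((isUnitaryGroup_freeGroup Config ħ).twist _)

theorem eq_laplacianOp_iff (u w : L2) :
    (w : 𝓢'(Config, ℂ)) = Δ (u : 𝓢'(Config, ℂ)) ↔
      ∃ h : u ∈ laplacianOp.domain, w = laplacianOp ⟨u, h⟩ := by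
  constructor
  · intro h
    have hu : u ∈ laplacianOp.domain := (mem_laplacianOp_domain u).2 ⟨w, h⟩
    refine ⟨hu, toDistr_injective ?_⟩
    have h2 := laplacianOp_spec ⟨u, hu⟩
    exact h.trans h2.symm
  · rintro ⟨h, rfl⟩
    exact laplacianOp_spec ⟨u, h⟩

theorem hasDerivAt_freeGroup_iff_laplacianOp {ħ : ℝ} (hħ : ħ ≠ 0) (u v : L2) :
    HasDerivAt (fun t => freeGroup Config ħ t u) v 0 ↔
      ∃ h : u ∈ laplacianOp.domain, v = (I * (ħ / 2)) • laplacianOp ⟨u, h⟩ := by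
  have hc : (I * (ħ / 2) : ℂ) ≠ 0 := by
    simp [hħ]
  rw [hasDerivAt_freeGroup_iff]
  have h1 : (v : 𝓢'(Config, ℂ)) = (I * (ħ / 2) : ℂ) • Δ (u : 𝓢'(Config, ℂ)) ↔
      (((I * (ħ / 2) : ℂ)⁻¹ • v : L2) : 𝓢'(Config, ℂ)) = Δ (u : 𝓢'(Config, ℂ)) := by
    have h2 : (((I * (ħ / 2) : ℂ)⁻¹ • v : L2) : 𝓢'(Config, ℂ)) =
      (I * (ħ / 2) : ℂ)⁻¹ • (v : 𝓢'(Config, ℂ)) := toDistr.map_smul _ v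
    rw [h2, inv_smul_eq_iff₀ hc]
  rw [h1, eq_laplacianOp_iff]
  refine exists_congr fun h => ?_
  rw [inv_smul_eq_iff₀ hc]

/-- The spin energies contribute only scalar phases, shifting the kinetic generator on each
component by a constant. Because `ħ ≠ 0`, differentiability of the orbit forces the distributional
Laplacian into `L²`, so the domain comes out exactly. -/
theorem isPropagator_stateGroup {ħ : ℝ} (hħ : ħ ≠ 0) (ω : ℝ) :
    IsPropagator ħ (freeHamiltonian ħ ω) (stateGroup ħ ω) where
  zero := (isUnitaryGroup_stateGroup ħ ω).zero
  add := (isUnitaryGroup_stateGroup ħ ω).add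
  continuous := (isUnitaryGroup_stateGroup ħ ω).continuous
  generator Ψ Φ := by
    have hF := isUnitaryGroup_freeGroup Config ħ
    have hħ' : (ħ : ℂ) ≠ 0 := by exact_mod_cast hħ
    have key : ∀ (L u v : L2) (m : ℝ), v + (I * m) • u = (I * (ħ / 2)) • L ↔
        v = (-(I / (ħ : ℂ))) • ((-((ħ : ℂ) ^ 2 / 2)) • L + ((ħ * m : ℝ) : ℂ) • u) := by
      intro L u v m
      rw [← eq_sub_iff_add_eq, smul_add, smul_smul, smul_smul, sub_eq_add_neg, ← neg_smul]
      have h1 : -(I / (ħ : ℂ)) * (-((ħ : ℂ) ^ 2 / 2)) = I * (ħ / 2) := by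
        field_simp
      have h2 : -(I / (ħ : ℂ)) * ((ħ * m : ℝ) : ℂ) = -(I * m) := by
        push_cast
        field_simp
      rw [h1, h2]
    rw [hasDerivAt_withLp_iff]
    have e1 : HasDerivAt (fun s => (stateGroup ħ ω s Ψ).fst) Φ.fst 0 ↔
        ∃ h : Ψ.fst ∈ laplacianOp.domain,
          Φ.fst + (I * (ω / 2 : ℝ)) • Ψ.fst = (I * (ħ / 2)) • laplacianOp ⟨Ψ.fst, h⟩ :=
      (hasDerivAt_twist_iff hF (ω / 2)).trans (hasDerivAt_freeGroup_iff_laplacianOp hħ _ _)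
    have e2 : HasDerivAt (fun s => (stateGroup ħ ω s Ψ).snd) Φ.snd 0 ↔
        ∃ h : Ψ.snd ∈ laplacianOp.domain,
          Φ.snd + (I * (-(ω / 2) : ℝ)) • Ψ.snd = (I * (ħ / 2)) • laplacianOp ⟨Ψ.snd, h⟩ :=
      (hasDerivAt_twist_iff hF (-(ω / 2))).trans (hasDerivAt_freeGroup_iff_laplacianOp hħ _ _)
    rw [e1, e2]
    simp only [key]
    have hω : ħ * (-(ω / 2)) = -(ħ * ω / 2) := by ring
    have hω' : ħ * (ω / 2) = ħ * ω / 2 := by ring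
    rw [hω, hω']
    constructor
    · rintro ⟨⟨h1, h1'⟩, h2, h2'⟩
      refine ⟨⟨h1, h2⟩, ?_⟩
      rw [freeHamiltonian_apply]
      exact WithLp.ofLp_injective 2 (Prod.ext h1' h2')
    · rintro ⟨⟨h1, h2⟩, h⟩
      rw [freeHamiltonian_apply] at h
      exact ⟨⟨h1, congrArg WithLp.fst h⟩, h2, congrArg WithLp.snd h⟩

/-- The potential as a bounded continuous function. -/
def potentialBCF (V : 𝓢(ℝ, ℝ)) (a δ : ℝ) : Config →ᵇ ℂ :=
  BoundedContinuousFunction.ofNormedAddCommGroup (potential V a δ)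
    (by
      unfold potential
      have h0 : Continuous fun x : Config => (x 0 - a) / δ := by fun_prop
      exact continuous_ofReal.comp (V.continuous.comp h0)) (SchwartzMap.seminorm ℝ 0 0 V)
    (fun x => by
      simpa [potential] using SchwartzMap.norm_le_seminorm ℝ V ((x 0 - a) / δ))

theorem potentialBCF_apply (V : 𝓢(ℝ, ℝ)) (a δ : ℝ) (x : Config) :
    potentialBCF V a δ x = V ((x 0 - a) / δ) := rfl

theorem potentialOp_eq_bmul (V : 𝓢(ℝ, ℝ)) (a δ : ℝ) (u : L2) :
    potentialOp V a δ u = bmul (potentialBCF V a δ) u := by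
  ext1
  filter_upwards [coeFn_bmul (potentialBCF V a δ) u,
    (potential_mul_memLp V a δ u).coeFn_toLp] with x h1 h2
  rw [h1]
  exact h2

/-- The bounded operator `(u, d) ↦ r (-W d, W u)`. -/
def coupling (W : Config →ᵇ ℂ) (r : ℝ) : StateSpace →L[ℂ] StateSpace :=
  (r : ℂ) • ((WithLp.prodContinuousLinearEquiv 2 ℂ L2 L2).symm.toContinuousLinearMap ∘L
    ((-(bmul W ∘L WithLp.sndL 2 ℂ L2 L2)).prod (bmul W ∘L WithLp.fstL 2 ℂ L2 L2)))

theorem coupling_apply (W : Config →ᵇ ℂ) (r : ℝ) (x : StateSpace) :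
    coupling W r x = (r : ℂ) • WithLp.toLp 2 (-bmul W x.snd, bmul W x.fst) := rfl

theorem inner_bmul_of_real {α : Type*} [TopologicalSpace α] [MeasurableSpace α] [BorelSpace α]
    {μ : Measure α} (W : α →ᵇ ℂ) (hW : ∀ x, conj (W x) = W x) (u v : Lp ℂ 2 μ) :
    (inner ℂ (bmul W u) v : ℂ) = inner ℂ u (bmul W v) := by
  rw [L2.inner_def, L2.inner_def]
  refine integral_congr_ae ?_
  filter_upwards [coeFn_bmul W u, coeFn_bmul W v] with x h1 h2
  rw [h1, h2]
  simp only [RCLike.inner_apply, map_mul, hW]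
  ring

/-- The matrix `-i σ₂` is real and antisymmetric, and `W` is real, so the cross terms cancel in
pairs. -/
theorem coupling_skew (W : Config →ᵇ ℂ) (hW : ∀ x, conj (W x) = W x) (r : ℝ) (x : StateSpace) :
    (inner ℂ x (coupling W r x) : ℂ) + inner ℂ (coupling W r x) x = 0 := by
  rw [coupling_apply, inner_smul_left, inner_smul_right, conj_ofReal, ← mul_add,
    WithLp.prod_inner_apply, WithLp.prod_inner_apply]
  change (r : ℂ) * (inner ℂ x.fst (-bmul W x.snd) + inner ℂ x.snd (bmul W x.fst) +
    (inner ℂ (-bmul W x.snd) x.fst + inner ℂ (bmul W x.fst) x.snd)) = 0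
  simp only [inner_neg_left, inner_neg_right, inner_bmul_of_real W hW]
  ring

theorem smul_interaction_eq_coupling (V : 𝓢(ℝ, ℝ)) (a γ δ ħ : ℝ) (x : StateSpace) :
    (-(I / (ħ : ℂ))) • interaction V a γ δ x = coupling (potentialBCF V a δ) (γ / ħ) x := by
  rw [interaction_apply, coupling_apply, smul_smul, potentialOp_eq_bmul, potentialOp_eq_bmul]
  have h : (-(I / (ħ : ℂ))) * (γ : ℂ) = ((γ / ħ : ℝ) : ℂ) * (-I) := by
    push_cast
    ring
  rw [h, mul_smul]
  congr 1
  refine WithLp.ofLp_injective 2 (Prod.ext ?_ ?_)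
  · change (-I) • ((-I) • bmul _ _) = -bmul _ _
    rw [smul_smul, neg_mul_neg, I_mul_I, neg_one_smul]
  · change (-I) • (I • bmul _ _) = bmul _ _
    rw [smul_smul, neg_mul, I_mul_I, neg_neg, one_smul]

/-! ### Uniqueness of propagators and existence of the interacting one -/

theorem IsPropagator.isUnitaryGroup {ħ : ℝ} {H : StateSpace →ₗ.[ℂ] StateSpace}
    {U : ℝ → StateSpace ≃ₗᵢ[ℂ] StateSpace} (h : IsPropagator ħ H U) : IsUnitaryGroup U :=
  ⟨h.zero, h.add, h.continuous⟩

theorem IsPropagator.unique {ħ : ℝ} {H : StateSpace →ₗ.[ℂ] StateSpace}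
    {U U' : ℝ → StateSpace ≃ₗᵢ[ℂ] StateSpace} (h : IsPropagator ħ H U)
    (h' : IsPropagator ħ H U') : U = U' :=
  h.isUnitaryGroup.eq_of_generator h'.isUnitaryGroup
    fun x Φ hx => (h'.generator x Φ).2 ((h.generator x Φ).1 hx)

/-- Uniqueness makes the choice in `propagator` immaterial: any group with the right generator is
the chosen one. -/
theorem IsPropagator.propagator_eq {ħ : ℝ} {H : StateSpace →ₗ.[ℂ] StateSpace}
    {U : ℝ → StateSpace ≃ₗᵢ[ℂ] StateSpace} (h : IsPropagator ħ H U) : propagator ħ H = U :=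
  (Classical.epsilon_spec (p := IsPropagator ħ H) ⟨U, h⟩ : IsPropagator ħ H _).unique h

/-- A bounded perturbation does not affect which orbits are differentiable at `0`; it only shifts
the derivative. This yields the full generator condition with the free domain. -/
theorem exists_isPropagator_hamiltonian (V : 𝓢(ℝ, ℝ)) (a ω γ δ : ℝ) {ħ : ℝ} (hħ : ħ ≠ 0) :
    ∃ U, IsPropagator ħ (hamiltonian V a ħ ω γ δ) U ∧ ∀ x,
      HasDerivAt (fun t => U (-t) (stateGroup ħ ω t x))
        (-coupling (potentialBCF V a δ) (γ / ħ) x) 0 := by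
  have hU₀ := isUnitaryGroup_stateGroup ħ ω
  obtain ⟨U, hU, hB⟩ := exists_unitaryGroup_perturbation hU₀
    (coupling (potentialBCF V a δ) (γ / ħ))
    (coupling_skew _ (fun x => by rw [potentialBCF_apply, conj_ofReal]) _)
  refine ⟨U, ⟨hU.zero, hU.add, hU.continuous, fun Ψ Φ => ?_⟩,
    hasDerivAt_perturbation_symm hU hU₀ hB⟩
  rw [hasDerivAt_iff_of_perturbation hU hU₀ hB, (isPropagator_stateGroup hħ ω).generator]
  refine exists_congr fun h => ?_
  rw [sub_eq_iff_eq_add, ← smul_interaction_eq_coupling, ← smul_add, add_comm]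
  rfl

theorem isPropagator_scaledFreeHamiltonian {ε : ℝ} (hε : ε ≠ 0) :
    IsPropagator (ε ^ 2) (scaledFreeHamiltonian ε) (stateGroup (ε ^ 2) ε⁻¹) :=
  isPropagator_stateGroup (pow_ne_zero 2 hε) ε⁻¹

theorem propagator_scaledFreeHamiltonian {ε : ℝ} (hε : ε ≠ 0) :
    propagator (ε ^ 2) (scaledFreeHamiltonian ε) = stateGroup (ε ^ 2) ε⁻¹ :=
  (isPropagator_scaledFreeHamiltonian hε).propagator_eq

/-- In this scaling `γ = ħ`, so the coupling constant is `1`: the smallness of the effect comes from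
the short duration of the collision. -/
theorem propagator_scaledHamiltonian (V : 𝓢(ℝ, ℝ)) (a : ℝ) {ε : ℝ} (hε : ε ≠ 0) :
    IsPropagator (ε ^ 2) (scaledHamiltonian V a ε)
      (propagator (ε ^ 2) (scaledHamiltonian V a ε)) ∧ ∀ x,
      HasDerivAt (fun t => propagator (ε ^ 2) (scaledHamiltonian V a ε) (-t)
        (stateGroup (ε ^ 2) ε⁻¹ t x)) (-coupling (potentialBCF V a ε) 1 x) 0 := by
  obtain ⟨U, hU, hB⟩ := exists_isPropagator_hamiltonian V a ε⁻¹ (ε ^ 2) ε (pow_ne_zero 2 hε)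
  have h : propagator (ε ^ 2) (scaledHamiltonian V a ε) = U := IsPropagator.propagator_eq hU
  rw [div_self (pow_ne_zero 2 hε)] at hB
  rw [h]
  exact ⟨hU, hB⟩

/-! ### The free evolution of Schwartz functions -/

theorem hasTemperateGrowth_cexp_ofReal_mul_I :
    (fun x : ℝ => exp ((x : ℂ) * I)).HasTemperateGrowth := by
  have hd : ∀ n : ℕ, iteratedDeriv n (fun x : ℝ => exp ((x : ℂ) * I)) =
      fun x : ℝ => exp ((x : ℂ) * I) * I ^ n := by
    intro n
    induction n with
    | zero => simp
    | succ n ih =>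
      rw [iteratedDeriv_succ, ih]
      funext x
      have h := ((((hasDerivAt_id x).ofReal_comp).mul_const I).cexp).mul_const (I ^ n)
      refine h.deriv.trans ?_
      simp only [id_eq, ofReal_one, one_mul]
      ring
  refine ⟨?_, fun n => ⟨0, 1, fun x => ?_⟩⟩
  · have h : ContDiff ℝ ((⊤ : ℕ∞) : WithTop ℕ∞) fun x : ℝ => (x : ℂ) * I :=
      (ofRealCLM.contDiff).mul contDiff_const
    exact h.cexp
  · rw [norm_iteratedFDeriv_eq_norm_iteratedDeriv, hd, norm_mul, norm_exp_ofReal_mul_I]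
    simp

section Free

variable (E : Type*) [NormedAddCommGroup E] [InnerProductSpace ℝ E] [FiniteDimensional ℝ E]
  [MeasurableSpace E] [BorelSpace E]

omit [FiniteDimensional ℝ E] [MeasurableSpace E] [BorelSpace E] in
theorem hasTemperateGrowth_phase_kinetic (c t : ℝ) :
    (phase (kinetic E c) (continuous_kinetic E c) t : E → ℂ).HasTemperateGrowth := by
  have h : (fun ξ : E => -(t * (c / 2 * (2 * Real.pi) ^ 2 * ‖ξ‖ ^ 2))).HasTemperateGrowth :=
    ((Function.HasTemperateGrowth.const t).mul ((Function.HasTemperateGrowth.const _).mul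
      (Function.hasTemperateGrowth_norm_sq E))).neg
  exact hasTemperateGrowth_cexp_ofReal_mul_I.comp h

/-- The free Schrödinger group `exp (i t (c / 2) Δ)` on the Schwartz functions. -/
def freeSchwartz (c t : ℝ) : 𝓢(E, ℂ) →L[ℂ] 𝓢(E, ℂ) :=
  SchwartzMap.fourierMultiplierCLM ℂ (phase (kinetic E c) (continuous_kinetic E c) t : E → ℂ)

theorem fourier_freeSchwartz_apply (c t : ℝ) (h : 𝓢(E, ℂ)) (ξ : E) :
    𝓕 (freeSchwartz E c t h) ξ = exp (((-(t * kinetic E c ξ) : ℝ) : ℂ) * I) * 𝓕 h ξ := by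
  rw [freeSchwartz, SchwartzMap.fourierMultiplierCLM_apply, FourierTransform.fourier_fourierInv_eq,
    SchwartzMap.smulLeftCLM_apply_apply (hasTemperateGrowth_phase_kinetic E c t)]
  rfl

/-- Both evolutions are the same Fourier multiplier. Wave packets can therefore be computed
pointwise on Schwartz functions and transferred to `L²`. -/
theorem toLp_freeSchwartz (c t : ℝ) (h : 𝓢(E, ℂ)) :
    (freeSchwartz E c t h).toLp 2 volume = freeGroup E c t (h.toLp 2 volume) := by
  refine (Lp.fourierTransformₗᵢ E ℂ).injective ?_
  rw [fourier_freeGroup]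
  change 𝓕 ((freeSchwartz E c t h).toLp 2 volume) = bmul _ (𝓕 (h.toLp 2 volume))
  rw [SchwartzMap.toLp_fourier_eq, SchwartzMap.toLp_fourier_eq]
  ext1
  filter_upwards [SchwartzMap.coeFn_toLp (𝓕 (freeSchwartz E c t h)) 2 volume,
    SchwartzMap.coeFn_toLp (𝓕 h) 2 volume,
    coeFn_bmul (phase (kinetic E c) (continuous_kinetic E c) t) ((𝓕 h).toLp 2 volume)]
    with ξ h1 h2 h3
  rw [h1, h3, h2, fourier_freeSchwartz_apply]
  rfl

theorem freeSchwartz_zero (c : ℝ) (h : 𝓢(E, ℂ)) : freeSchwartz E c 0 h = h := by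
  refine SchwartzMap.injective_toLp 2 volume ?_
  change (freeSchwartz E c 0 h).toLp 2 volume = h.toLp 2 volume
  rw [toLp_freeSchwartz, (isUnitaryGroup_freeGroup E c).zero]

theorem freeSchwartz_add (c s t : ℝ) (h : 𝓢(E, ℂ)) :
    freeSchwartz E c (s + t) h = freeSchwartz E c s (freeSchwartz E c t h) := by
  refine SchwartzMap.injective_toLp 2 volume ?_
  change (freeSchwartz E c (s + t) h).toLp 2 volume =
    (freeSchwartz E c s (freeSchwartz E c t h)).toLp 2 volume
  rw [toLp_freeSchwartz, (isUnitaryGroup_freeGroup E c).add, toLp_freeSchwartz, toLp_freeSchwartz]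

theorem norm_toLp_freeSchwartz (c t : ℝ) (h : 𝓢(E, ℂ)) :
    ‖(freeSchwartz E c t h).toLp 2 volume‖ = ‖h.toLp 2 volume‖ := by
  rw [toLp_freeSchwartz, LinearIsometryEquiv.norm_map]

theorem fourier_injective_schwartz {g h : 𝓢(E, ℂ)} (hgh : ∀ ξ, 𝓕 g ξ = 𝓕 h ξ) : g = h := by
  have h1 : 𝓕 g = 𝓕 h := SchwartzMap.ext hgh
  exact (FourierTransform.fourierCLE ℂ 𝓢(E, ℂ)).injective h1

theorem hasDerivAt_freeGroup_toLp (c : ℝ) (h : 𝓢(E, ℂ)) :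
    HasDerivAt (fun t => freeGroup E c t (h.toLp 2 volume))
      (((I * (c / 2) : ℂ) • Δ h).toLp 2 volume) 0 := by
  rw [hasDerivAt_freeGroup_iff, Lp.toTemperedDistribution_toLp_eq,
    Lp.toTemperedDistribution_toLp_eq, TemperedDistribution.laplacian_toTemperedDistributionCLM_eq,
    map_smul]

end Free

/-! ### Tensor products of Schwartz functions -/

theorem norm_iteratedFDeriv_comp_proj_le (g : 𝓢(ℝ, ℂ)) (j : Fin 2) (n : ℕ) (x : Config) :
    ‖iteratedFDeriv ℝ n (fun x : Config => g (x j)) x‖ ≤ ‖iteratedFDeriv ℝ n g (x j)‖ := by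
  have hp : ‖(EuclideanSpace.proj j : Config →L[ℝ] ℝ)‖ ≤ 1 :=
    ContinuousLinearMap.opNorm_le_bound _ zero_le_one fun x => by
      simpa using PiLp.norm_apply_le x j
  have h := (EuclideanSpace.proj j : Config →L[ℝ] ℝ).iteratedFDeriv_comp_right
    (g.smooth (n : ℕ∞)) x (i := n) le_rfl
  change ‖iteratedFDeriv ℝ n (g ∘ (EuclideanSpace.proj j : Config →L[ℝ] ℝ)) x‖ ≤ _
  rw [h]
  refine (ContinuousMultilinearMap.norm_compContinuousLinearMap_le _ _).trans ?_
  refine mul_le_of_le_one_right (norm_nonneg _) ?_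
  exact Finset.prod_le_one (fun _ _ => norm_nonneg _) fun _ _ => hp

theorem contDiff_comp_proj (g : 𝓢(ℝ, ℂ)) (j : Fin 2) (n : ℕ∞) :
    ContDiff ℝ n fun x : Config => g (x j) :=
  (g.smooth n).comp (EuclideanSpace.proj j : Config →L[ℝ] ℝ).contDiff

/-- The estimate for one Leibniz term of a tensor product: the weight splits into a part `p` for the
first factor and a part `q` for the second. -/
theorem weighted_mul_le {X m A A' B B' c p q S₁ S₂ S₃ S₄ : ℝ} (hA' : 0 ≤ A') (hA : A' ≤ A)
    (hB' : 0 ≤ B') (hB : B' ≤ B) (hp : 0 ≤ p) (hq : 0 ≤ q) (hc : 0 ≤ c) (hX : X ≤ c * (p + q))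
    (h₁ : p * A ≤ S₁) (h₂ : A ≤ S₂) (h₃ : B ≤ S₃) (h₄ : q * B ≤ S₄) (hm : 0 ≤ m) :
    X * (m * A' * B') ≤ m * (c * (S₁ * S₃ + S₂ * S₄)) := by
  have hA0 := hA'.trans hA
  have hB0 := hB'.trans hB
  have h1 : p * A * B ≤ S₁ * S₃ := mul_le_mul h₁ h₃ hB0 ((by positivity : 0 ≤ p * A).trans h₁)
  have h2 : A * (q * B) ≤ S₂ * S₄ := mul_le_mul h₂ h₄ (by positivity) (hA0.trans h₂)
  calc X * (m * A' * B') ≤ c * (p + q) * (m * A * B) := by gcongr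
    _ = m * (c * (p * A * B + A * (q * B))) := by ring
    _ ≤ _ := by gcongr

/-- The tensor product `(x₁, x₂) ↦ g (x₁) h (x₂)` of two Schwartz functions. -/
def tensorS (g h : 𝓢(ℝ, ℂ)) : 𝓢(Config, ℂ) where
  toFun x := g (x 0) * h (x 1)
  smooth' := (contDiff_comp_proj g 0 _).mul (contDiff_comp_proj h 1 _)
  decay' k n := by
    let S := fun (u : 𝓢(ℝ, ℂ)) k n => SchwartzMap.seminorm ℝ k n u
    refine ⟨∑ i ∈ Finset.range (n + 1), n.choose i *
      (2 ^ (k - 1) * (S g k i * S h 0 (n - i) + S g 0 i * S h k (n - i))), fun x => ?_⟩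
    have h1 := norm_iteratedFDeriv_mul_le (𝕜 := ℝ) (n := n) (N := (⊤ : ℕ∞))
      (contDiff_comp_proj g 0 ⊤) (contDiff_comp_proj h 1 ⊤) x (by exact_mod_cast le_top)
    have hx : ‖x‖ ^ k ≤ 2 ^ (k - 1) * (‖x 0‖ ^ k + ‖x 1‖ ^ k) := by
      refine le_trans (pow_le_pow_left₀ (norm_nonneg x) ?_ k)
        (add_pow_le (norm_nonneg (x 0)) (norm_nonneg (x 1)) k)
      rw [EuclideanSpace.norm_eq, Fin.sum_univ_two]
      refine Real.sqrt_le_iff.2 ⟨by positivity, ?_⟩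
      nlinarith [mul_nonneg (norm_nonneg (x 0)) (norm_nonneg (x 1))]
    refine (mul_le_mul_of_nonneg_left h1 (by positivity)).trans ?_
    rw [Finset.mul_sum]
    refine Finset.sum_le_sum fun i _ => ?_
    have a1 := norm_iteratedFDeriv_comp_proj_le g 0 i x
    have a2 := norm_iteratedFDeriv_comp_proj_le h 1 (n - i) x
    have b1 := SchwartzMap.le_seminorm ℝ k i g (x 0)
    have b2 := SchwartzMap.norm_iteratedFDeriv_le_seminorm ℝ g i (x 0)
    have b3 := SchwartzMap.le_seminorm ℝ k (n - i) h (x 1)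
    have b4 := SchwartzMap.norm_iteratedFDeriv_le_seminorm ℝ h (n - i) (x 1)
    have hA := norm_nonneg (iteratedFDeriv ℝ i (fun x : Config => g (x 0)) x)
    have hB := norm_nonneg (iteratedFDeriv ℝ (n - i) (fun x : Config => h (x 1)) x)
    exact weighted_mul_le hA a1 hB a2 (by positivity) (by positivity) (by positivity) hx b1 b2
      b4 b3 (by positivity)

theorem tensorS_apply (g h : 𝓢(ℝ, ℂ)) (x : Config) : tensorS g h x = g (x 0) * h (x 1) := rfl

theorem measurePreserving_config_prod :
    MeasurePreserving (fun x : Config => (x 0, x 1)) :=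
  (volume_preserving_finTwoArrow ℝ).comp (PiLp.volume_preserving_ofLp (Fin 2))

theorem integral_config_mul {𝕜 : Type*} [RCLike 𝕜] (g h : ℝ → 𝕜) :
    ∫ x : Config, g (x 0) * h (x 1) = (∫ x, g x) * ∫ x, h x := by
  rw [← integral_prod_mul]
  have he : MeasurableEmbedding (fun x : Config => (x 0, x 1)) :=
    ((MeasurableEquiv.toLp 2 (Fin 2 → ℝ)).symm.trans
      MeasurableEquiv.finTwoArrow).measurableEmbedding
  exact measurePreserving_config_prod.integral_comp he fun z : ℝ × ℝ => g z.1 * h z.2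

theorem norm_sq_toLp {E : Type*} [NormedAddCommGroup E] [NormedSpace ℝ E] [MeasurableSpace E]
    [BorelSpace E] [SecondCountableTopology E] {μ : Measure E} [μ.HasTemperateGrowth]
    (u : 𝓢(E, ℂ)) : ‖u.toLp 2 μ‖ ^ 2 = ∫ x, ‖u x‖ ^ 2 ∂μ := by
  rw [norm_sq_Lp_two]
  refine integral_congr_ae ?_
  filter_upwards [u.coeFn_toLp 2 μ] with x hx
  rw [hx]

theorem norm_toLp_tensorS (g h : 𝓢(ℝ, ℂ)) :
    ‖(tensorS g h).toLp 2 volume‖ = ‖g.toLp 2 volume‖ * ‖h.toLp 2 volume‖ := by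
  refine (pow_left_inj₀ (norm_nonneg _) (by positivity) two_ne_zero).1 ?_
  rw [mul_pow]
  rw [norm_sq_toLp, norm_sq_toLp, norm_sq_toLp, ← integral_config_mul]
  refine integral_congr_ae (Eventually.of_forall fun x => ?_)
  change ‖g (x 0) * h (x 1)‖ ^ 2 = _
  rw [norm_mul, mul_pow]

theorem fourier_tensorS (g h : 𝓢(ℝ, ℂ)) : 𝓕 (tensorS g h) = tensorS (𝓕 g) (𝓕 h) := by
  ext ξ
  rw [tensorS_apply, SchwartzMap.fourier_coe, SchwartzMap.fourier_coe, SchwartzMap.fourier_coe,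
    Real.fourier_eq', Real.fourier_eq', Real.fourier_eq', ← integral_config_mul]
  refine integral_congr_ae (Eventually.of_forall fun x => ?_)
  simp only [smul_eq_mul, tensorS_apply, PiLp.inner_apply, Fin.sum_univ_two]
  rw [mul_mul_mul_comm, ← Complex.exp_add]
  congr 2
  push_cast
  ring

/-- The kinetic symbol is the sum of its one-particle symbols, so its phase factorizes. -/
theorem freeSchwartz_tensorS (c t : ℝ) (g h : 𝓢(ℝ, ℂ)) :
    freeSchwartz Config c t (tensorS g h) =
      tensorS (freeSchwartz ℝ c t g) (freeSchwartz ℝ c t h) := by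
  refine fourier_injective_schwartz Config fun ξ => ?_
  rw [fourier_freeSchwartz_apply, fourier_tensorS, fourier_tensorS, tensorS_apply, tensorS_apply,
    fourier_freeSchwartz_apply, fourier_freeSchwartz_apply, mul_mul_mul_comm, ← Complex.exp_add]
  congr 2
  simp only [kinetic, EuclideanSpace.norm_sq_eq, Fin.sum_univ_two]
  push_cast
  ring

theorem tensorS_add_left (g g' h : 𝓢(ℝ, ℂ)) : tensorS (g + g') h = tensorS g h + tensorS g' h := by
  ext x
  simp [tensorS_apply, add_mul]

theorem tensorS_smul_left (c : ℂ) (g h : 𝓢(ℝ, ℂ)) : tensorS (c • g) h = c • tensorS g h := by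
  ext x
  simp [tensorS_apply, mul_assoc]

/-- Tensoring with a fixed Schwartz function, as a map into `L²(ℝ²)`. -/
def tensorRight (h : 𝓢(ℝ, ℂ)) : 𝓢(ℝ, ℂ) →ₗ[ℂ] L2 where
  toFun g := (tensorS g h).toLp 2 volume
  map_add' g g' := by
    rw [tensorS_add_left]
    exact map_add (SchwartzMap.toLpCLM ℂ ℂ 2 (volume : Measure Config)) _ _
  map_smul' c g := by
    rw [tensorS_smul_left]
    exact map_smul (SchwartzMap.toLpCLM ℂ ℂ 2 (volume : Measure Config)) c _

theorem tensor_eq_toLp (g h : 𝓢(ℝ, ℂ)) {g' h' : ℝ → ℂ} (hg' : MemLp g' 2) (hh' : MemLp h' 2)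
    (hg : g' = g) (hh : h' = h) : tensor hg' hh' = (tensorS g h).toLp 2 volume := by
  subst hg hh
  rfl

/-! ### Position, momentum and wave packets on the Schwartz space of the line -/

/-- Differentiation of Schwartz functions. -/
def D : 𝓢(ℝ, ℂ) →L[ℂ] 𝓢(ℝ, ℂ) := SchwartzMap.derivCLM ℂ ℂ

theorem D_apply (h : 𝓢(ℝ, ℂ)) (x : ℝ) : D h x = deriv h x := rfl

theorem D_eq_lineDeriv (h : 𝓢(ℝ, ℂ)) : D h = ∂_{(1 : ℝ)} h := by
  ext x
  rw [SchwartzMap.lineDerivOp_apply_eq_fderiv, D_apply, fderiv_apply_one_eq_deriv]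

theorem hasTemperateGrowth_ofReal : (fun x : ℝ => (x : ℂ)).HasTemperateGrowth :=
  Function.Complex.hasTemperateGrowth_ofReal

/-- Multiplication by the coordinate. -/
def X : 𝓢(ℝ, ℂ) →L[ℂ] 𝓢(ℝ, ℂ) := SchwartzMap.smulLeftCLM ℂ (fun x : ℝ => (x : ℂ))

theorem X_apply (h : 𝓢(ℝ, ℂ)) (x : ℝ) : X h x = x * h x :=
  SchwartzMap.smulLeftCLM_apply_apply hasTemperateGrowth_ofReal h x

theorem laplacian_eq_D_D (h : 𝓢(ℝ, ℂ)) : Δ h = D (D h) := by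
  rw [SchwartzMap.laplacian_eq_sum (OrthonormalBasis.singleton (Fin 1) ℝ), D_eq_lineDeriv,
    D_eq_lineDeriv]
  exact (Fintype.sum_subsingleton _ (0 : Fin 1)).trans
    (by rw [OrthonormalBasis.singleton_apply])

theorem fourier_D_apply (h : 𝓢(ℝ, ℂ)) (ξ : ℝ) : 𝓕 (D h) ξ = 2 * Real.pi * I * (ξ * 𝓕 h ξ) := by
  have hg : (inner ℝ · (1 : ℝ) : ℝ → ℝ).HasTemperateGrowth := by fun_prop
  rw [D_eq_lineDeriv, SchwartzMap.fourier_lineDerivOp_eq, smul_apply,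
    SchwartzMap.smulLeftCLM_apply_apply hg]
  simp

theorem deriv_fourier (h : 𝓢(ℝ, ℂ)) (ξ : ℝ) :
    deriv (𝓕 h : 𝓢(ℝ, ℂ)) ξ = -(2 * Real.pi * I) * 𝓕 (X h) ξ := by
  have hg : (inner ℝ · (1 : ℝ) : ℝ → ℝ).HasTemperateGrowth := by fun_prop
  have h1 : SchwartzMap.smulLeftCLM ℂ (inner ℝ · (1 : ℝ) : ℝ → ℝ) h = X h := by
    ext x
    rw [SchwartzMap.smulLeftCLM_apply_apply hg, X_apply]
    simp
  rw [← D_apply, D_eq_lineDeriv, SchwartzMap.lineDerivOp_fourier_eq, h1,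
    FourierTransform.fourier_smul, smul_apply, smul_eq_mul]

theorem D_freeSchwartz (c s : ℝ) (h : 𝓢(ℝ, ℂ)) :
    D (freeSchwartz ℝ c s h) = freeSchwartz ℝ c s (D h) := by
  refine fourier_injective_schwartz ℝ fun ξ => ?_
  rw [fourier_D_apply, fourier_freeSchwartz_apply, fourier_freeSchwartz_apply, fourier_D_apply]
  ring

/-- Heisenberg evolution `x + c s p` with `p = -i D`, obtained by differentiating the Fourier phase.
-/
theorem X_freeSchwartz (c s : ℝ) (h : 𝓢(ℝ, ℂ)) :
    X (freeSchwartz ℝ c s h) = freeSchwartz ℝ c s (X h - (I * (c * s : ℝ)) • D h) := by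
  refine fourier_injective_schwartz ℝ fun ξ => ?_
  have hπ : (2 * Real.pi * I : ℂ) ≠ 0 := by simp [Real.pi_ne_zero]
  refine mul_left_cancel₀ (neg_ne_zero.2 hπ) ?_
  rw [← deriv_fourier, fourier_freeSchwartz_apply]
  have h1 : ((𝓕 (freeSchwartz ℝ c s h) : 𝓢(ℝ, ℂ)) : ℝ → ℂ) =
      fun ξ => exp (((-(s * kinetic ℝ c ξ) : ℝ) : ℂ) * I) * 𝓕 h ξ :=
    funext fun ξ => fourier_freeSchwartz_apply ℝ c s h ξ
  have h2 : HasDerivAt (fun ξ => -(s * kinetic ℝ c ξ))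
      (-(s * (c / 2 * (2 * Real.pi) ^ 2 * (2 * ξ)))) ξ := by
    have h3 : (kinetic ℝ c) = fun ξ => c / 2 * (2 * Real.pi) ^ 2 * ξ ^ 2 := by
      funext ξ
      rw [kinetic, Real.norm_eq_abs, sq_abs]
    rw [h3]
    have := (((hasDerivAt_pow 2 ξ).const_mul (c / 2 * (2 * Real.pi) ^ 2)).const_mul s).fun_neg
    simpa using this
  have h4 := ((h2.ofReal_comp.mul_const I).cexp).mul (SchwartzMap.hasDerivAt (𝓕 h) ξ)
  rw [h1]
  refine h4.deriv.trans ?_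
  have h5 : 𝓕 (X h - (I * (c * s : ℝ)) • D h) = 𝓕 (X h) - 𝓕 ((I * (c * s : ℝ)) • D h) :=
    map_sub (FourierTransform.fourierCLE ℂ 𝓢(ℝ, ℂ)) _ _
  rw [deriv_fourier, h5, FourierTransform.fourier_smul, sub_apply, smul_apply,
    fourier_D_apply, smul_eq_mul]
  push_cast
  linear_combination -(exp (-(s * kinetic ℝ c ξ) * I) * 𝓕 h ξ * c * s * (2 * Real.pi) ^ 2 * ξ * I) *
    I_sq

theorem hasTemperateGrowth_cexp_linear (k : ℝ) :
    (fun x : ℝ => exp (I * (k : ℂ) * (x : ℂ))).HasTemperateGrowth := by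
  have h := hasTemperateGrowth_cexp_ofReal_mul_I.comp
    ((Function.HasTemperateGrowth.const k).mul (Function.HasTemperateGrowth.id' (E := ℝ)))
  convert h using 2 with x
  change _ = exp (((k * x : ℝ) : ℂ) * I)
  rw [ofReal_mul, mul_comm _ I, mul_assoc]

/-- The wave packet operator `h ↦ σ^{-1/2} h ((x - q) / σ) exp (i k x)`. -/
def packet {σ : ℝ} (hσ : σ ≠ 0) (q k : ℝ) : 𝓢(ℝ, ℂ) →L[ℂ] 𝓢(ℝ, ℂ) :=
  ((1 / √σ : ℝ) : ℂ) •
    (SchwartzMap.smulLeftCLM ℂ (fun x : ℝ => exp (I * (k : ℂ) * (x : ℂ))) ∘L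
      SchwartzMap.compSubConstCLM ℂ q ∘L
      SchwartzMap.compCLMOfContinuousLinearEquiv ℂ
        (ContinuousLinearEquiv.smulLeft (Units.mk0 σ⁻¹ (inv_ne_zero hσ)) : ℝ ≃L[ℝ] ℝ))

theorem packet_apply {σ : ℝ} (hσ : σ ≠ 0) (q k : ℝ) (h : 𝓢(ℝ, ℂ)) (x : ℝ) :
    packet hσ q k h x = ((1 / √σ : ℝ) : ℂ) * h ((x - q) / σ) * exp (I * (k : ℂ) * (x : ℂ)) := by
  have h1 := SchwartzMap.smulLeftCLM_apply_apply (hasTemperateGrowth_cexp_linear k)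
    (SchwartzMap.compSubConstCLM ℂ q (SchwartzMap.compCLMOfContinuousLinearEquiv ℂ
        (ContinuousLinearEquiv.smulLeft (Units.mk0 σ⁻¹ (inv_ne_zero hσ)) : ℝ ≃L[ℝ] ℝ) h)) x
  refine (congrArg (((1 / √σ : ℝ) : ℂ) * ·) h1).trans ?_
  change _ * (exp (I * (k : ℂ) * (x : ℂ)) * h (σ⁻¹ * (x - q))) = _
  rw [inv_mul_eq_div]
  ring

theorem integral_comp_affine {E : Type*} [NormedAddCommGroup E] [NormedSpace ℝ E]
    (g : ℝ → E) (σ q : ℝ) : ∫ x, g ((x - q) / σ) = |σ| • ∫ y, g y := by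
  rw [integral_sub_right_eq_self (fun x => g (x / σ)) q, Measure.integral_comp_div]

theorem norm_toLp_packet {σ : ℝ} (hσ : 0 < σ) (q k : ℝ) (h : 𝓢(ℝ, ℂ)) :
    ‖(packet hσ.ne' q k h).toLp 2 volume‖ = ‖h.toLp 2 volume‖ := by
  refine (pow_left_inj₀ (norm_nonneg _) (norm_nonneg _) two_ne_zero).1 ?_
  rw [norm_sq_toLp, norm_sq_toLp]
  have h1 : ∀ x, ‖packet hσ.ne' q k h x‖ ^ 2 = σ⁻¹ * ‖h ((x - q) / σ)‖ ^ 2 := by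
    intro x
    have he : ‖exp (I * (k : ℂ) * (x : ℂ))‖ = 1 := by
      rw [mul_assoc, mul_comm, ← ofReal_mul]
      exact norm_exp_ofReal_mul_I _
    rw [packet_apply, norm_mul, norm_mul, he, mul_one, mul_pow, norm_real, Real.norm_eq_abs,
      sq_abs, div_pow, Real.sq_sqrt hσ.le, one_pow, one_div]
  simp only [h1]
  rw [integral_const_mul, integral_comp_affine (fun y => ‖h y‖ ^ 2), abs_of_pos hσ, smul_eq_mul,
    inv_mul_cancel_left₀ hσ.ne']

theorem fourier_packet_apply {σ : ℝ} (hσ : 0 < σ) (q k : ℝ) (h : 𝓢(ℝ, ℂ)) (ξ : ℝ) :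
    𝓕 (packet hσ.ne' q k h) ξ =
      √σ * exp (I * ((q * (k - 2 * Real.pi * ξ) : ℝ) : ℂ)) *
        𝓕 h (σ * (ξ - k / (2 * Real.pi))) := by
  rw [SchwartzMap.fourier_coe, SchwartzMap.fourier_coe, Real.fourier_eq', Real.fourier_eq']
  have h1 : ∀ x, exp (((-2 * Real.pi * inner ℝ x ξ : ℝ) : ℂ) * I) • packet hσ.ne' q k h x =
      (fun y => ((1 / √σ : ℝ) : ℂ) * exp (I * ((q * (k - 2 * Real.pi * ξ) : ℝ) : ℂ)) *
        (exp (((-2 * Real.pi * inner ℝ y (σ * (ξ - k / (2 * Real.pi))) : ℝ) : ℂ) * I) • h y))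
        ((x - q) / σ) := by
    intro x
    rw [packet_apply]
    simp only [smul_eq_mul, Real.inner_apply]
    have h2 : exp (((-2 * Real.pi * (x * ξ) : ℝ) : ℂ) * I) * exp (I * (k : ℂ) * (x : ℂ)) =
        exp (I * ((q * (k - 2 * Real.pi * ξ) : ℝ) : ℂ)) *
        exp (((-2 * Real.pi * ((x - q) / σ * (σ * (ξ - k / (2 * Real.pi)))) : ℝ) : ℂ) * I) := by
      rw [← Complex.exp_add, ← Complex.exp_add]
      congr 1
      push_cast
      have hσ' : (σ : ℂ) ≠ 0 := by exact_mod_cast hσ.ne'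
      have hπ : (Real.pi : ℂ) ≠ 0 := by exact_mod_cast Real.pi_ne_zero
      field_simp
      ring
    linear_combination ((1 / √σ : ℝ) : ℂ) * h ((x - q) / σ) * h2
  simp only [h1]
  rw [integral_comp_affine (fun y => ((1 / √σ : ℝ) : ℂ) *
    exp (I * ((q * (k - 2 * Real.pi * ξ) : ℝ) : ℂ)) *
        (exp (((-2 * Real.pi * inner ℝ y (σ * (ξ - k / (2 * Real.pi))) : ℝ) : ℂ) * I) • h y)),
    integral_const_mul, abs_of_pos hσ, real_smul, ← mul_assoc, ← mul_assoc, ← ofReal_mul]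
  congr 4
  rw [mul_one_div, div_eq_iff (Real.sqrt_pos.2 hσ).ne', Real.mul_self_sqrt hσ.le]

/-- Galilean covariance, from completing the square in the Fourier phase. The constant `c = σ²`
matches the packet width, so the profile evolves with constant `1`; for `σ = ε`, `k = P / ε²` the
centre moves at velocity `P`. -/
theorem freeSchwartz_packet {σ : ℝ} (hσ : 0 < σ) (q k s : ℝ) (h : 𝓢(ℝ, ℂ)) :
    freeSchwartz ℝ (σ ^ 2) s (packet hσ.ne' q k h) =
      exp (((-(s * σ ^ 2 * k ^ 2 / 2) : ℝ) : ℂ) * I) •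
        packet hσ.ne' (q + s * σ ^ 2 * k) k (freeSchwartz ℝ 1 s h) := by
  refine fourier_injective_schwartz ℝ fun ξ => ?_
  rw [fourier_freeSchwartz_apply, FourierTransform.fourier_smul, smul_apply,
    fourier_packet_apply hσ, fourier_packet_apply hσ, fourier_freeSchwartz_apply, smul_eq_mul]
  have h1 : exp (((-(s * kinetic ℝ (σ ^ 2) ξ) : ℝ) : ℂ) * I) *
      exp (I * ((q * (k - 2 * Real.pi * ξ) : ℝ) : ℂ)) =
      exp (((-(s * σ ^ 2 * k ^ 2 / 2) : ℝ) : ℂ) * I) *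
        exp (I * (((q + s * σ ^ 2 * k) * (k - 2 * Real.pi * ξ) : ℝ) : ℂ)) *
        exp (((-(s * kinetic ℝ 1 (σ * (ξ - k / (2 * Real.pi)))) : ℝ) : ℂ) * I) := by
    rw [← Complex.exp_add, ← Complex.exp_add, ← Complex.exp_add]
    congr 1
    rw [mul_comm I, mul_comm I, ← add_mul, ← add_mul, ← add_mul, ← ofReal_add, ← ofReal_add,
      ← ofReal_add]
    congr 2
    simp only [kinetic, Real.norm_eq_abs, sq_abs]
    have hπ := Real.pi_ne_zero
    field_simp
    ring
  linear_combination (√σ : ℂ) * 𝓕 h (σ * (ξ - k / (2 * Real.pi))) * h1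

/-! ### Decay estimates for the free evolution on the line -/

/-- The `L²` norm of a Schwartz function. -/
def nrm : Seminorm ℂ 𝓢(ℝ, ℂ) :=
  (normSeminorm ℂ (Lp ℂ 2 (volume : Measure ℝ))).comp
    (SchwartzMap.toLpCLM ℂ ℂ 2 (volume : Measure ℝ)).toLinearMap

theorem nrm_eq (h : 𝓢(ℝ, ℂ)) : nrm h = ‖h.toLp 2 volume‖ := rfl

theorem toLp_sub {E : Type*} [NormedAddCommGroup E] [NormedSpace ℝ E] [MeasurableSpace E]
    [BorelSpace E] [SecondCountableTopology E] (μ : Measure E) [μ.HasTemperateGrowth]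
    (g h : 𝓢(E, ℂ)) : (g - h).toLp 2 μ = g.toLp 2 μ - h.toLp 2 μ :=
  map_sub (SchwartzMap.toLpCLM ℂ ℂ 2 μ) g h

theorem toLp_smul {E : Type*} [NormedAddCommGroup E] [NormedSpace ℝ E] [MeasurableSpace E]
    [BorelSpace E] [SecondCountableTopology E] (μ : Measure E) [μ.HasTemperateGrowth]
    (c : ℂ) (h : 𝓢(E, ℂ)) : (c • h).toLp 2 μ = c • h.toLp 2 μ :=
  map_smul (SchwartzMap.toLpCLM ℂ ℂ 2 μ) c h

theorem nrm_le_of_le {u v : 𝓢(ℝ, ℂ)} {C : ℝ} (h : ∀ x, ‖u x‖ ≤ C * ‖v x‖) :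
    nrm u ≤ C * nrm v := by
  rw [nrm_eq, nrm_eq]
  refine Lp.norm_le_mul_norm_of_ae_le_mul ?_
  filter_upwards [u.coeFn_toLp 2 volume, v.coeFn_toLp 2 volume] with x h1 h2
  rw [h1, h2]
  exact h x

theorem nrm_freeSchwartz (c s : ℝ) (h : 𝓢(ℝ, ℂ)) : nrm (freeSchwartz ℝ c s h) = nrm h :=
  norm_toLp_freeSchwartz ℝ c s h

/-- Multiplication by `1 + x²`. -/
def G : 𝓢(ℝ, ℂ) →L[ℂ] 𝓢(ℝ, ℂ) := ContinuousLinearMap.id ℂ _ + X ∘L X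

theorem G_eq (h : 𝓢(ℝ, ℂ)) : G h = h + X (X h) := rfl

theorem G_pow_apply (k : ℕ) (h : 𝓢(ℝ, ℂ)) (x : ℝ) : (G ^ k) h x = ((1 + x ^ 2) ^ k : ℝ) * h x := by
  induction k generalizing h with
  | zero => simp
  | succ k ih =>
    rw [pow_succ, mul_apply_eq_comp, ih, G_eq, add_apply, X_apply, X_apply]
    push_cast
    ring

theorem G_freeSchwartz (s : ℝ) (h : 𝓢(ℝ, ℂ)) :
    G (freeSchwartz ℝ 1 s h) = freeSchwartz ℝ 1 s
      (G h - (I * s : ℂ) • (X (D h) + D (X h)) - ((s : ℂ) ^ 2) • D (D h)) := by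
  rw [G_eq, X_freeSchwartz, X_freeSchwartz, ← map_add]
  congr 1
  rw [G_eq, one_mul]
  simp only [map_sub, map_smul, smul_sub, smul_smul]
  have h1 : (I * (s : ℂ)) * (I * s) = -((s : ℂ) ^ 2) := by
    linear_combination (s : ℂ) ^ 2 * I_sq
  rw [h1]
  module

theorem nrm_G_freeSchwartz_le (s : ℝ) (h : 𝓢(ℝ, ℂ)) :
    nrm (G (freeSchwartz ℝ 1 s h)) ≤
      nrm (G h) + |s| * (nrm (X (D h)) + nrm (D (X h))) + s ^ 2 * nrm (D (D h)) := by
  rw [G_freeSchwartz, nrm_freeSchwartz]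
  refine (map_sub_le_add nrm _ _).trans (add_le_add ((map_sub_le_add nrm _ _).trans ?_) ?_)
  · rw [map_smul_eq_mul, norm_mul, norm_I, one_mul, norm_real, Real.norm_eq_abs]
    gcongr
    exact map_add_le_add nrm _ _
  · rw [map_smul_eq_mul, norm_pow, norm_real, Real.norm_eq_abs, sq_abs]

/-- By induction on the power: commuting one `G` through the evolution leaves evolutions of other
fixed Schwartz functions, with coefficients polynomial in `s`. -/
theorem exists_nrm_G_pow_freeSchwartz_le (k : ℕ) (T : ℝ) (h : 𝓢(ℝ, ℂ)) :
    ∃ C, 0 ≤ C ∧ ∀ s, |s| ≤ T → nrm ((G ^ k) (freeSchwartz ℝ 1 s h)) ≤ C := by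
  induction k generalizing h with
  | zero => exact ⟨nrm h, apply_nonneg _ _, fun s _ => by simp [nrm_freeSchwartz]⟩
  | succ k ih =>
    obtain ⟨C₁, h₁, H₁⟩ := ih (G h)
    obtain ⟨C₂, h₂, H₂⟩ := ih (X (D h) + D (X h))
    obtain ⟨C₃, h₃, H₃⟩ := ih (D (D h))
    refine ⟨C₁ + |T| * C₂ + T ^ 2 * C₃, by positivity, fun s hs => ?_⟩
    have hT : |s| ≤ |T| := hs.trans (le_abs_self T)
    rw [pow_succ, mul_apply_eq_comp, G_freeSchwartz]
    simp only [map_sub, map_smul]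
    refine (map_sub_le_add nrm _ _).trans (add_le_add ((map_sub_le_add nrm _ _).trans ?_) ?_)
    · rw [map_smul_eq_mul, norm_mul, norm_I, one_mul, norm_real, Real.norm_eq_abs]
      exact add_le_add (H₁ s hs) (mul_le_mul hT (H₂ s hs) (apply_nonneg _ _) (abs_nonneg _))
    · rw [map_smul_eq_mul, norm_pow, norm_real, Real.norm_eq_abs, sq_abs]
      exact mul_le_mul (sq_le_sq.2 hT) (H₃ s hs) (apply_nonneg _ _) (by positivity)

/-- Multiplication by the translate `W (· + ρ)` of a Schwartz function. -/
def shiftMul (W : 𝓢(ℝ, ℂ)) (ρ : ℝ) : 𝓢(ℝ, ℂ) →L[ℂ] 𝓢(ℝ, ℂ) :=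
  SchwartzMap.smulLeftCLM ℂ (SchwartzMap.compSubConstCLM ℂ (-ρ) W)

theorem shiftMul_apply (W : 𝓢(ℝ, ℂ)) (ρ : ℝ) (h : 𝓢(ℝ, ℂ)) (x : ℝ) :
    shiftMul W ρ h x = W (x + ρ) * h x := by
  rw [shiftMul, SchwartzMap.smulLeftCLM_apply_apply (SchwartzMap.hasTemperateGrowth _),
    SchwartzMap.compSubConstCLM_apply, sub_neg_eq_add, smul_eq_mul]

theorem D_shiftMul (W : 𝓢(ℝ, ℂ)) (ρ : ℝ) (h : 𝓢(ℝ, ℂ)) :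
    D (shiftMul W ρ h) = shiftMul (D W) ρ h + shiftMul W ρ (D h) := by
  ext x
  have h1 : (shiftMul W ρ h : ℝ → ℂ) = fun x => W (x + ρ) * h x :=
    funext (shiftMul_apply W ρ h)
  rw [D_apply, h1, add_apply, shiftMul_apply, shiftMul_apply, D_apply, D_apply]
  exact (((W.hasDerivAt (x + ρ)).comp_add_const x ρ).mul (h.hasDerivAt x)).deriv

/-- Peetre's inequality `1 + ρ² ≤ 2 (1 + (x + ρ)²) (1 + x²)`: at distance `ρ` either the potential
or the profile is small. -/
theorem exists_nrm_shiftMul_le (k : ℕ) (W : 𝓢(ℝ, ℂ)) :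
    ∃ C, 0 ≤ C ∧ ∀ ρ h, nrm (shiftMul W ρ h) ≤ C / (1 + ρ ^ 2) ^ k * nrm ((G ^ k) h) := by
  refine ⟨2 ^ k * SchwartzMap.seminorm ℝ 0 0 ((G ^ k) W), by positivity, fun ρ h => ?_⟩
  refine nrm_le_of_le fun x => ?_
  have hW := SchwartzMap.norm_le_seminorm ℝ ((G ^ k) W) (x + ρ)
  rw [G_pow_apply, norm_mul, norm_real, Real.norm_of_nonneg (by positivity)] at hW
  rw [shiftMul_apply, G_pow_apply, norm_mul, norm_mul, norm_real,
    Real.norm_of_nonneg (by positivity), div_mul_eq_mul_div, le_div_iff₀ (by positivity)]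
  have hP : 1 + ρ ^ 2 ≤ 2 * (1 + (x + ρ) ^ 2) * (1 + x ^ 2) := by
    nlinarith [sq_nonneg (2 * x + ρ), sq_nonneg ((x + ρ) * x)]
  calc ‖W (x + ρ)‖ * ‖h x‖ * (1 + ρ ^ 2) ^ k
      ≤ ‖W (x + ρ)‖ * ‖h x‖ * (2 * (1 + (x + ρ) ^ 2) * (1 + x ^ 2)) ^ k := by gcongr
    _ = 2 ^ k * ((1 + (x + ρ) ^ 2) ^ k * ‖W (x + ρ)‖) * ((1 + x ^ 2) ^ k * ‖h x‖) := by
      rw [mul_pow, mul_pow]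
      ring
    _ ≤ _ := by gcongr

theorem exists_nrm_shiftMul_freeSchwartz_le (k : ℕ) (W h : 𝓢(ℝ, ℂ)) (T : ℝ) :
    ∃ C, 0 ≤ C ∧ ∀ ρ s, |s| ≤ T →
      nrm (shiftMul W ρ (freeSchwartz ℝ 1 s h)) ≤ C / (1 + ρ ^ 2) ^ k := by
  obtain ⟨C, hC, H⟩ := exists_nrm_shiftMul_le k W
  obtain ⟨C', hC', H'⟩ := exists_nrm_G_pow_freeSchwartz_le k T h
  refine ⟨C * C', by positivity, fun ρ s hs => (H ρ _).trans ?_⟩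
  rw [mul_comm C C', mul_div_assoc, mul_comm]
  exact mul_le_mul_of_nonneg_right (H' s hs) (by positivity)

/-! ### Time dependence of the interaction picture on the line -/

theorem toLp_smulLeft {E : Type*} [NormedAddCommGroup E] [NormedSpace ℝ E] [MeasurableSpace E]
    [BorelSpace E] [SecondCountableTopology E] {μ : Measure E} [μ.HasTemperateGrowth]
    (Q : E →ᵇ ℂ) (hQ : (Q : E → ℂ).HasTemperateGrowth) (h : 𝓢(E, ℂ)) :
    (SchwartzMap.smulLeftCLM ℂ (Q : E → ℂ) h).toLp 2 μ = bmul Q (h.toLp 2 μ) := by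
  ext1
  filter_upwards [SchwartzMap.coeFn_toLp (SchwartzMap.smulLeftCLM ℂ (Q : E → ℂ) h) 2 μ,
    h.coeFn_toLp 2 μ, coeFn_bmul Q (h.toLp 2 μ)] with x h1 h2 h3
  rw [h1, h3, h2, SchwartzMap.smulLeftCLM_apply_apply hQ, smul_eq_mul]

theorem toLp_shiftMul (W : 𝓢(ℝ, ℂ)) (ρ : ℝ) (h : 𝓢(ℝ, ℂ)) :
    (shiftMul W ρ h).toLp 2 volume =
      bmul (SchwartzMap.compSubConstCLM ℂ (-ρ) W).toBoundedContinuousFunction (h.toLp 2 volume) :=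
  toLp_smulLeft (SchwartzMap.compSubConstCLM ℂ (-ρ) W).toBoundedContinuousFunction
    (SchwartzMap.compSubConstCLM ℂ (-ρ) W).hasTemperateGrowth h

theorem hasDerivAt_toLp_freeSchwartz (h : 𝓢(ℝ, ℂ)) (s : ℝ) :
    HasDerivAt (fun s => (freeSchwartz ℝ 1 s h).toLp 2 volume)
      ((freeSchwartz ℝ 1 s ((I / 2 : ℂ) • D (D h))).toLp 2 volume) s := by
  have h1 := (isUnitaryGroup_freeGroup ℝ 1).hasDerivAt_apply (hasDerivAt_freeGroup_toLp ℝ 1 h) s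
  simp only [toLp_freeSchwartz]
  have h2 : (I * ((1 : ℝ) / 2) : ℂ) = I / 2 := by
    push_cast
    ring
  rwa [laplacian_eq_D_D, h2] at h1

/-- The derivative is a commutator of the Laplacian with multiplication by `W`, so the terms `W h''`
cancel. Every surviving term carries `W'` or `W''` and thus keeps the decay in `ρ`. -/
theorem hasDerivAt_interaction_picture (W h : 𝓢(ℝ, ℂ)) (ρ s : ℝ) :
    HasDerivAt (fun s => (freeSchwartz ℝ 1 (-s) (shiftMul W ρ (freeSchwartz ℝ 1 s h))).toLp 2 volume)
      (((-(I / 2) : ℂ) • freeSchwartz ℝ 1 (-s) (shiftMul (D (D W)) ρ (freeSchwartz ℝ 1 s h) +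
        (2 : ℂ) • shiftMul (D W) ρ (freeSchwartz ℝ 1 s (D h)))).toLp 2 volume) s := by
  have hU := isUnitaryGroup_freeGroup ℝ 1
  have h1 : HasDerivAt (fun s => (shiftMul W ρ (freeSchwartz ℝ 1 s h)).toLp 2 volume)
      ((shiftMul W ρ (freeSchwartz ℝ 1 s ((I / 2 : ℂ) • D (D h)))).toLp 2 volume) s := by
    simp only [toLp_shiftMul]
    exact (((bmul _).restrictScalars ℝ).hasFDerivAt).comp_hasDerivAt s
      (hasDerivAt_toLp_freeSchwartz h s)
  have h2 : HasDerivAt (fun r => freeGroup ℝ 1 (-r)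
      ((shiftMul W ρ (freeSchwartz ℝ 1 s h)).toLp 2 volume))
      (-((freeSchwartz ℝ 1 (-s) ((I / 2 : ℂ) •
        D (D (shiftMul W ρ (freeSchwartz ℝ 1 s h))))).toLp 2 volume)) s := by
    have h3 := (hasDerivAt_toLp_freeSchwartz (shiftMul W ρ (freeSchwartz ℝ 1 s h)) (-s)).scomp s
      (hasDerivAt_neg s)
    rw [neg_one_smul] at h3
    refine h3.congr_of_eventuallyEq (Eventually.of_forall fun r => ?_)
    exact (toLp_freeSchwartz ℝ 1 (-r) _).symm
  have h4 := hasDerivAt_isometry_apply (Z := fun r => freeGroup ℝ 1 (-r))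
    (hU.continuous_neg _).continuousAt h1 h2
  refine (h4.congr_of_eventuallyEq (Eventually.of_forall fun r => ?_)).congr_deriv ?_
  · exact toLp_freeSchwartz ℝ 1 (-r) _
  · rw [← toLp_freeSchwartz, neg_add_eq_sub, ← toLp_sub, ← map_sub]
    congr 1
    rw [← (freeSchwartz ℝ 1 (-s)).map_smul]
    congr 1
    rw [D_shiftMul, map_add, D_shiftMul, D_shiftMul, D_freeSchwartz, D_freeSchwartz]
    simp only [map_smul]
    module

/-- This justifies freezing the profile evolution. The fourth-order decay in `ρ` is chosen so that
the later substitution `|s - s'| = (ε / P) |ρ|` still leaves the integrable factor `1 / (1 + ρ²)`.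
-/
theorem exists_nrm_interaction_picture_sub_le (W h : 𝓢(ℝ, ℂ)) (T : ℝ) :
    ∃ C, 0 ≤ C ∧ ∀ ρ s s', 0 ≤ s → s ≤ T → 0 ≤ s' → s' ≤ T →
      nrm (freeSchwartz ℝ 1 (-s) (shiftMul W ρ (freeSchwartz ℝ 1 s h)) -
        freeSchwartz ℝ 1 (-s') (shiftMul W ρ (freeSchwartz ℝ 1 s' h))) ≤
          C / (1 + ρ ^ 2) ^ 2 * |s - s'| := by
  obtain ⟨C₁, h₁, H₁⟩ := exists_nrm_shiftMul_freeSchwartz_le 2 (D (D W)) h T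
  obtain ⟨C₂, h₂, H₂⟩ := exists_nrm_shiftMul_freeSchwartz_le 2 (D W) (D h) T
  refine ⟨C₁ + C₂, by positivity, fun ρ s s' hs hsT hs' hsT' => ?_⟩
  rw [nrm_eq, toLp_sub, ← Real.norm_eq_abs]
  refine (convex_Icc 0 T).norm_image_sub_le_of_norm_hasDerivWithin_le
    (fun r _ => (hasDerivAt_interaction_picture W h ρ r).hasDerivWithinAt) (fun r hr => ?_)
    ⟨hs', hsT'⟩ ⟨hs, hsT⟩
  have hr' : |r| ≤ T := by
    rw [abs_of_nonneg hr.1]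
    exact hr.2
  rw [← nrm_eq, map_smul_eq_mul, nrm_freeSchwartz, norm_neg, norm_div, norm_I, add_div]
  refine (mul_le_mul_of_nonneg_left (map_add_le_add nrm _ _) (by positivity)).trans ?_
  rw [map_smul_eq_mul]
  have a1 := H₁ ρ r hr'
  have a2 := H₂ ρ r hr'
  have a3 : 0 ≤ C₁ / (1 + ρ ^ 2) ^ 2 := by positivity
  norm_num
  linarith

/-! ### Primitives of Schwartz functions -/

/-- The primitive `u ↦ ∫_{-∞}^u W`. -/
def prim (W : 𝓢(ℝ, ℂ)) (u : ℝ) : ℂ := ∫ z in Set.Iic u, W z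

theorem norm_prim_le (W : 𝓢(ℝ, ℂ)) (u : ℝ) : ‖prim W u‖ ≤ ∫ z, ‖W z‖ :=
  (norm_integral_le_integral_norm _).trans
    (setIntegral_le_integral W.integrable.norm (Eventually.of_forall fun _ => norm_nonneg _))

theorem hasDerivAt_prim (W : 𝓢(ℝ, ℂ)) (u : ℝ) : HasDerivAt (prim W) (W u) u := by
  have h1 : prim W = fun u => prim W 0 + ∫ z in (0 : ℝ)..u, W z := by
    funext u
    rw [← intervalIntegral.integral_Iic_sub_Iic W.integrable.integrableOn
      W.integrable.integrableOn]
    simp [prim]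
  rw [h1]
  exact (intervalIntegral.integral_hasDerivAt_right (W.continuous.intervalIntegrable _ _)
    W.continuous.aestronglyMeasurable.stronglyMeasurableAtFilter
    W.continuous.continuousAt).const_add _

theorem hasTemperateGrowth_prim (W : 𝓢(ℝ, ℂ)) : (prim W).HasTemperateGrowth := by
  have h1 : fderiv ℝ (prim W) = fun u => ContinuousLinearMap.smulRightL ℝ ℝ ℂ 1 (W u) := by
    funext u
    refine (hasDerivAt_prim W u).hasFDerivAt.fderiv.trans ?_
    ext
    simp
  refine Function.HasTemperateGrowth.of_fderiv (k := 0) (C := ∫ z, ‖W z‖) ?_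
    (fun u => (hasDerivAt_prim W u).differentiableAt) fun u => ?_
  · rw [h1]
    exact (ContinuousLinearMap.hasTemperateGrowth _).comp W.hasTemperateGrowth
  · simpa using norm_prim_le W u

theorem integrable_weight (W : 𝓢(ℝ, ℂ)) (x : ℝ) : Integrable fun z => (|z| + |x|) * ‖W z‖ := by
  have h1 := W.integrable_pow_mul volume 1
  simp only [pow_one, Real.norm_eq_abs] at h1
  simp only [add_mul]
  exact h1.add (W.integrable.norm.const_mul |x|)

/-- On the missing tail `z > x + ρ` one has `ρ ≤ |z| + |x|`, so a first moment pays for the factor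
`ρ`. -/
theorem norm_integral_sub_prim_mul_le (W : 𝓢(ℝ, ℂ)) (x ρ : ℝ) :
    ‖prim W (x + ρ) - ∫ z, W z‖ * ρ ≤ ∫ z, (|z| + |x|) * ‖W z‖ := by
  have hi := integrable_weight W x
  have h0 : ∀ z, 0 ≤ (|z| + |x|) * ‖W z‖ := fun z => by positivity
  rcases le_total ρ 0 with hρ | hρ
  · exact (mul_nonpos_of_nonneg_of_nonpos (norm_nonneg _) hρ).trans (integral_nonneg h0)
  have h1 : (∫ z, W z) - prim W (x + ρ) = ∫ z in Set.Ioi (x + ρ), W z := by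
    rw [prim, sub_eq_iff_eq_add', intervalIntegral.integral_Iic_add_Ioi
      W.integrable.integrableOn W.integrable.integrableOn]
  rw [norm_sub_rev, h1, mul_comm]
  calc ρ * ‖∫ z in Set.Ioi (x + ρ), W z‖ ≤ ρ * ∫ z in Set.Ioi (x + ρ), ‖W z‖ :=
        mul_le_mul_of_nonneg_left (norm_integral_le_integral_norm _) hρ
    _ = ∫ z in Set.Ioi (x + ρ), ρ * ‖W z‖ := (integral_const_mul _ _).symm
    _ ≤ ∫ z in Set.Ioi (x + ρ), (|z| + |x|) * ‖W z‖ := by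
      refine setIntegral_mono_on (W.integrable.norm.const_mul ρ).integrableOn hi.integrableOn
        measurableSet_Ioi fun z hz => ?_
      have hz' : x + ρ < z := hz
      refine mul_le_mul_of_nonneg_right ?_ (norm_nonneg _)
      linarith [le_abs_self z, neg_abs_le x]
    _ ≤ _ := setIntegral_le_integral hi (Eventually.of_forall h0)

theorem norm_prim_mul_le (W : 𝓢(ℝ, ℂ)) (x ρ : ℝ) :
    ‖prim W (x + ρ)‖ * (-ρ) ≤ ∫ z, (|z| + |x|) * ‖W z‖ := by
  have hi := integrable_weight W x
  have h0 : ∀ z, 0 ≤ (|z| + |x|) * ‖W z‖ := fun z => by positivity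
  rcases le_total 0 ρ with hρ | hρ
  · exact (mul_nonpos_of_nonneg_of_nonpos (norm_nonneg _) (neg_nonpos.2 hρ)).trans
      (integral_nonneg h0)
  have hρ' := neg_nonneg.2 hρ
  rw [prim, mul_comm]
  calc -ρ * ‖∫ z in Set.Iic (x + ρ), W z‖ ≤ -ρ * ∫ z in Set.Iic (x + ρ), ‖W z‖ :=
        mul_le_mul_of_nonneg_left (norm_integral_le_integral_norm _) hρ'
    _ = ∫ z in Set.Iic (x + ρ), -ρ * ‖W z‖ := (integral_const_mul _ _).symm
    _ ≤ ∫ z in Set.Iic (x + ρ), (|z| + |x|) * ‖W z‖ := by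
      refine setIntegral_mono_on (W.integrable.norm.const_mul (-ρ)).integrableOn hi.integrableOn
        measurableSet_Iic fun z hz => ?_
      have hz' : z ≤ x + ρ := hz
      refine mul_le_mul_of_nonneg_right ?_ (norm_nonneg _)
      linarith [neg_abs_le z, le_abs_self x]
    _ ≤ _ := setIntegral_le_integral hi (Eventually.of_forall h0)

theorem integral_weight_le (W : 𝓢(ℝ, ℂ)) (x : ℝ) :
    ∫ z, (|z| + |x|) * ‖W z‖ ≤ ((∫ z, |z| * ‖W z‖) + ∫ z, ‖W z‖) * (1 + x ^ 2) := by
  have h1 := W.integrable_pow_mul volume 1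
  simp only [pow_one, Real.norm_eq_abs] at h1
  simp only [add_mul _ _ ‖_‖]
  rw [integral_add h1 (W.integrable.norm.const_mul |x|), integral_const_mul]
  have h2 : 0 ≤ ∫ z, |z| * ‖W z‖ := integral_nonneg fun z => by positivity
  have h3 : 0 ≤ ∫ z, ‖W z‖ := integral_nonneg fun z => norm_nonneg _
  have h4 : |x| ≤ 1 + x ^ 2 := by nlinarith [sq_nonneg (|x| - 1), sq_abs x]
  nlinarith [mul_nonneg h2 (sq_nonneg x)]

/-- Two mean value estimates. Only the uniform quadratic order matters: it makes multiplication by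
the primitive differentiable in the translation, in `L²` norm. -/
theorem norm_prim_sub_sub_le (W : 𝓢(ℝ, ℂ)) (u v : ℝ) :
    ‖prim W v - prim W u - (v - u : ℝ) * W u‖ ≤
      SchwartzMap.seminorm ℝ 0 0 (D W) * (v - u) ^ 2 := by
  have hW : ∀ z, ‖W z - W u‖ ≤ SchwartzMap.seminorm ℝ 0 0 (D W) * ‖z - u‖ := fun z =>
    convex_univ.norm_image_sub_le_of_norm_hasDerivWithin_le
      (fun r _ => (W.hasDerivAt r).hasDerivWithinAt)
      (fun r _ => SchwartzMap.norm_le_seminorm ℝ (D W) r) (Set.mem_univ u) (Set.mem_univ z)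
  have hd : ∀ r, HasDerivAt (fun r => prim W r - (r : ℂ) * W u) (W r - W u) r := fun r => by
    have h := (hasDerivAt_prim W r).sub (((hasDerivAt_id r).ofReal_comp).mul_const (W u))
    simp only [ofReal_one, one_mul] at h
    exact h
  have h := (convex_uIcc u v).norm_image_sub_le_of_norm_hasDerivWithin_le
    (C := SchwartzMap.seminorm ℝ 0 0 (D W) * ‖v - u‖)
    (fun r _ => (hd r).hasDerivWithinAt) (fun r hr => (hW r).trans ?_)
    Set.left_mem_uIcc Set.right_mem_uIcc
  · rw [mul_assoc, ← pow_two, Real.norm_eq_abs, sq_abs] at h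
    refine le_of_eq_of_le ?_ h
    congr 1
    push_cast
    ring
  · refine mul_le_mul_of_nonneg_left ?_ (apply_nonneg _ _)
    exact Set.abs_sub_left_of_mem_uIcc hr

/-- Multiplication by the translate of a primitive. -/
def primMul (W : 𝓢(ℝ, ℂ)) (ρ : ℝ) : 𝓢(ℝ, ℂ) →L[ℂ] 𝓢(ℝ, ℂ) :=
  SchwartzMap.smulLeftCLM ℂ fun x => prim W (x + ρ)

theorem primMul_apply (W : 𝓢(ℝ, ℂ)) (ρ : ℝ) (h : 𝓢(ℝ, ℂ)) (x : ℝ) :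
    primMul W ρ h x = prim W (x + ρ) * h x := by
  have h1 : (fun x => prim W (x + ρ)).HasTemperateGrowth :=
    (hasTemperateGrowth_prim W).comp
      ((Function.HasTemperateGrowth.id' (E := ℝ)).add (Function.HasTemperateGrowth.const ρ))
  rw [primMul, SchwartzMap.smulLeftCLM_apply_apply h1, smul_eq_mul]

theorem D_primMul (W : 𝓢(ℝ, ℂ)) (ρ : ℝ) (h : 𝓢(ℝ, ℂ)) :
    D (primMul W ρ h) = shiftMul W ρ h + primMul W ρ (D h) := by
  ext x
  have h1 : (primMul W ρ h : ℝ → ℂ) = fun x => prim W (x + ρ) * h x :=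
    funext (primMul_apply W ρ h)
  rw [D_apply, h1, add_apply, shiftMul_apply, primMul_apply, D_apply]
  exact (((hasDerivAt_prim W (x + ρ)).comp_add_const x ρ).mul (h.hasDerivAt x)).deriv

theorem X_primMul (W : 𝓢(ℝ, ℂ)) (ρ : ℝ) (h : 𝓢(ℝ, ℂ)) :
    X (primMul W ρ h) = primMul W ρ (X h) := by
  ext x
  simp only [X_apply, primMul_apply]
  ring

theorem X_shiftMul (W : 𝓢(ℝ, ℂ)) (ρ : ℝ) (h : 𝓢(ℝ, ℂ)) :
    X (shiftMul W ρ h) = shiftMul W ρ (X h) := by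
  ext x
  simp only [X_apply, shiftMul_apply]
  ring

theorem nrm_primMul_le (W : 𝓢(ℝ, ℂ)) (ρ : ℝ) (h : 𝓢(ℝ, ℂ)) :
    nrm (primMul W ρ h) ≤ (∫ z, ‖W z‖) * nrm h := by
  refine nrm_le_of_le fun x => ?_
  rw [primMul_apply, norm_mul]
  exact mul_le_mul_of_nonneg_right (norm_prim_le W _) (norm_nonneg _)

theorem nrm_shiftMul_le (W : 𝓢(ℝ, ℂ)) (ρ : ℝ) (h : 𝓢(ℝ, ℂ)) :
    nrm (shiftMul W ρ h) ≤ SchwartzMap.seminorm ℝ 0 0 W * nrm h := by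
  refine nrm_le_of_le fun x => ?_
  rw [shiftMul_apply, norm_mul]
  exact mul_le_mul_of_nonneg_right (SchwartzMap.norm_le_seminorm ℝ W _) (norm_nonneg _)

/-- Convergence of the translated primitive is not uniform in `x`, but the loss is at most a factor
`1 + x²`, absorbed by `G h`. The rate `1 / ρ` suffices, since it is used with `ρ` of order `1 / ε`
and a prefactor `ε`. -/
theorem exists_nrm_primMul_le (W h : 𝓢(ℝ, ℂ)) :
    ∃ C, 0 ≤ C ∧ (∀ ρ, 0 < ρ → nrm (primMul W ρ h - (∫ z, W z) • h) ≤ C / ρ) ∧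
      ∀ ρ, 0 < ρ → nrm (primMul W (-ρ) h) ≤ C / ρ := by
  have h0 : 0 ≤ (∫ z, |z| * ‖W z‖) + ∫ z, ‖W z‖ :=
    add_nonneg (integral_nonneg fun z => by positivity) (integral_nonneg fun z => norm_nonneg _)
  have hG : ∀ x, ‖G h x‖ = (1 + x ^ 2) * ‖h x‖ := by
    intro x
    have := G_pow_apply 1 h x
    rw [pow_one, pow_one] at this
    rw [this, norm_mul, norm_real, Real.norm_of_nonneg (by positivity)]
  refine ⟨((∫ z, |z| * ‖W z‖) + ∫ z, ‖W z‖) * nrm (G h), mul_nonneg h0 (apply_nonneg _ _),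
    fun ρ hρ => ?_, fun ρ hρ => ?_⟩
  · rw [mul_div_right_comm]
    refine nrm_le_of_le fun x => ?_
    have h1 := (norm_integral_sub_prim_mul_le W x ρ).trans (integral_weight_le W x)
    rw [sub_apply, smul_apply, primMul_apply, smul_eq_mul, ← sub_mul, norm_mul, hG, ← mul_assoc,
      div_mul_eq_mul_div]
    exact mul_le_mul_of_nonneg_right ((le_div_iff₀ hρ).2 h1) (norm_nonneg _)
  · rw [mul_div_right_comm]
    refine nrm_le_of_le fun x => ?_
    have h1 := (norm_prim_mul_le W x (-ρ)).trans (integral_weight_le W x)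
    rw [neg_neg] at h1
    rw [primMul_apply, norm_mul, hG, ← mul_assoc, div_mul_eq_mul_div]
    exact mul_le_mul_of_nonneg_right ((le_div_iff₀ hρ).2 h1) (norm_nonneg _)

theorem hasDerivAt_of_norm_sub_le {F : Type*} [NormedAddCommGroup F] [NormedSpace ℝ F]
    {f : ℝ → F} {f' : F} {x C : ℝ} (h : ∀ y, ‖f y - f x - (y - x) • f'‖ ≤ C * (y - x) ^ 2) :
    HasDerivAt f f' x := by
  rw [hasDerivAt_iff_isLittleO]
  have h1 : (fun y => f y - f x - (y - x) • f') =O[𝓝 x] fun y => (y - x) ^ 2 :=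
    Asymptotics.IsBigO.of_bound C (Eventually.of_forall fun y => by
      rw [Real.norm_of_nonneg (sq_nonneg (y - x))]
      exact h y)
  refine h1.trans_isLittleO ?_
  have h2 : (fun y => (y - x) * (y - x)) =o[𝓝 x] fun y => 1 * (y - x) := by
    refine Asymptotics.IsLittleO.mul_isBigO ?_ (Asymptotics.isBigO_refl _ _)
    rw [Asymptotics.isLittleO_one_iff]
    have : Tendsto (fun y => y - x) (𝓝 x) (𝓝 (x - x)) := tendsto_id.sub_const x
    rwa [sub_self] at this
  simpa only [one_mul, ← pow_two] using h2

theorem nrm_primMul_sub_sub_le (W h : 𝓢(ℝ, ℂ)) (ρ ρ' : ℝ) :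
    nrm (primMul W ρ' h - primMul W ρ h - ((ρ' - ρ : ℝ) : ℂ) • shiftMul W ρ h) ≤
      SchwartzMap.seminorm ℝ 0 0 (D W) * nrm h * (ρ' - ρ) ^ 2 := by
  rw [mul_right_comm]
  refine nrm_le_of_le fun x => ?_
  rw [sub_apply, sub_apply, smul_apply, primMul_apply, primMul_apply, shiftMul_apply, smul_eq_mul,
    ← mul_assoc, ← sub_mul, ← sub_mul, norm_mul]
  refine mul_le_mul_of_nonneg_right ?_ (norm_nonneg _)
  have h1 := norm_prim_sub_sub_le W (x + ρ) (x + ρ')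
  rwa [add_sub_add_left_eq_sub] at h1

/-- A linear map that is bounded for the `L²` norm, applied to the multiplication by a translated
primitive, is differentiable in the translation. -/
theorem hasDerivAt_linearMap_primMul {F : Type*} [NormedAddCommGroup F] [NormedSpace ℂ F]
    [NormedSpace ℝ F] [IsScalarTower ℝ ℂ F] (Φ : 𝓢(ℝ, ℂ) →ₗ[ℂ] F) {C : ℝ} (hC : 0 ≤ C)
    (hΦ : ∀ u, ‖Φ u‖ ≤ C * nrm u) (W h : 𝓢(ℝ, ℂ)) (ρ : ℝ) :
    HasDerivAt (fun ρ => Φ (primMul W ρ h)) (Φ (shiftMul W ρ h)) ρ := by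
  refine hasDerivAt_of_norm_sub_le (C := C * (SchwartzMap.seminorm ℝ 0 0 (D W) * nrm h))
    fun ρ' => ?_
  have h1 : (ρ' - ρ) • Φ (shiftMul W ρ h) = Φ (((ρ' - ρ : ℝ) : ℂ) • shiftMul W ρ h) := by
    rw [map_smul]
    exact (RCLike.real_smul_eq_coe_smul (K := ℂ) (ρ' - ρ) (Φ (shiftMul W ρ h)))
  rw [h1, ← map_sub, ← map_sub, mul_assoc]
  exact (hΦ _).trans (mul_le_mul_of_nonneg_left (nrm_primMul_sub_sub_le W h ρ ρ') hC)

/-! ### Modulated primitives -/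

/-- Multiplication by `exp (i k x)`. -/
def modul (k : ℝ) : 𝓢(ℝ, ℂ) →L[ℂ] 𝓢(ℝ, ℂ) := packet one_ne_zero 0 k

theorem modul_apply (k : ℝ) (h : 𝓢(ℝ, ℂ)) (x : ℝ) :
    modul k h x = exp (I * (k : ℂ) * (x : ℂ)) * h x := by
  rw [modul, packet_apply, Real.sqrt_one, div_one, ofReal_one, one_mul, sub_zero, div_one, mul_comm]

theorem nrm_modul (k : ℝ) (h : 𝓢(ℝ, ℂ)) : nrm (modul k h) = nrm h :=
  norm_toLp_packet one_pos 0 k h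

theorem X_modul (k : ℝ) (h : 𝓢(ℝ, ℂ)) : X (modul k h) = modul k (X h) := by
  ext x
  simp only [X_apply, modul_apply]
  ring

theorem D_modul (k : ℝ) (h : 𝓢(ℝ, ℂ)) : D (modul k h) = modul k (D h + (I * k : ℂ) • h) := by
  ext x
  have h1 : (modul k h : ℝ → ℂ) = fun x : ℝ => exp (I * (k : ℂ) * (x : ℂ)) * h x :=
    funext (modul_apply k h)
  have h2 : HasDerivAt (fun x : ℝ => exp (I * (k : ℂ) * (x : ℂ)))
      (exp (I * (k : ℂ) * (x : ℂ)) * (I * k)) x := by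
    have := (((hasDerivAt_id x).ofReal_comp).const_mul (I * (k : ℂ))).cexp
    simpa only [id_eq, ofReal_one, mul_one] using this
  rw [D_apply, h1, modul_apply, add_apply, smul_apply, D_apply, smul_eq_mul]
  refine (h2.mul (h.hasDerivAt x)).deriv.trans ?_
  ring

/-- The primitive is bounded but does not decay, so the profile supplies the decay. Every derivative
of the translated primitive is a translated Schwartz function, bounded uniformly in `ρ`. -/
theorem exists_nrm_G_freeSchwartz_modul_primMul_le (W h : 𝓢(ℝ, ℂ)) (k T : ℝ) :
    ∃ C, 0 ≤ C ∧ ∀ ρ s, |s| ≤ T →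
      nrm (G (freeSchwartz ℝ 1 s (modul k (primMul W ρ h)))) ≤ C := by
  have key : ∀ u v : ℝ → 𝓢(ℝ, ℂ), (∃ C, ∀ ρ, nrm (u ρ) ≤ C) → (∃ C, ∀ ρ, nrm (v ρ) ≤ C) →
      ∃ C, ∀ ρ, nrm (u ρ + v ρ) ≤ C := fun u v ⟨C₁, h₁⟩ ⟨C₂, h₂⟩ =>
    ⟨C₁ + C₂, fun ρ => (map_add_le_add nrm _ _).trans (add_le_add (h₁ ρ) (h₂ ρ))⟩
  have keyM : ∀ u, ∃ C, ∀ ρ, nrm (modul k (primMul W ρ u)) ≤ C := fun u =>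
    ⟨_, fun ρ => (nrm_modul k _).le.trans (nrm_primMul_le W ρ u)⟩
  have keyS : ∀ W' u, ∃ C, ∀ ρ, nrm (modul k (shiftMul W' ρ u)) ≤ C := fun W' u =>
    ⟨_, fun ρ => (nrm_modul k _).le.trans (nrm_shiftMul_le W' ρ u)⟩
  have hD : ∀ u ρ, D (modul k (primMul W ρ u)) =
      modul k (shiftMul W ρ u) + modul k (primMul W ρ (D u + (I * k : ℂ) • u)) := by
    intro u ρ
    rw [D_modul, D_primMul, ← map_add, add_assoc, ← map_smul, ← map_add]
  have hD' : ∀ u ρ, D (modul k (shiftMul W ρ u)) =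
      modul k (shiftMul (D W) ρ u) + modul k (shiftMul W ρ (D u + (I * k : ℂ) • u)) := by
    intro u ρ
    rw [D_modul, D_shiftMul, ← map_add, add_assoc, ← map_smul, ← map_add]
  obtain ⟨C₁, h₁⟩ : ∃ C, ∀ ρ, nrm (G (modul k (primMul W ρ h))) ≤ C := by
    simp only [G_eq, X_modul, X_primMul]
    exact key _ _ (keyM _) (keyM _)
  obtain ⟨C₂, h₂⟩ : ∃ C, ∀ ρ, nrm (X (D (modul k (primMul W ρ h)))) ≤ C := by
    simp only [hD, map_add X, X_modul, X_primMul, X_shiftMul]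
    exact key _ _ (keyS _ _) (keyM _)
  obtain ⟨C₃, h₃⟩ : ∃ C, ∀ ρ, nrm (D (X (modul k (primMul W ρ h)))) ≤ C := by
    simp only [X_modul, X_primMul, hD]
    exact key _ _ (keyS _ _) (keyM _)
  obtain ⟨C₄, h₄⟩ : ∃ C, ∀ ρ, nrm (D (D (modul k (primMul W ρ h)))) ≤ C := by
    simp only [hD, hD', map_add D]
    exact key _ _ (key _ _ (keyS _ _) (keyS _ _)) (key _ _ (keyS _ _) (keyM _))
  have n₁ := (apply_nonneg nrm _).trans (h₁ 0)
  have n₂ := (apply_nonneg nrm _).trans (h₂ 0)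
  have n₃ := (apply_nonneg nrm _).trans (h₃ 0)
  have n₄ := (apply_nonneg nrm _).trans (h₄ 0)
  refine ⟨C₁ + |T| * (C₂ + C₃) + T ^ 2 * C₄, by positivity, fun ρ s hs => ?_⟩
  have hT : |s| ≤ |T| := hs.trans (le_abs_self T)
  refine (nrm_G_freeSchwartz_le s _).trans ?_
  exact add_le_add (add_le_add (h₁ ρ) (mul_le_mul hT (add_le_add (h₂ ρ) (h₃ ρ))
    (add_nonneg (apply_nonneg _ _) (apply_nonneg _ _)) (abs_nonneg _)))
    (mul_le_mul (sq_le_sq.2 hT) (h₄ ρ) (apply_nonneg _ _) (sq_nonneg _))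

theorem exists_nrm_shiftMul_modul_primMul_le (V W h : 𝓢(ℝ, ℂ)) (k T : ℝ) :
    ∃ C, 0 ≤ C ∧ ∀ ρ s, |s| ≤ T →
      nrm (shiftMul V ρ (freeSchwartz ℝ 1 s (modul k (primMul W ρ h)))) ≤ C / (1 + ρ ^ 2) := by
  obtain ⟨C, hC, H⟩ := exists_nrm_shiftMul_le 1 V
  obtain ⟨C', hC', H'⟩ := exists_nrm_G_freeSchwartz_modul_primMul_le W h k T
  refine ⟨C * C', by positivity, fun ρ s hs => (H ρ _).trans ?_⟩
  rw [pow_one, pow_one, mul_div_right_comm]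
  exact mul_le_mul_of_nonneg_left (H' ρ s hs) (by positivity)

/-! ### Wave packets of the two particles -/

/-- A real Schwartz function as a complex one. -/
def toC (V : 𝓢(ℝ, ℝ)) : 𝓢(ℝ, ℂ) := SchwartzMap.postcompCLM (𝕜 := ℝ) ofRealCLM V

theorem toC_apply (V : 𝓢(ℝ, ℝ)) (x : ℝ) : toC V x = V x := rfl

theorem nrm_toC (f : 𝓢(ℝ, ℝ)) (hf : ∫ x, f x ^ 2 = 1) : nrm (toC f) = 1 := by
  have h := norm_sq_toLp (μ := volume) (toC f)
  simp only [toC_apply, norm_real, Real.norm_eq_abs, sq_abs] at h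
  rw [hf] at h
  rw [nrm_eq]
  exact (pow_eq_one_iff_of_nonneg (norm_nonneg _) two_ne_zero).1 h

theorem wavePacket_eq_packet (f : 𝓢(ℝ, ℝ)) {σ : ℝ} (hσ : σ ≠ 0) (q k : ℝ) :
    wavePacket f σ q k = packet hσ q k (toC f) := by
  funext x
  rw [packet_apply, toC_apply, wavePacket]

theorem phi_eq_packet (f : 𝓢(ℝ, ℝ)) {ε : ℝ} (hε : ε ≠ 0) (P : ℝ) :
    phi f (ε ^ 2) ε P = packet hε 0 (P / ε ^ 2) (toC f) :=
  wavePacket_eq_packet f hε 0 _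

/-- The state of the two particles with the wave packet of profile `u` and momentum `k` for the
first one, and `v` for the second one. -/
def packetTensor {ε : ℝ} (hε : ε ≠ 0) (k : ℝ) (v : 𝓢(ℝ, ℂ)) : 𝓢(ℝ, ℂ) →ₗ[ℂ] L2 :=
  tensorRight v ∘ₗ (packet hε 0 k).toLinearMap

theorem packetTensor_apply {ε : ℝ} (hε : ε ≠ 0) (k : ℝ) (v u : 𝓢(ℝ, ℂ)) :
    packetTensor hε k v u = (tensorS (packet hε 0 k u) v).toLp 2 volume := rfl

theorem norm_packetTensor {ε : ℝ} (hε : 0 < ε) (k : ℝ) (v u : 𝓢(ℝ, ℂ)) :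
    ‖packetTensor hε.ne' k v u‖ = nrm u * nrm v := by
  rw [packetTensor_apply, norm_toLp_tensorS, norm_toLp_packet hε]
  rfl

theorem freeGroup_packetTensor {ε : ℝ} (hε : 0 < ε) (k s : ℝ) (v u : 𝓢(ℝ, ℂ)) :
    freeGroup Config (ε ^ 2) s (packetTensor hε.ne' k v u) =
      exp (((-(s * ε ^ 2 * k ^ 2 / 2) : ℝ) : ℂ) * I) •
        (tensorS (packet hε.ne' (0 + s * ε ^ 2 * k) k (freeSchwartz ℝ 1 s u))
          (freeSchwartz ℝ (ε ^ 2) s v)).toLp 2 volume := by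
  rw [packetTensor_apply, ← toLp_freeSchwartz, freeSchwartz_tensorS, freeSchwartz_packet hε,
    tensorS_smul_left, toLp_smul]

theorem bmul_potential_packet (V : 𝓢(ℝ, ℝ)) (a : ℝ) {ε : ℝ} (hε : ε ≠ 0) (q k : ℝ)
    (u v : 𝓢(ℝ, ℂ)) :
    bmul (potentialBCF V a ε) ((tensorS (packet hε q k u) v).toLp 2 volume) =
      (tensorS (packet hε q k (shiftMul (toC V) ((q - a) / ε) u)) v).toLp 2 volume := by
  ext1
  filter_upwards [coeFn_bmul (potentialBCF V a ε) ((tensorS (packet hε q k u) v).toLp 2 volume),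
    (tensorS (packet hε q k u) v).coeFn_toLp 2 volume,
    (tensorS (packet hε q k (shiftMul (toC V) ((q - a) / ε) u)) v).coeFn_toLp 2 volume]
    with x h1 h2 h3
  have h4 : (x 0 - q) / ε + (q - a) / ε = (x 0 - a) / ε := by ring
  rw [h1, h2, h3, potentialBCF_apply, tensorS_apply, tensorS_apply, packet_apply, packet_apply,
    shiftMul_apply, h4, toC_apply]
  ring

theorem freeSchwartz_modul (s k : ℝ) (h : 𝓢(ℝ, ℂ)) :
    freeSchwartz ℝ 1 s (modul k h) = exp (((-(s * k ^ 2 / 2) : ℝ) : ℂ) * I) •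
      packet one_ne_zero (s * k) k (freeSchwartz ℝ 1 s h) := by
  have h1 := freeSchwartz_packet one_pos 0 k s h
  rwa [one_pow, mul_one, zero_add] at h1

/-- The function `exp (i z / P) V(z) / P`, whose integral is the transition amplitude. -/
def transition (V : 𝓢(ℝ, ℝ)) (P : ℝ) : 𝓢(ℝ, ℂ) := ((P⁻¹ : ℝ) : ℂ) • modul P⁻¹ (toC V)

theorem transition_apply (V : 𝓢(ℝ, ℝ)) (P x : ℝ) :
    transition V P x = ((P⁻¹ : ℝ) : ℂ) * (exp (I * ((P⁻¹ : ℝ) : ℂ) * (x : ℂ)) * V x) := by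
  rw [transition, smul_apply, modul_apply, smul_eq_mul, toC_apply]

/-- The exponent has the opposite sign to that of `fourierHat`; as `V` is real, this is a complex
conjugation. -/
theorem integral_transition (V : 𝓢(ℝ, ℝ)) (P : ℝ) :
    ∫ x, transition V P x = ((√(2 * Real.pi) / P : ℝ) : ℂ) * conj (fourierHat V P⁻¹) := by
  have h1 : ((√(2 * Real.pi) : ℝ) : ℂ) ≠ 0 := by
    have : 0 < √(2 * Real.pi) := Real.sqrt_pos.2 (by positivity)
    exact_mod_cast this.ne'
  simp only [transition_apply]
  rw [integral_const_mul, fourierHat, map_mul, conj_ofReal, ← integral_conj]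
  have h2 : ∀ x : ℝ, conj ((V x : ℂ) * exp (-(I * ((P⁻¹ : ℝ) : ℂ) * (x : ℂ)))) =
      exp (I * ((P⁻¹ : ℝ) : ℂ) * (x : ℂ)) * V x := by
    intro x
    rw [map_mul, conj_ofReal, ← Complex.exp_conj, map_neg, map_mul, map_mul, conj_I, conj_ofReal,
      conj_ofReal, mul_comm]
    congr 2
    ring
  simp only [h2]
  rw [← mul_assoc]
  congr 1
  push_cast
  field_simp

/-- Since `-x / P + (x + ρ) / P = ρ / P`, the modulations combine into a phase depending on `ρ`
alone. This is the remaining spin phase, and it makes the frozen forcing integrable in closed form.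
-/
theorem modul_shiftMul_transition (V : 𝓢(ℝ, ℝ)) (P ρ : ℝ) (h : 𝓢(ℝ, ℂ)) :
    modul (-P⁻¹) (shiftMul (transition V P) ρ h) =
      (((P⁻¹ : ℝ) : ℂ) * exp (((ρ / P : ℝ) : ℂ) * I)) • shiftMul (toC V) ρ h := by
  ext x
  rw [modul_apply, shiftMul_apply, smul_apply, shiftMul_apply, transition_apply, toC_apply,
    smul_eq_mul]
  have h1 : exp (I * ((-P⁻¹ : ℝ) : ℂ) * (x : ℂ)) * exp (I * ((P⁻¹ : ℝ) : ℂ) * ((x + ρ : ℝ) : ℂ)) =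
      exp (((ρ / P : ℝ) : ℂ) * I) := by
    rw [← Complex.exp_add]
    congr 1
    push_cast
    ring
  linear_combination ((P⁻¹ : ℝ) : ℂ) * V (x + ρ) * h x * h1

/-- Galilean covariance applied to a kick by `-1 / P` at time `a / P`, pulled back to time `0`: the
profile moves by `a / P²` and acquires the phase `a / (2 P³)`, while the spin phase at collision is
`a / (ε P)`. -/
theorem outgoing_eq (V f : 𝓢(ℝ, ℝ)) (a P : ℝ) {ε : ℝ} (hε : ε ≠ 0) (hP : P ≠ 0) :
    outgoing V f a P ε = ((-exp (((a / (ε * P) : ℝ) : ℂ) * I) * ∫ x, transition V P x) •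
      packet hε 0 (P / ε ^ 2) (freeSchwartz ℝ 1 (-(a / P))
        (modul (-P⁻¹) (freeSchwartz ℝ 1 (a / P) (toC f)))) : 𝓢(ℝ, ℂ)) := by
  funext x
  rw [freeSchwartz_modul, ← freeSchwartz_add, neg_add_cancel, freeSchwartz_zero, map_smul,
    smul_smul, smul_apply, packet_apply, packet_apply, smul_eq_mul, integral_transition, outgoing,
    wavePacket, toC_apply, Real.sqrt_one, div_one, div_one, ofReal_one, one_mul, sub_zero]
  have hq : x / ε - -(a / P) * -P⁻¹ = (x - a / P ^ 2 * ε) / ε := by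
    field_simp
  have he : exp (I * ((a / (ε * P) * (1 + ε / (2 * P ^ 2)) : ℝ) : ℂ)) *
      exp (I * (((P - ε * P⁻¹) / ε ^ 2 : ℝ) : ℂ) * (x : ℂ)) =
      exp (((a / (ε * P) : ℝ) : ℂ) * I) * exp (((-(-(a / P) * (-P⁻¹) ^ 2 / 2) : ℝ) : ℂ) * I) *
        exp (I * ((-P⁻¹ : ℝ) : ℂ) * ((x / ε : ℝ) : ℂ)) *
        exp (I * ((P / ε ^ 2 : ℝ) : ℂ) * (x : ℂ)) := by
    rw [← Complex.exp_add, ← Complex.exp_add, ← Complex.exp_add, ← Complex.exp_add]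
    congr 1
    push_cast
    have hε' : (ε : ℂ) ≠ 0 := by exact_mod_cast hε
    have hP' : (P : ℂ) ≠ 0 := by exact_mod_cast hP
    field_simp
    ring
  rw [hq]
  linear_combination -(((√(2 * Real.pi) / P : ℝ) : ℂ) * conj (fourierHat V P⁻¹) *
    ((1 / √ε : ℝ) : ℂ) * f ((x - a / P ^ 2 * ε) / ε)) * he

theorem tensor_outgoing_eq (V f : 𝓢(ℝ, ℝ)) (a P : ℝ) {ε : ℝ} (hε : ε ≠ 0) (hP : P ≠ 0) :
    tensor (outgoing_memLp V f a P ε) (phi_memLp f (ε ^ 2) ε (-P)) =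
      (-exp (((a / (ε * P) : ℝ) : ℂ) * I) * ∫ x, transition V P x) •
        packetTensor hε (P / ε ^ 2) (packet hε 0 (-P / ε ^ 2) (toC f))
          (freeSchwartz ℝ 1 (-(a / P))
            (modul (-P⁻¹) (freeSchwartz ℝ 1 (a / P) (toC f)))) := by
  rw [tensor_eq_toLp _ _ _ _ (outgoing_eq V f a P hε hP) (phi_eq_packet f hε _),
    tensorS_smul_left, toLp_smul]
  rfl

theorem initialState_eq (f : 𝓢(ℝ, ℝ)) (P N : ℝ) {ε : ℝ} (hε : ε ≠ 0) :
    initialState f (ε ^ 2) ε P N = WithLp.toLp 2 (0, (N : ℂ) •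
      (packetTensor hε (P / ε ^ 2) (packet hε 0 (-P / ε ^ 2) (toC f)) (toC f) +
        packetTensor hε (-P / ε ^ 2) (packet hε 0 (P / ε ^ 2) (toC f)) (toC f))) := by
  rw [initialState, tensor_eq_toLp _ _ _ _ (phi_eq_packet f hε P) (phi_eq_packet f hε (-P)),
    tensor_eq_toLp _ _ _ _ (phi_eq_packet f hε (-P)) (phi_eq_packet f hε P)]
  rfl

/-! ### The normalization constants -/

theorem abs_normFactor_le (f : 𝓢(ℝ, ℝ)) (ħ σ P : ℝ) : |normFactor f ħ σ P| ≤ 1 := by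
  have h : (1 : ℝ) ≤ 2 + 2 * overlap f ħ σ P ^ 2 := by nlinarith [sq_nonneg (overlap f ħ σ P)]
  rw [normFactor, abs_of_nonneg (Real.rpow_nonneg (by linarith) _)]
  exact Real.rpow_le_one_of_one_le_of_nonpos h (by norm_num)

theorem abs_normFactor'_le (f : 𝓢(ℝ, ℝ)) (ħ σ P : ℝ) (h : |overlap f ħ σ P| ≤ 1 / 2) :
    |normFactor' f ħ σ P| ≤ 1 := by
  have h : (1 : ℝ) ≤ 2 + 2 * overlap f ħ σ P := by linarith [(abs_le.1 h).1]
  rw [normFactor', abs_of_nonneg (Real.rpow_nonneg (by linarith) _)]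
  exact Real.rpow_le_one_of_one_le_of_nonpos h (by norm_num)

/-- Riemann–Lebesgue for the integrable function `f²`, at angular frequency `2 P / ε`. It serves to
bound the normalization without the square, where the overlap could otherwise be close to `-1`. -/
theorem tendsto_overlap (f : 𝓢(ℝ, ℝ)) {P : ℝ} (hP : 0 < P) :
    Tendsto (fun ε => overlap f (ε ^ 2) ε P) (𝓝[>] 0) (𝓝 0) := by
  have hf : Integrable fun y => f y ^ 2 :=
    (memLp_two_iff_integrable_sq f.continuous.aestronglyMeasurable).1 (f.memLp 2)
  have h1 := Real.tendsto_integral_exp_smul_cocompact (fun y => ((f y ^ 2 : ℝ) : ℂ))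
  have hs : Tendsto (fun ε : ℝ => P / Real.pi * ε⁻¹) (𝓝[>] 0) (cocompact ℝ) := by
    refine Tendsto.mono_right ?_ atTop_le_cocompact
    exact tendsto_inv_nhdsGT_zero.const_mul_atTop (by positivity)
  have h2 := (continuous_re.tendsto 0).comp (h1.comp hs)
  rw [zero_re] at h2
  refine h2.congr' ?_
  filter_upwards [self_mem_nhdsWithin] with ε hε
  have hε' : ε ≠ 0 := (Set.mem_Ioi.1 hε).ne'
  have hi : Integrable fun v : ℝ =>
      (Real.fourierChar (-(v * (P / Real.pi * ε⁻¹))) • ((f v ^ 2 : ℝ) : ℂ)) := by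
    have hc : Integrable fun y => ((f y ^ 2 : ℝ) : ℂ) := hf.ofReal
    have h3 := (Real.fourierIntegral_convergent_iff (P / Real.pi * ε⁻¹)).2 hc
    simpa [mul_comm] using h3
  refine (reCLM.integral_comp_comm hi).symm.trans ?_
  refine integral_congr_ae (Eventually.of_forall fun v => ?_)
  have h4 : 2 * ε * P / ε ^ 2 * v = -(2 * Real.pi * -(v * (P / Real.pi * ε⁻¹))) := by
    have hπ := Real.pi_ne_zero
    field_simp
  change (Real.fourierChar (-(v * (P / Real.pi * ε⁻¹))) • ((f v ^ 2 : ℝ) : ℂ)).re =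
    f v ^ 2 * Real.cos (2 * ε * P / ε ^ 2 * v)
  rw [Circle.smul_def, Real.fourierChar_apply, smul_eq_mul, re_mul_ofReal, exp_ofReal_mul_I_re, h4,
    Real.cos_neg, mul_comm]

/-! ### The interaction picture for the two particles and the spin -/

/-- The multiplication by `W` in the interaction picture. -/
def interactionPicture (W : Config →ᵇ ℂ) (ħ s : ℝ) : L2 →L[ℂ] L2 :=
  (freeGroup Config ħ (-s)).toContinuousLinearEquiv.toContinuousLinearMap ∘L bmul W ∘L
    (freeGroup Config ħ s).toContinuousLinearEquiv.toContinuousLinearMap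

theorem interactionPicture_apply (W : Config →ᵇ ℂ) (ħ s : ℝ) (u : L2) :
    interactionPicture W ħ s u =
      freeGroup Config ħ (-s) (bmul W (freeGroup Config ħ s u)) := rfl

/-- The global phase, the motion of the centre and the evolution of the second particle cancel
between the two free evolutions. Only a one-dimensional interaction picture of the first profile
survives. -/
theorem interactionPicture_packetTensor (V : 𝓢(ℝ, ℝ)) (a : ℝ) {ε : ℝ} (hε : 0 < ε) (k s : ℝ)
    (v u : 𝓢(ℝ, ℂ)) :
    interactionPicture (potentialBCF V a ε) (ε ^ 2) s (packetTensor hε.ne' k v u) =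
    packetTensor hε.ne' k v (freeSchwartz ℝ 1 (-s)
      (shiftMul (toC V) ((s * ε ^ 2 * k - a) / ε) (freeSchwartz ℝ 1 s u))) := by
  have hU := isUnitaryGroup_freeGroup Config (ε ^ 2)
  rw [interactionPicture_apply,
    ← hU.neg_apply s (packetTensor hε.ne' k v (freeSchwartz ℝ 1 (-s)
      (shiftMul (toC V) ((s * ε ^ 2 * k - a) / ε) (freeSchwartz ℝ 1 s u))))]
  congr 1
  rw [freeGroup_packetTensor hε, freeGroup_packetTensor hε, map_smul, bmul_potential_packet,
    ← freeSchwartz_add, add_neg_cancel, freeSchwartz_zero, zero_add]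

theorem stateGroup_toLp (ħ ω s : ℝ) (u d : L2) :
    stateGroup ħ ω s (WithLp.toLp 2 (u, d)) = WithLp.toLp 2
      (exp (-(I * ((ω / 2 * s : ℝ) : ℂ))) • freeGroup Config ħ s u,
        exp (-(I * ((-(ω / 2) * s : ℝ) : ℂ))) • freeGroup Config ħ s d) := rfl

theorem neg_coupling_toLp (W : Config →ᵇ ℂ) (u d : L2) :
    -coupling W 1 (WithLp.toLp 2 (u, d)) = WithLp.toLp 2 (bmul W d, -bmul W u) := by
  rw [coupling_apply, ofReal_one, one_smul, ← WithLp.toLp_neg, Prod.neg_mk, neg_neg]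
  rfl

theorem smul_isometry_smul {H : Type*} [NormedAddCommGroup H] [InnerProductSpace ℂ H]
    (F G : H ≃ₗᵢ[ℂ] H) (B : H →L[ℂ] H) {c c' e : ℂ} (he : c * c' = e) (u : H) :
    c • F (B (c' • G u)) = e • F (B (G u)) ∧ c • F (-B (c' • G u)) = -(e • F (B (G u))) := by
  have h : c • F (B (c' • G u)) = e • F (B (G u)) := by rw [map_smul, map_smul, smul_smul, he]
  exact ⟨h, by rw [map_neg, smul_neg, h]⟩

/-- The coupling to the spin in the interaction picture. -/
theorem stateGroup_neg_coupling (W : Config →ᵇ ℂ) (ħ ω s : ℝ) (u d : L2) :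
    stateGroup ħ ω (-s) (-coupling W 1 (stateGroup ħ ω s (WithLp.toLp 2 (u, d)))) =
      WithLp.toLp 2
        (exp (((ω * s : ℝ) : ℂ) * I) • interactionPicture W ħ s d,
          -(exp (((-(ω * s) : ℝ) : ℂ) * I) • interactionPicture W ħ s u)) := by
  have h1 : exp (-(I * ((ω / 2 * -s : ℝ) : ℂ))) * exp (-(I * ((-(ω / 2) * s : ℝ) : ℂ))) =
      exp (((ω * s : ℝ) : ℂ) * I) := by
    rw [← Complex.exp_add]
    congr 1
    push_cast
    ring
  have h2 : exp (-(I * ((-(ω / 2) * -s : ℝ) : ℂ))) * exp (-(I * ((ω / 2 * s : ℝ) : ℂ))) =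
      exp (((-(ω * s) : ℝ) : ℂ) * I) := by
    rw [← Complex.exp_add]
    congr 1
    push_cast
    ring
  rw [stateGroup_toLp ħ ω s u d, neg_coupling_toLp, stateGroup_toLp]
  exact congrArg (WithLp.toLp 2) (Prod.ext
    (smul_isometry_smul (freeGroup Config ħ (-s)) (freeGroup Config ħ s) (bmul W) h1 d).1
    (smul_isometry_smul (freeGroup Config ħ (-s)) (freeGroup Config ħ s) (bmul W) h2 u).2)

theorem norm_toLp_prod_le (u d : L2) : ‖(WithLp.toLp 2 (u, d) : StateSpace)‖ ≤ ‖u‖ + ‖d‖ := by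
  rw [WithLp.prod_norm_eq_of_L2]
  refine Real.sqrt_le_iff.2 ⟨by positivity, ?_⟩
  change ‖u‖ ^ 2 + ‖d‖ ^ 2 ≤ _
  nlinarith [mul_nonneg (norm_nonneg u) (norm_nonneg d)]

/-! ### The first-order correction -/

/-- The product state with the profile `u` and momentum `k` for the first particle, and the profile
`f` and momentum `k'` for the second one. -/
def pairMap (f : 𝓢(ℝ, ℝ)) {ε : ℝ} (hε : ε ≠ 0) (k k' : ℝ) : 𝓢(ℝ, ℂ) →ₗ[ℂ] L2 :=
  packetTensor hε k (packet hε 0 k' (toC f))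

theorem norm_pairMap {f : 𝓢(ℝ, ℝ)} (hf : nrm (toC f) = 1) {ε : ℝ} (hε : 0 < ε)
    (k k' : ℝ) (u : 𝓢(ℝ, ℂ)) : ‖pairMap f hε.ne' k k' u‖ = nrm u := by
  have h : nrm (packet hε.ne' 0 k' (toC f)) = 1 := (norm_toLp_packet hε 0 k' (toC f)).trans hf
  rw [pairMap, norm_packetTensor hε, h, mul_one]

theorem interactionPicture_pairMap (V f : 𝓢(ℝ, ℝ)) (a : ℝ) {ε : ℝ} (hε : 0 < ε) (k k' s : ℝ)
    (u : 𝓢(ℝ, ℂ)) :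
    interactionPicture (potentialBCF V a ε) (ε ^ 2) s (pairMap f hε.ne' k k' u) =
    pairMap f hε.ne' k k' (freeSchwartz ℝ 1 (-s)
      (shiftMul (toC V) ((s * ε ^ 2 * k - a) / ε) (freeSchwartz ℝ 1 s u))) :=
  interactionPicture_packetTensor V a hε k s _ u

theorem initialState_snd (f : 𝓢(ℝ, ℝ)) (P N : ℝ) {ε : ℝ} (hε : ε ≠ 0) :
    (initialState f (ε ^ 2) ε P N).snd = (N : ℂ) •
      (pairMap f hε (P / ε ^ 2) (-P / ε ^ 2) (toC f) +
        pairMap f hε (-P / ε ^ 2) (P / ε ^ 2) (toC f)) := by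
  rw [initialState_eq f P N hε]
  rfl

/-- The profile of the spin-up component of the approximate solution, in the interaction picture,
after the transition has been integrated up to `ρ`. -/
def transitionProfile (V f : 𝓢(ℝ, ℝ)) (a P : ℝ) (ρ : ℝ) : 𝓢(ℝ, ℂ) :=
  freeSchwartz ℝ 1 (-(a / P)) (modul (-P⁻¹)
    (primMul (transition V P) ρ (freeSchwartz ℝ 1 (a / P) (toC f))))

/-- The spin-up component of the approximate solution in the interaction picture. -/
def correction (V f : 𝓢(ℝ, ℝ)) (a P N : ℝ) {ε : ℝ} (hε : ε ≠ 0) (s : ℝ) : L2 :=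
  (-((ε * N : ℝ) : ℂ) * exp (((a / (ε * P) : ℝ) : ℂ) * I)) •
    pairMap f hε (P / ε ^ 2) (-P / ε ^ 2) (transitionProfile V f a P ((s * P - a) / ε))

/-- The time derivative of `correction`. -/
def correctionDeriv (V f : 𝓢(ℝ, ℝ)) (a P N : ℝ) {ε : ℝ} (hε : ε ≠ 0) (s : ℝ) : L2 :=
  (-((N : ℂ) * exp (((ε⁻¹ * s : ℝ) : ℂ) * I))) •
    pairMap f hε (P / ε ^ 2) (-P / ε ^ 2)
      (freeSchwartz ℝ 1 (-(a / P)) (shiftMul (toC V) ((s * P - a) / ε)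
        (freeSchwartz ℝ 1 (a / P) (toC f))))

theorem hasDerivAt_pairMap_transitionProfile (V : 𝓢(ℝ, ℝ)) {f : 𝓢(ℝ, ℝ)}
    (hf : nrm (toC f) = 1) (a P : ℝ) {ε : ℝ} (hε : 0 < ε) (k k' ρ : ℝ) :
    HasDerivAt (fun ρ => pairMap f hε.ne' k k' (transitionProfile V f a P ρ))
      ((((P⁻¹ : ℝ) : ℂ) * exp (((ρ / P : ℝ) : ℂ) * I)) • pairMap f hε.ne' k k'
        (freeSchwartz ℝ 1 (-(a / P)) (shiftMul (toC V) ρ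
          (freeSchwartz ℝ 1 (a / P) (toC f))))) ρ := by
  let Φ : 𝓢(ℝ, ℂ) →ₗ[ℂ] L2 := pairMap f hε.ne' k k' ∘ₗ
    (freeSchwartz ℝ 1 (-(a / P)) ∘L modul (-P⁻¹)).toLinearMap
  have hΦ : ∀ u, Φ u = pairMap f hε.ne' k k' (freeSchwartz ℝ 1 (-(a / P)) (modul (-P⁻¹) u)) :=
    fun u => rfl
  have hn : ∀ u, ‖Φ u‖ ≤ 1 * nrm u := fun u => by
    rw [hΦ, norm_pairMap hf hε, nrm_freeSchwartz, nrm_modul, one_mul]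
  have h := hasDerivAt_linearMap_primMul Φ zero_le_one hn (transition V P)
    (freeSchwartz ℝ 1 (a / P) (toC f)) ρ
  rw [hΦ (shiftMul _ _ _), modul_shiftMul_transition, map_smul, map_smul] at h
  exact h

theorem hasDerivAt_correction (V : 𝓢(ℝ, ℝ)) {f : 𝓢(ℝ, ℝ)} (hf : nrm (toC f) = 1) (a N : ℝ)
    {P ε : ℝ} (hP : P ≠ 0) (hε : 0 < ε) (s : ℝ) :
    HasDerivAt (correction V f a P N hε.ne') (correctionDeriv V f a P N hε.ne' s) s := by
  have h2 : HasDerivAt (fun s => (s * P - a) / ε) (1 * P / ε) s :=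
    (((hasDerivAt_id s).mul_const P).sub_const a).div_const ε
  have h3 := ((hasDerivAt_pairMap_transitionProfile V hf a P hε (P / ε ^ 2) (-P / ε ^ 2)
    ((s * P - a) / ε)).scomp s h2).const_smul
    (-((ε * N : ℝ) : ℂ) * exp (((a / (ε * P) : ℝ) : ℂ) * I))
  refine h3.congr_deriv ?_
  rw [correctionDeriv, RCLike.real_smul_eq_coe_smul (K := ℂ) (1 * P / ε), smul_smul, smul_smul]
  congr 1
  -- The splitting `s / ε = a / (ε P) + ρ / P` of the spin phase explains the constant phase in
  -- `correction`.
  have h4 : exp (((a / (ε * P) : ℝ) : ℂ) * I) * exp ((((s * P - a) / ε / P : ℝ) : ℂ) * I) =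
      exp (((ε⁻¹ * s : ℝ) : ℂ) * I) := by
    rw [← Complex.exp_add, ← add_mul, ← ofReal_add]
    congr 3
    have := hε.ne'
    field_simp
    ring
  rw [← h4]
  have hε' : (ε : ℂ) ≠ 0 := by exact_mod_cast hε.ne'
  have hP' : (P : ℂ) ≠ 0 := by exact_mod_cast hP
  simp only [RCLike.ofReal_eq_complex_ofReal]
  push_cast
  field_simp

theorem correction_sub (V f : 𝓢(ℝ, ℝ)) (a N s : ℝ) {P ε : ℝ} (hP : P ≠ 0) (hε : ε ≠ 0) :
    correction V f a P N hε s - (ε : ℂ) • (firstOrderState V f a P N ε).fst =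
      (-((ε * N : ℝ) : ℂ) * exp (((a / (ε * P) : ℝ) : ℂ) * I)) •
        pairMap f hε (P / ε ^ 2) (-P / ε ^ 2)
          (freeSchwartz ℝ 1 (-(a / P)) (modul (-P⁻¹)
            (primMul (transition V P) ((s * P - a) / ε) (freeSchwartz ℝ 1 (a / P) (toC f)) -
              (∫ x, transition V P x) • freeSchwartz ℝ 1 (a / P) (toC f)))) := by
  have h : (firstOrderState V f a P N ε).fst = (N : ℂ) •
    tensor (outgoing_memLp V f a P ε) (phi_memLp f (ε ^ 2) ε (-P)) := rfl
  rw [h, tensor_outgoing_eq V f a P hε hP, correction, transitionProfile, ← pairMap]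
  simp only [map_sub, map_smul, smul_sub, smul_smul]
  congr 2
  push_cast
  ring

/-! ### Residual and endpoint errors of the approximate solution -/

theorem norm_correction_coeff (a P N ε : ℝ) (hN : |N| ≤ 1) (hε : 0 < ε) :
    ‖-((ε * N : ℝ) : ℂ) * exp (((a / (ε * P) : ℝ) : ℂ) * I)‖ ≤ ε := by
  rw [norm_mul, norm_neg, norm_exp_ofReal_mul_I, mul_one, norm_real, norm_mul,
    Real.norm_of_nonneg hε.le]
  exact mul_le_of_le_one_right hε.le hN

/-- This is the spin-down residual: one `ε` from the correction itself, and decay in `ρ` from the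
potential acting a second time. The kick at time `a / P` does not alter the packet momentum in the
representation, so the same `ρ` appears. -/
theorem exists_norm_interactionPicture_correction_le (V : 𝓢(ℝ, ℝ)) {f : 𝓢(ℝ, ℝ)}
    (hf : nrm (toC f) = 1) {a P t : ℝ} (ha : 0 < a) (hP : 0 < P) (ht : a / P < t) :
    ∃ C, 0 ≤ C ∧ ∀ (N ε : ℝ) (hε : 0 < ε), |N| ≤ 1 → ∀ s, 0 ≤ s → s ≤ t →
      ‖interactionPicture (potentialBCF V a ε) (ε ^ 2) s (correction V f a P N hε.ne' s)‖ ≤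
        C * (ε / (1 + ((s * P - a) / ε) ^ 2)) := by
  have hs₀ : 0 < a / P := div_pos ha hP
  obtain ⟨C, hC, H⟩ := exists_nrm_shiftMul_modul_primMul_le (toC V) (transition V P)
    (freeSchwartz ℝ 1 (a / P) (toC f)) (-P⁻¹) t
  refine ⟨C, hC, fun N ε hε hN s hs hst => ?_⟩
  have hρ : (s * ε ^ 2 * (P / ε ^ 2) - a) / ε = (s * P - a) / ε := by field_simp
  have b := H ((s * P - a) / ε) (s + -(a / P)) (abs_le.2 ⟨by linarith, by linarith⟩)
  rw [freeSchwartz_add] at b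
  rw [correction, ContinuousLinearMap.map_smul, interactionPicture_pairMap V f a hε, hρ, norm_smul,
    norm_pairMap hf hε, nrm_freeSchwartz, transitionProfile]
  refine (mul_le_mul (norm_correction_coeff a P N ε hN hε) b (apply_nonneg _ _)
    hε.le).trans (le_of_eq ?_)
  ring

/-- This is the spin-up residual: the error of freezing the `+P` profile plus the whole contribution
of the `-P` packet. -/
theorem exists_norm_correctionDeriv_add_le (V : 𝓢(ℝ, ℝ)) {f : 𝓢(ℝ, ℝ)}
    (hf : nrm (toC f) = 1) {a P t : ℝ} (ha : 0 < a) (hP : 0 < P) (ht : a / P < t) :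
    ∃ C, 0 ≤ C ∧ ∀ (N ε : ℝ) (hε : 0 < ε), |N| ≤ 1 → ∀ s, 0 ≤ s → s ≤ t →
      ‖correctionDeriv V f a P N hε.ne' s + exp (((ε⁻¹ * s : ℝ) : ℂ) * I) •
        interactionPicture (potentialBCF V a ε) (ε ^ 2) s (initialState f (ε ^ 2) ε P N).snd‖ ≤
        C * (ε / (1 + ((s * P - a) / ε) ^ 2) + ε ^ 2) := by
  have hs₀ : 0 < a / P := div_pos ha hP
  obtain ⟨C₁, h₁, H₁⟩ := exists_nrm_interaction_picture_sub_le (toC V) (toC f) t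
  obtain ⟨C₂, h₂, H₂⟩ := exists_nrm_shiftMul_freeSchwartz_le 1 (toC V) (toC f) t
  refine ⟨C₁ / P + C₂ / a ^ 2, by positivity, fun N ε hε hN s hs hst => ?_⟩
  have hρ : (s * ε ^ 2 * (P / ε ^ 2) - a) / ε = (s * P - a) / ε := by field_simp
  have hρ' : (s * ε ^ 2 * (-P / ε ^ 2) - a) / ε = -((s * P + a) / ε) := by
    field_simp
    ring
  rw [initialState_snd f P N hε.ne', ContinuousLinearMap.map_smul, ContinuousLinearMap.map_add,
    interactionPicture_pairMap V f a hε, interactionPicture_pairMap V f a hε, hρ, hρ',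
    correctionDeriv]
  have hup : ∀ A B D : L2, (-((N : ℂ) * exp (((ε⁻¹ * s : ℝ) : ℂ) * I))) • A +
      exp (((ε⁻¹ * s : ℝ) : ℂ) * I) • (N : ℂ) • (B + D) =
      ((N : ℂ) * exp (((ε⁻¹ * s : ℝ) : ℂ) * I)) • ((B - A) + D) := fun A B D => by module
  rw [hup, ← map_sub, norm_smul, norm_mul (N : ℂ), norm_exp_ofReal_mul_I, mul_one, norm_real,
    Real.norm_eq_abs]
  have b1 := H₁ ((s * P - a) / ε) s (a / P) hs hst hs₀.le ht.le
  have b2 := H₂ (-((s * P + a) / ε)) s (by rwa [abs_of_nonneg hs])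
  refine (mul_le_of_le_one_left (norm_nonneg _) hN).trans ((norm_add_le _ _).trans ?_)
  rw [norm_pairMap hf hε, norm_pairMap hf hε, nrm_freeSchwartz]
  refine (add_le_add b1 b2).trans ?_
  have e1 : ∀ ρ : ℝ, |ρ| ≤ 1 + ρ ^ 2 := fun ρ => by nlinarith [sq_nonneg (|ρ| - 1), sq_abs ρ]
  -- The time to the collision in units of `ρ`: this turns the freezing error into a gain of `ε`.
  have e2 : s - a / P = ε / P * ((s * P - a) / ε) := by field_simp
  have e3 : C₁ / (1 + ((s * P - a) / ε) ^ 2) ^ 2 * |s - a / P| ≤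
      C₁ / P * (ε / (1 + ((s * P - a) / ε) ^ 2)) := by
    rw [e2, abs_mul, abs_of_pos (div_pos hε hP)]
    generalize (s * P - a) / ε = ρ
    calc C₁ / (1 + ρ ^ 2) ^ 2 * (ε / P * |ρ|) ≤ C₁ / (1 + ρ ^ 2) ^ 2 * (ε / P * (1 + ρ ^ 2)) := by
          gcongr
          exact e1 ρ
      _ = _ := by field_simp
  -- The `-P` packet moves away from the scatterer at `a > 0`, so its rescaled distance never drops
  -- below `a / ε`.
  have e4 : C₂ / (1 + (-((s * P + a) / ε)) ^ 2) ^ 1 ≤ C₂ / a ^ 2 * ε ^ 2 := by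
    have h5 : (a / ε) ^ 2 ≤ ((s * P + a) / ε) ^ 2 := by
      gcongr
      nlinarith [mul_nonneg hs hP.le]
    have h6 : C₂ / a ^ 2 * ε ^ 2 = C₂ / (a / ε) ^ 2 := by field_simp
    rw [pow_one, neg_sq, h6]
    exact div_le_div_of_nonneg_left h₂ (by positivity) (by linarith)
  have e5 : 0 ≤ ε / (1 + ((s * P - a) / ε) ^ 2) := by positivity
  have f1 : 0 ≤ C₁ / P := by positivity
  have f2 : 0 ≤ C₂ / a ^ 2 := by positivity
  nlinarith [mul_nonneg f2 e5, mul_nonneg f1 (sq_nonneg ε)]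

theorem exists_norm_evolution_sub_le (V : 𝓢(ℝ, ℝ)) {f : 𝓢(ℝ, ℝ)} (hf : nrm (toC f) = 1)
    {a P t : ℝ} (ha : 0 < a) (hP : 0 < P) (ht : a / P < t) :
    ∃ C, 0 ≤ C ∧ ∀ (N ε : ℝ) (hε : 0 < ε), |N| ≤ 1 →
      ‖propagator (ε ^ 2) (scaledHamiltonian V a ε) t (WithLp.toLp 2
          (correction V f a P N hε.ne' 0, (initialState f (ε ^ 2) ε P N).snd)) -
        stateGroup (ε ^ 2) ε⁻¹ t (WithLp.toLp 2
          (correction V f a P N hε.ne' t, (initialState f (ε ^ 2) ε P N).snd))‖ ≤ C * ε ^ 2 := by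
  have ht₀ : 0 < t := (div_pos ha hP).trans ht
  obtain ⟨C₁, h₁, H₁⟩ := exists_norm_correctionDeriv_add_le V hf ha hP ht
  obtain ⟨C₂, h₂, H₂⟩ := exists_norm_interactionPicture_correction_le V hf ha hP ht
  refine ⟨(C₁ + C₂) * (Real.pi / P + t), by positivity, fun N ε hε hN => ?_⟩
  obtain ⟨hU, hB⟩ := propagator_scaledHamiltonian V a hε.ne'
  have hd : ∀ s, HasDerivAt (fun s => (s * P - a) / ε) (1 * P / ε) s := fun s =>
    (((hasDerivAt_id s).mul_const P).sub_const a).div_const ε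
  -- A primitive of the residual bound: as `dρ/ds = P / ε`, the factor `ε (ε / P)` before `arctan`
  -- yields `ε / (1 + ρ²)`. The total variation of `arctan` is below `π`, uniformly in `ε`.
  have hb : ∀ s, HasDerivAt (fun s => (C₁ + C₂) *
      (ε * (ε / P) * Real.arctan ((s * P - a) / ε) + ε ^ 2 * s))
      ((C₁ + C₂) * (ε / (1 + ((s * P - a) / ε) ^ 2) + ε ^ 2)) s := fun s => by
    refine ((((hd s).arctan.const_mul (ε * (ε / P))).add
      ((hasDerivAt_id s).const_mul (ε ^ 2))).const_mul (C₁ + C₂)).congr_deriv ?_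
    generalize (s * P - a) / ε = ρ
    have : (1 + ρ ^ 2) ≠ 0 := by positivity
    field_simp
  have hy : ∀ s, HasDerivAt (fun s => (WithLp.toLp 2
      (correction V f a P N hε.ne' s, (initialState f (ε ^ 2) ε P N).snd) : StateSpace))
      (WithLp.toLp 2 (correctionDeriv V f a P N hε.ne' s, 0)) s := fun s =>
    hasDerivAt_withLp_iff.2 ⟨hasDerivAt_correction V hf a N hP.ne' hε s, hasDerivAt_const s _⟩
  refine (norm_evolution_sub_le hU.isUnitaryGroup (isUnitaryGroup_stateGroup _ _) hB hy hb
    ht₀.le fun s hs hst => ?_).trans ?_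
  · have u1 := H₁ N ε hε hN s hs hst
    have u2 := H₂ N ε hε hN s hs hst
    rw [stateGroup_neg_coupling, ← WithLp.toLp_add, Prod.mk_add_mk, zero_add]
    refine (norm_toLp_prod_le _ _).trans ?_
    rw [norm_neg, norm_smul (exp (((-(ε⁻¹ * s) : ℝ) : ℂ) * I)), norm_exp_ofReal_mul_I, one_mul]
    refine (add_le_add u1 u2).trans ?_
    nlinarith [mul_nonneg h₂ (sq_nonneg ε)]
  · have h₀ : 0 ≤ C₁ + C₂ := add_nonneg h₁ h₂
    rw [← mul_sub, mul_assoc (C₁ + C₂)]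
    refine mul_le_mul_of_nonneg_left ?_ h₀
    have g1 := (Real.arctan_lt_pi_div_two ((t * P - a) / ε)).le
    have g2 := (Real.neg_pi_div_two_lt_arctan ((0 * P - a) / ε)).le
    have g3 : ε * (ε / P) * (Real.arctan ((t * P - a) / ε) - Real.arctan ((0 * P - a) / ε)) ≤
        ε * (ε / P) * Real.pi := mul_le_mul_of_nonneg_left (by linarith) (by positivity)
    have g4 : (Real.pi / P + t) * ε ^ 2 = ε * (ε / P) * Real.pi + ε ^ 2 * t := by
      field_simp
    rw [g4]
    linarith

/-- Three errors add up: the residual, the correction already present at time `0`, and its distance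
from its limit at time `t`. The normalization enters only through `|N| ≤ 1`. -/
theorem exists_expansion (V : 𝓢(ℝ, ℝ)) {f : 𝓢(ℝ, ℝ)} (hf : nrm (toC f) = 1)
    {a P t : ℝ} (ha : 0 < a) (hP : 0 < P) (ht : a / P < t) :
    ∃ C, 0 < C ∧ ∀ N ε : ℝ, 0 < ε → |N| ≤ 1 → ∃ R : StateSpace,
      propagator (ε ^ 2) (scaledHamiltonian V a ε) t (initialState f (ε ^ 2) ε P N) =
        propagator (ε ^ 2) (scaledFreeHamiltonian ε) t (initialState f (ε ^ 2) ε P N) +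
          (ε : ℂ) • propagator (ε ^ 2) (scaledFreeHamiltonian ε) t
            (firstOrderState V f a P N ε) + R ∧
        ‖R‖ < C * ε ^ 2 := by
  obtain ⟨C, hC, H⟩ := exists_norm_evolution_sub_le V hf ha hP ht
  obtain ⟨C', hC', H', H''⟩ := exists_nrm_primMul_le (transition V P)
    (freeSchwartz ℝ 1 (a / P) (toC f))
  have htP : 0 < t * P - a := sub_pos.2 ((div_lt_iff₀ hP).1 ht)
  refine ⟨C + C' / a + C' / (t * P - a) + 1, by positivity, fun N ε hε hN => ?_⟩
  rw [propagator_scaledFreeHamiltonian hε.ne']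
  refine ⟨_, (add_sub_cancel _ _).symm, ?_⟩
  set U := propagator (ε ^ 2) (scaledHamiltonian V a ε)
  set x := initialState f (ε ^ 2) ε P N
  set y : ℝ → StateSpace := fun s => WithLp.toLp 2 (correction V f a P N hε.ne' s, 0) with hy
  have hx : ∀ s, (WithLp.toLp 2 (correction V f a P N hε.ne' s, x.snd) : StateSpace) =
      x + y s := by
    intro s
    refine WithLp.ofLp_injective 2 (Prod.ext ?_ ?_)
    · exact (zero_add _).symm
    · exact (add_zero _).symm
  have h1 := H N ε hε hN
  rw [hx, hx, map_add, map_add] at h1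
  have h2 : U t x - (stateGroup (ε ^ 2) ε⁻¹ t x +
      (ε : ℂ) • stateGroup (ε ^ 2) ε⁻¹ t (firstOrderState V f a P N ε)) =
      (U t x + U t (y 0) - (stateGroup (ε ^ 2) ε⁻¹ t x + stateGroup (ε ^ 2) ε⁻¹ t (y t))) -
        U t (y 0) + stateGroup (ε ^ 2) ε⁻¹ t (y t - (ε : ℂ) • firstOrderState V f a P N ε) := by
    rw [map_sub, map_smul]
    abel
  -- At time `0`, `ρ = -a / ε`: the transition has hardly begun.
  have h3 : ‖U t (y 0)‖ ≤ C' / a * ε ^ 2 := by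
    rw [LinearIsometryEquiv.norm_map]
    refine (norm_toLp_prod_le _ _).trans ?_
    rw [norm_zero, add_zero, correction, norm_smul, norm_pairMap hf hε, transitionProfile,
      nrm_freeSchwartz, nrm_modul, zero_mul, zero_sub, neg_div]
    refine (mul_le_mul (norm_correction_coeff a P N ε hN hε) (H'' (a / ε) (by positivity))
      (apply_nonneg _ _) hε.le).trans (le_of_eq ?_)
    field_simp
  -- At time `t`, `ρ = (t P - a) / ε`, which is positive precisely because `t` lies beyond the
  -- collision time.
  have h4 : ‖stateGroup (ε ^ 2) ε⁻¹ t (y t - (ε : ℂ) • firstOrderState V f a P N ε)‖ ≤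
      C' / (t * P - a) * ε ^ 2 := by
    rw [LinearIsometryEquiv.norm_map]
    have h5 : y t - (ε : ℂ) • firstOrderState V f a P N ε = WithLp.toLp 2
        (correction V f a P N hε.ne' t - (ε : ℂ) • (firstOrderState V f a P N ε).fst, 0) := by
      refine WithLp.ofLp_injective 2 (Prod.ext rfl ?_)
      change (0 : L2) - (ε : ℂ) • 0 = 0
      rw [smul_zero, sub_zero]
    rw [h5]
    refine (norm_toLp_prod_le _ _).trans ?_
    rw [norm_zero, add_zero, correction_sub V f a N t hP.ne' hε.ne', norm_smul,
      norm_pairMap hf hε, nrm_freeSchwartz, nrm_modul]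
    refine (mul_le_mul (norm_correction_coeff a P N ε hN hε)
      (H' ((t * P - a) / ε) (by positivity)) (apply_nonneg _ _) hε.le).trans (le_of_eq ?_)
    field_simp
  rw [h2]
  have h6 := norm_add_le (U t x + U t (y 0) -
    (stateGroup (ε ^ 2) ε⁻¹ t x + stateGroup (ε ^ 2) ε⁻¹ t (y t)) - U t (y 0))
    (stateGroup (ε ^ 2) ε⁻¹ t (y t - (ε : ℂ) • firstOrderState V f a P N ε))
  have h7 := norm_sub_le (U t x + U t (y 0) -
    (stateGroup (ε ^ 2) ε⁻¹ t x + stateGroup (ε ^ 2) ε⁻¹ t (y t))) (U t (y 0))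
  have h8 : 0 < ε ^ 2 := by positivity
  linarith

end EPR

end

/-! ### The expansion theorem for both normalizations -/

theorem theorem1p1 (V f : 𝓢(ℝ, ℝ)) (a P t : ℝ) (ha : 0 < a) (hP : 0 < P)
    (hf_even : ∀ x, f (-x) = f x) (hf_norm : ∫ x, f x ^ 2 = 1) (ht : a / P < t)
    (N : ℝ → ℝ)
    (hN : (∀ ε, N ε = EPR.normFactor f (ε ^ 2) ε P) ∨
      (∀ ε, N ε = EPR.normFactor' f (ε ^ 2) ε P)) :
    -- the two Hamiltonians generate unitary groups
    (∀ ε, 0 < ε →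
      EPR.IsPropagator (ε ^ 2) (EPR.scaledFreeHamiltonian ε)
        (EPR.propagator (ε ^ 2) (EPR.scaledFreeHamiltonian ε)) ∧
      EPR.IsPropagator (ε ^ 2) (EPR.scaledHamiltonian V a ε)
        (EPR.propagator (ε ^ 2) (EPR.scaledHamiltonian V a ε))) ∧
    -- the expansion of the evolved state
    ∃ C : ℝ, 0 < C ∧ ∃ ε₀ : ℝ, 0 < ε₀ ∧ ∀ ε, 0 < ε → ε < ε₀ →
      ∃ R : EPR.StateSpace,
        EPR.propagator (ε ^ 2) (EPR.scaledHamiltonian V a ε) t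
            (EPR.initialState f (ε ^ 2) ε P (N ε))
          = EPR.propagator (ε ^ 2) (EPR.scaledFreeHamiltonian ε) t
              (EPR.initialState f (ε ^ 2) ε P (N ε))
            + (ε : ℂ) • EPR.propagator (ε ^ 2) (EPR.scaledFreeHamiltonian ε) t
              (EPR.firstOrderState V f a P (N ε) ε)
            + R ∧
        ‖R‖ < C * ε ^ 2 := by
  have hf : EPR.nrm (EPR.toC f) = 1 := EPR.nrm_toC f hf_norm
  refine ⟨fun ε hε => ⟨?_, (EPR.propagator_scaledHamiltonian V a hε.ne').1⟩, ?_⟩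
  · rw [EPR.propagator_scaledFreeHamiltonian hε.ne']
    exact EPR.isPropagator_scaledFreeHamiltonian hε.ne'
  obtain ⟨C, hC, H⟩ := EPR.exists_expansion V hf ha hP ht
  -- Only here must `ε` be small: the squared normalization is at most `1` for every `ε`, while the
  -- other one requires an overlap of at most `1 / 2` in absolute value.
  obtain ⟨ε₀, hε₀, hN₁⟩ : ∃ ε₀ : ℝ, 0 < ε₀ ∧ ∀ ε, 0 < ε → ε < ε₀ → |N ε| ≤ 1 := by
    rcases hN with hN | hN
    · exact ⟨1, one_pos, fun ε _ _ => by
        rw [hN]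
        exact EPR.abs_normFactor_le _ _ _ _⟩
    · have h1 := (EPR.tendsto_overlap f hP).eventually
        (Metric.closedBall_mem_nhds (0 : ℝ) one_half_pos)
      obtain ⟨ε₀, hε₀, h2⟩ := mem_nhdsGT_iff_exists_Ioo_subset.1 h1
      refine ⟨ε₀, hε₀, fun ε hε hε' => ?_⟩
      rw [hN]
      have h3 : EPR.overlap f (ε ^ 2) ε P ∈ Metric.closedBall (0 : ℝ) (1 / 2) := h2 ⟨hε, hε'⟩
      exact EPR.abs_normFactor'_le _ _ _ _ (mem_closedBall_zero_iff.1 h3)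
  exact ⟨C, hC, ε₀, hε₀, fun ε hε hε' => H (N ε) ε hε (hN₁ ε hε hε')⟩
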